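/- **Conventions.** Let $S_{\mathbb Z}$ be the group of permutations of $\mathbb Z$ moving finitely many integers, $s_i=(i\ i{+}1)$, $\ell$ the number of inversions, and $S_n\subset S_{\mathbb Z}$ ($n\ge 0$) the subgroup fixing every integer outside $[1,n]$. Write $u\ominus v=\frac{u-v}{1-v}$. *Rings.* Let $\hat\Lambda(x\|a)$ be the ring of formal power series in the elements $e_k(x/a)$, $k\ge1$, with coefficients in $\mathbb Z[[a_i\mid i\in\mathbb Z]]$, where $\sum_{k}e_k(x/a)t^k=\prod_{i\le 0}\frac{1+x_it}{1+a_it}$, and let $\overleftarrow R(x;a)=\hat\Lambda(x\|a)[x_i,(1-x_i)^{-1}\mid i\in\mathbb Z]$ (the variables $x_i$ being adjoined freely). Its elements are expanded as formal power series in all the variables $x_i,a_i$. Let $\eta_a:\overleftarrow R(x;a)\to\hat\Lambda(x\|a)$ be the homomorphism of $\hat\Lambda(x\|a)$-algebras with $x_i\mapsto a_i$. *Grothendieck polynomials.* For $w$ a permutation of an interval $[p,q]$ the double Grothendieck polynomial $\mathfrak G^{[p,q]}_w(x;a)$ is defined by $\mathfrak G^{[p,q]}_{w_0}(x;a)=\prod_{p\le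 i,j\le q,\ i+j\le p+q-1}(x_i\ominus a_j)$ for the longest permutation $w_0$ of $[p,q]$, and $\mathfrak G^{[p,q]}_w=\frac{(1-x_{i+1})f-(1-x_i)s_i^x f}{x_i-x_{i+1}}$ with $f=\mathfrak G^{[p,q]}_{ws_i}$ whenever $p\le i<q$ and $w(i)<w(i+1)$; here $s_i^x$ exchanges $x_i$ and $x_{i+1}$. The back stable double Grothendieck polynomial $\overleftarrow{\mathfrak G}_w(x;a)\in\overleftarrow R(x;a)$ is the coefficientwise limit of $\mathfrak G^{[p,q]}_w(x;a)$ as $p\to-\infty$, $q\to\infty$. The double $K$-Stanley function is $G_w(x\|a)=\eta_a(\overleftarrow{\mathfrak G}_w(x;a))$. For a partition $\lambda$ put $G_\lambda(x\|a)=G_{w_\lambda}(x\|a)$, where $w_\lambda$ is the product of the $s_{j-i}$ over the boxes $(i,j)$ of $\lambda$, reading rows from bottom to top and each row from right to left. *Pipedreams.* Let $w\in S_n$. A *$w$-rectangular $K$-bumpless pipedream* $D$ is a tiling of the region with rows $1,\dots,n$ (top to bottom) and columns $1-n,\dots,n$ (left to right) by the six tiles: empty, NW elbow (joining the north and west sides),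 SE elbow (joining the south and east sides), horizontal, vertical, crossing, such that the tiles fit together into pipes; a pipe enters through every south boundary edge (labelled by its column) and none through the west boundary; pipes with nonpositive label cross no other pipe and exit through the north boundary; pipes with positive label exit through the east boundary, one in each row, and, when pipes are followed from southwest to northeast and every crossing of two pipes that have already crossed is ignored, the pipe exiting in row $i$ is labelled $w(i)$. Its weight is $$\mathrm{wt}(D)=\prod_{\text{empty tiles }(i,j)}\bigl(-(x_i\ominus a_j)\bigr)\prod_{\text{NW elbows }(i,j)}\bigl(1-(x_i\ominus a_j)\bigr).$$ The partition $\lambda(D)$ is the one whose boundary, inside the $n\times n$ box and starting at the northeast corner, is obtained by reading the north boundary edges of $D$ from right to left, an edge without a pipe being a step to the left and an edge with a pipe a step down. **Theorem.** Let $n\ge0$ and $w\in S_n$. The limits defining $\overleftarrow{\mathfrak G}_w(x;a)$ and $\overleftarrow{\mathfrak G}_{w_\lambda}(x;a)$ (for every partition $\lambda$) exist and are expansions of unique elements of $\overleftarrow R(x;a)$, and $$\overleftarrow{\mathfrak G}_w(x;a)=(-1)^{\ell(w)}\sum_D(-1)^{|\lambda(D)|}\,\mathrm{wt}(D)\,G_{\lambda(D)}(x\|a),$$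 $$G_w(x\|a)=(-1)^{\ell(w)}\sum_D(-1)^{|\lambda(D)|}\,\eta_a(\mathrm{wt}(D))\,G_{\lambda(D)}(x\|a),$$ both sums over all $w$-rectangular $K$-bumpless pipedreams $D$. -/

import Mathlib

namespace BackStable

noncomputable section

/-- `u ⊖ v = (u - v) / (1 - v)`; it is only used where `1 - v` is a unit. -/
def ominus {A : Type*} [CommRing A] (u v : A) : A := (u - v) * Ring.inverse (1 - v)

/-! ### The rings -/

/-- The ring `Λ̂(x‖a)`: formal power series in the super elementary symmetric functions `e_k(x/a)`,
`k ≥ 1` (the variables `Sum.inl k`), with coefficients in `ℤ[[a_i | i ∈ ℤ]]`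
(the variables `Sum.inr i`). -/
abbrev LamHat : Type := MvPowerSeries (ℕ+ ⊕ ℤ) ℤ

/-- The variable `a_i`. -/
def LamHat.a (i : ℤ) : LamHat := MvPowerSeries.X (Sum.inr i)

/-- The multiplicative set generated by the `1 - x_i`, `i ∈ ℤ`, in the polynomial ring in the `x_i`
over `Λ̂(x‖a)`. -/
abbrev oneSubX : Submonoid (MvPolynomial ℤ LamHat) :=
  Submonoid.closure (Set.range fun i : ℤ => 1 - MvPolynomial.X i)

/-- The double back stable ring `Λ̂(x‖a) ⊗_{R(a)} R(x;a) = Λ̂(x‖a)[x_i, (1 - x_i)⁻¹ | i ∈ ℤ]`. -/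
abbrev BackRing : Type := Localization oneSubX

/-- The inclusion of polynomials in the `x_i` over `Λ̂(x‖a)` into the double back stable ring. -/
def BackRing.ofPoly : MvPolynomial ℤ LamHat →ₐ[LamHat] BackRing :=
  IsScalarTower.toAlgHom LamHat (MvPolynomial ℤ LamHat) BackRing

/-- The element `x_i` of the double back stable ring. -/
def BackRing.x (i : ℤ) : BackRing := BackRing.ofPoly (MvPolynomial.X i)

/-- The element `a_i` of the double back stable ring. -/
def BackRing.a (i : ℤ) : BackRing := algebraMap LamHat BackRing (LamHat.a i)

theorem LamHat.isUnit_one_sub_a (i : ℤ) : IsUnit (1 - LamHat.a i) := by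
  rw [MvPowerSeries.isUnit_iff_constantCoeff]
  simp [LamHat.a]

theorem isUnit_map_oneSubX {A : Type*} [CommRing A] (f : MvPolynomial ℤ LamHat →+* A)
    (h : ∀ i, IsUnit (1 - f (MvPolynomial.X i))) (y : oneSubX) : IsUnit (f y) := by
  have : oneSubX ≤ (IsUnit.submonoid A).comap f := by
    rw [Submonoid.closure_le]
    rintro _ ⟨i, rfl⟩
    simpa [IsUnit.mem_submonoid_iff] using h i
  exact this y.2

/-! ### The map `η_a` -/

/-- The homomorphism `η_a` from the double back stable ring to `Λ̂(x‖a)`: it is the identity on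
`Λ̂(x‖a)` and sends `x_i` to `a_i`. -/
def etaA : BackRing →ₐ[LamHat] LamHat :=
  IsLocalization.liftAlgHom (M := oneSubX) (S := BackRing) (f := MvPolynomial.aeval LamHat.a)
    (isUnit_map_oneSubX (MvPolynomial.aeval LamHat.a : _ →ₐ[LamHat] LamHat).toRingHom
      fun i => by simpa using LamHat.isUnit_one_sub_a i)

/-! ### Realization by power series in the variables `x_i` and `a_i` -/

/-- Formal power series in the variables `x_i` (`Sum.inl i`) and `a_i` (`Sum.inr i`), `i ∈ ℤ`. -/
abbrev Series : Type := MvPowerSeries (ℤ ⊕ ℤ) ℤ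

open Classical in
/-- `e_k(x_-)`, the elementary symmetric function in the variables `x_i`, `i ≤ 0`. -/
def eX (k : ℕ) : Series := fun d =>
  if d.degree = k ∧ (∀ i, d (Sum.inr i) = 0) ∧ (∀ i > 0, d (Sum.inl i) = 0) ∧
    (∀ i, d (Sum.inl i) ≤ 1) then 1 else 0

open Classical in
/-- `h_k(a_-)`, the complete homogeneous symmetric function in the variables `a_i`, `i ≤ 0`. -/
def hA (k : ℕ) : Series := fun d =>
  if d.degree = k ∧ (∀ i, d (Sum.inl i) = 0) ∧ (∀ i > 0, d (Sum.inr i) = 0) then 1 else 0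

/-- `e_k(x/a) = ∑_j (-1)^j e_{k-j}(x_-) h_j(a_-)`, the image of `e_k` under the ring homomorphism
that sends the power sum `p_k` to `p_k(x_-) - p_k(a_-)`; in other words, the coefficient of `t^k`
in `∏_{i ≤ 0} (1 + x_i t) / (1 + a_i t)`. -/
def eSuper (k : ℕ) : Series :=
  ∑ j ∈ Finset.range (k + 1), (-1) ^ j * eX (k - j) * hA j

/-- The series `e_k(x/a)` and `a_i` that are substituted for the variables of `LamHat`. -/
def lamVal : ℕ+ ⊕ ℤ → Series
  | Sum.inl k => eSuper k
  | Sum.inr i => MvPowerSeries.X (Sum.inr i)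

theorem degree_of_coeff_eSuper_ne_zero {k : ℕ} {d : ℤ ⊕ ℤ →₀ ℕ}
    (h : MvPowerSeries.coeff d (eSuper k) ≠ 0) : d.degree = k := by
  classical
  rw [eSuper, map_sum] at h
  obtain ⟨l, hl, h⟩ := Finset.exists_ne_zero_of_sum_ne_zero h
  have hc : ((-1) ^ l * eX (k - l) * hA l : Series) =
      MvPowerSeries.C ((-1) ^ l) * (eX (k - l) * hA l) := by
    rw [mul_assoc]; simp
  simp only [hc, MvPowerSeries.coeff_C_mul] at h
  have h := right_ne_zero_of_mul h
  rw [MvPowerSeries.coeff_mul] at h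
  obtain ⟨⟨s, t⟩, hst, h⟩ := Finset.exists_ne_zero_of_sum_ne_zero h
  have h1 : eX (k - l) s ≠ 0 := left_ne_zero_of_mul h
  have h2 : hA l t ≠ 0 := right_ne_zero_of_mul h
  simp only [eX, hA, ne_eq, ite_eq_right_iff, one_ne_zero, imp_false, not_not] at h1 h2
  rw [Finset.HasAntidiagonal.mem_antidiagonal] at hst
  rw [Finset.mem_range] at hl
  rw [← hst, map_add, h1.1, h2.1]
  omega

theorem hasSubst_lamVal : MvPowerSeries.HasSubst lamVal where
  const_coeff s := by
    rcases s with k | i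
    · have : MvPowerSeries.coeff 0 (eSuper k) = 0 := by
        by_contra h
        have := degree_of_coeff_eSuper_ne_zero h
        simp only [map_zero] at this
        exact k.ne_zero this.symm
      simpa [lamVal] using this
    · simp [lamVal]
  coeff_zero d := by
    classical
    have hsub : {s | MvPowerSeries.coeff d (lamVal s) ≠ 0} ⊆
        (Sum.inl '' {k : ℕ+ | (k : ℕ) = d.degree}) ∪
          (Sum.inr '' {i : ℤ | d (Sum.inr i) ≠ 0}) := by
      rintro (k | i) hs
      · exact Or.inl ⟨k, (degree_of_coeff_eSuper_ne_zero hs).symm, rfl⟩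
      · refine Or.inr ⟨i, ?_, rfl⟩
        simp only [lamVal, MvPowerSeries.coeff_X, Set.mem_ofPred_eq, ne_eq, ite_eq_right_iff,
          one_ne_zero, imp_false, not_not] at hs
        simp [hs]
    refine Set.Finite.subset (Set.Finite.union ?_ ?_) hsub
    · refine Set.Finite.image _ (Set.Subsingleton.finite ?_)
      intro a ha b hb
      exact PNat.eq (ha.trans hb.symm)
    · refine Set.Finite.image _ ?_
      have := d.support.finite_toSet.preimage (f := Sum.inr) (Sum.inr_injective.injOn)
      exact this.subset fun i hi => by simpa using hi

/-- The realization of elements of `Λ̂(x‖a)` as power series in the `x_i` and `a_i`. -/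
def realizeLam : LamHat →ₐ[ℤ] Series := MvPowerSeries.substAlgHom hasSubst_lamVal

/-- The realization of elements of the double back stable ring as power series in the `x_i` and
`a_i`. -/
def realize : BackRing →+* Series :=
  IsLocalization.lift (M := oneSubX) (S := BackRing)
    (isUnit_map_oneSubX (MvPolynomial.eval₂Hom (realizeLam : LamHat →+* Series)
        fun i => MvPowerSeries.X (Sum.inl i))
      fun i => by
        rw [MvPowerSeries.isUnit_iff_constantCoeff]
        simp)

/-! ### Double Grothendieck polynomials -/

theorem sub_dvd_sub_rename {A : Type*} [CommRing A] (i j : ℤ) (f : MvPolynomial ℤ A) :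
    (MvPolynomial.X i - MvPolynomial.X j) ∣ f - MvPolynomial.rename (Equiv.swap i j) f := by
  induction f using MvPolynomial.induction_on with
  | C c => simp
  | add f g hf hg =>
    rw [map_add, add_sub_add_comm]
    exact dvd_add hf hg
  | mul_X f k hf =>
    rw [map_mul, MvPolynomial.rename_X]
    have hk : (MvPolynomial.X i - MvPolynomial.X j : MvPolynomial ℤ A) ∣
        MvPolynomial.X k - MvPolynomial.X (Equiv.swap i j k) := by
      rcases eq_or_ne k i with rfl | hi
      · simp
      rcases eq_or_ne k j with rfl | hj
      · rw [Equiv.swap_apply_right]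
        exact ⟨-1, by ring⟩
      · simp [Equiv.swap_apply_of_ne_of_ne hi hj]
    have : f * MvPolynomial.X k -
        MvPolynomial.rename (Equiv.swap i j) f * MvPolynomial.X (Equiv.swap i j k) =
        (f - MvPolynomial.rename (Equiv.swap i j) f) * MvPolynomial.X k +
        MvPolynomial.rename (Equiv.swap i j) f *
          (MvPolynomial.X k - MvPolynomial.X (Equiv.swap i j k)) := by ring
    rw [this]
    exact dvd_add (hf.mul_right _) (hk.mul_left _)

/-- The divided difference `A_i f = (f - s_i f) / (x_i - x_{i+1})`. -/
def divDiff {A : Type*} [CommRing A] (i : ℤ) (f : MvPolynomial ℤ A) : MvPolynomial ℤ A :=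
  (sub_dvd_sub_rename i (i + 1) f).choose

theorem divDiff_spec {A : Type*} [CommRing A] (i : ℤ) (f : MvPolynomial ℤ A) :
    f - MvPolynomial.rename (Equiv.swap i (i + 1)) f =
      (MvPolynomial.X i - MvPolynomial.X (i + 1)) * divDiff i f :=
  (sub_dvd_sub_rename i (i + 1) f).choose_spec

/-- The isobaric divided difference operator
`f ↦ ((1 - x_{i+1}) f - (1 - x_i) s_i f) / (x_i - x_{i+1})`. -/
def demazure {A : Type*} [CommRing A] (i : ℤ) (f : MvPolynomial ℤ A) : MvPolynomial ℤ A :=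
  divDiff i ((1 - MvPolynomial.X (i + 1)) * f)

/-- The pairs in `[p, q]` that are not inversions of `w`. -/
def nonInv (p q : ℤ) (w : Equiv.Perm ℤ) : Finset (ℤ × ℤ) :=
  (Finset.Icc p q ×ˢ Finset.Icc p q).filter fun c => c.1 < c.2 ∧ w c.1 < w c.2

theorem card_nonInv_lt {p q : ℤ} {w : Equiv.Perm ℤ} {i : ℤ}
    (h : i ∈ Finset.Ico p q ∧ w i < w (i + 1)) :
    (nonInv p q (w * Equiv.swap i (i + 1))).card < (nonInv p q w).card := by
  obtain ⟨hi, hw⟩ := h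
  rw [Finset.mem_Ico] at hi
  have hs : ∀ k : ℤ, (Equiv.swap i (i + 1) k = i + 1 ∧ k = i) ∨
      (Equiv.swap i (i + 1) k = i ∧ k = i + 1) ∨
      (Equiv.swap i (i + 1) k = k ∧ k ≠ i ∧ k ≠ i + 1) := by
    intro k
    rcases eq_or_ne k i with rfl | h1
    · simp
    rcases eq_or_ne k (i + 1) with rfl | h2
    · simp
    · simp [Equiv.swap_apply_of_ne_of_ne h1 h2, h1, h2]
  have hmem : (i, i + 1) ∈ nonInv p q w := by
    simp only [nonInv, Finset.mem_filter, Finset.mem_product, Finset.mem_Icc]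
    exact ⟨⟨⟨hi.1, by omega⟩, by omega, by omega⟩, by omega, hw⟩
  rw [← Finset.card_erase_add_one hmem, Nat.lt_add_one_iff]
  refine Finset.card_le_card_of_injOn
    (fun c => (Equiv.swap i (i + 1) c.1, Equiv.swap i (i + 1) c.2)) ?_ ?_
  · rintro ⟨a, b⟩ hab
    rw [Finset.mem_coe] at hab ⊢
    rw [nonInv, Finset.mem_filter, Finset.mem_product, Finset.mem_Icc, Finset.mem_Icc] at hab
    simp only [Equiv.Perm.mul_apply] at hab
    simp only [nonInv, Finset.mem_erase, Finset.mem_filter, Finset.mem_product, Finset.mem_Icc,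
      ne_eq, Prod.mk.injEq]
    obtain ⟨⟨⟨ha1, ha2⟩, hb1, hb2⟩, hlt, hwl⟩ := hab
    rcases hs a with ⟨ea, rfl⟩ | ⟨ea, rfl⟩ | ⟨ea, na⟩ <;>
    rcases hs b with ⟨eb, hb⟩ | ⟨eb, hb⟩ | ⟨eb, nb⟩ <;>
    rw [ea, eb] at hwl ⊢ <;>
    refine ⟨?_, ⟨⟨?_, ?_⟩, ?_, ?_⟩, ?_, hwl⟩ <;> omega
  · rintro ⟨a, b⟩ _ ⟨c, d⟩ _ hcd
    simp only [Prod.mk.injEq, EmbeddingLike.apply_eq_iff_eq] at hcd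
    exact Prod.ext hcd.1 hcd.2

open Classical in
/-- The double Grothendieck polynomial `𝔊_w^{[p,q]}(x;a)` of a permutation `w` of the interval
`[p, q]`, in the variables `x_p, …, x_q` and `a_p, …, a_q`. For the longest permutation `w₀` of
`[p, q]` it is the product of the `x_i ⊖ a_j` with `(i - p + 1) + (j - p + 1) ≤ q - p + 1`, and
`𝔊_w = π_i 𝔊_{w s_i}` whenever `w s_i > w`; the ascent `i` used here does not matter, since the
operators `π_i = demazure i` satisfy the braid relations. -/
def doubleGroth (p q : ℤ) (w : Equiv.Perm ℤ) : MvPolynomial ℤ LamHat :=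
  if h : ∃ i, i ∈ Finset.Ico p q ∧ w i < w (i + 1) then
    demazure h.choose (doubleGroth p q (w * Equiv.swap h.choose (h.choose + 1)))
  else
    ∏ c ∈ (Finset.Icc p q ×ˢ Finset.Icc p q).filter (fun c => c.1 + c.2 ≤ p + q - 1),
      ominus (MvPolynomial.X c.1) (MvPolynomial.C (LamHat.a c.2))
termination_by (nonInv p q w).card
decreasing_by exact card_nonInv_lt h.choose_spec

/-! ### Back stable double Grothendieck polynomials and double `K`-Stanley functions -/

/-- `f` is the limit of the double Grothendieck polynomials `𝔊_w^{[p,q]}(x;a)` as `p → -∞` and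
`q → ∞`: the coefficient of every monomial in the `x_i` and `a_i` is eventually that of `f`. -/
def IsBackStableLimit (w : Equiv.Perm ℤ) (f : BackRing) : Prop :=
  ∀ d : ℤ ⊕ ℤ →₀ ℕ, ∀ᶠ pq : ℤ × ℤ in Filter.atBot ×ˢ Filter.atTop,
    MvPowerSeries.coeff d (realize (BackRing.ofPoly (doubleGroth pq.1 pq.2 w))) =
      MvPowerSeries.coeff d (realize f)

/-- The back stable double Grothendieck polynomial of `w`: the element of the double back stable
ring that is the limit of the double Grothendieck polynomials. -/
def backGroth (w : Equiv.Perm ℤ) : BackRing := Classical.epsilon (IsBackStableLimit w)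

/-- The double `K`-Stanley function `G_w(x‖a)`. -/
def kStanley (w : Equiv.Perm ℤ) : LamHat := etaA (backGroth w)

/-- The Grassmannian permutation `w_μ` of a partition `μ`: the product of the simple reflections
`s_{j-i}` over the boxes `(i, j)` of `μ`, the rows being taken from the last to the first and each
row being read from right to left. For instance `w_{(3,2)} = s_0 s_{-1} s_2 s_1 s_0`. -/
def grassPerm (μ : YoungDiagram) : Equiv.Perm ℤ :=
  ((List.range (μ.colLen 0)).reverse.map fun i =>
    ((List.range (μ.rowLen i)).reverse.map fun j =>
      Equiv.swap ((j : ℤ) - i) ((j : ℤ) - i + 1)).prod).prod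

/-- The Grassmannian double `K`-Stanley function `G_μ(x‖a)`. -/
def kStanleyGrass (μ : YoungDiagram) : LamHat := kStanley (grassPerm μ)

/-- The length of a permutation, its number of inversions. -/
def len (w : Equiv.Perm ℤ) : ℕ := Set.ncard {c : ℤ × ℤ | c.1 < c.2 ∧ w c.2 < w c.1}

/-! ### Rectangular `K`-bumpless pipedreams -/

/-- The six tiles. The tile `nw` has an elbow that connects its north and west sides, the tile `se`
an elbow that connects its south and east sides. -/
inductive Tile
  | empty | nw | se | horiz | cross | vert
  deriving DecidableEq

instance : Fintype Tile where
  elems := {Tile.empty, Tile.nw, Tile.se, Tile.horiz, Tile.cross, Tile.vert}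
  complete t := by cases t <;> decide

/-- The tiles with a pipe through the north side. -/
def Tile.north (t : Tile) : Prop := t = nw ∨ t = cross ∨ t = vert

/-- The tiles with a pipe through the south side. -/
def Tile.south (t : Tile) : Prop := t = se ∨ t = cross ∨ t = vert

/-- The tiles with a pipe through the east side. -/
def Tile.east (t : Tile) : Prop := t = se ∨ t = cross ∨ t = horiz

/-- The tiles with a pipe through the west side. -/
def Tile.west (t : Tile) : Prop := t = nw ∨ t = cross ∨ t = horiz

/-- The rectangular region with rows `1, …, n` (from top to bottom) and columns `1 - n, …, n` (from
left to right). -/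
def rect (n : ℕ) : Finset (ℤ × ℤ) := Finset.Icc 1 (n : ℤ) ×ˢ Finset.Icc (1 - (n : ℤ)) n

/-- The fillings of the rectangle by tiles. -/
abbrev Filling (n : ℕ) : Type := rect n → Tile

open Classical in
/-- The tile in row `i` and column `j`. -/
def Filling.tile {n : ℕ} (D : Filling n) (i j : ℤ) : Tile :=
  if h : (i, j) ∈ rect n then D ⟨(i, j), h⟩ else Tile.empty

/-- The tiles of `D` fit together, a pipe enters through every edge of the south boundary, none
enters through the west boundary, and a pipe leaves through every edge of the east boundary. -/
structure IsBumpless {n : ℕ} (D : Filling n) : Prop where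
  fit_vert : ∀ i j, (i, j) ∈ rect n → (i + 1, j) ∈ rect n →
    ((D.tile i j).south ↔ (D.tile (i + 1) j).north)
  fit_horiz : ∀ i j, (i, j) ∈ rect n → (i, j + 1) ∈ rect n →
    ((D.tile i j).east ↔ (D.tile i (j + 1)).west)
  south_bdry : ∀ j, ((n : ℤ), j) ∈ rect n → (D.tile n j).south
  west_bdry : ∀ i, (i, 1 - (n : ℤ)) ∈ rect n → ¬ (D.tile i (1 - n)).west
  east_bdry : ∀ i, (i, (n : ℤ)) ∈ rect n → (D.tile i n).east

/-- Here `v i j` is the label of the pipe through the south side of the tile `(i, j)` and `h i j`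
the label of the pipe through its west side. The two pipes that enter the crossing tile `(i, j)`
have already crossed, i.e. they have entered an earlier crossing tile together. -/
def AlreadyCrossed {n : ℕ} (D : Filling n) (v h : ℤ → ℤ → ℤ) (i j : ℤ) : Prop :=
  ∃ i' j', i ≤ i' ∧ j' ≤ j ∧ (i', j') ≠ (i, j) ∧ D.tile i' j' = Tile.cross ∧
    ((v i' j' = v i j ∧ h i' j' = h i j) ∨ (v i' j' = h i j ∧ h i' j' = v i j))

/-- `v i j` and `h i j` are the labels of the pipes through the south and the west side of the tile
`(i, j)`, when the pipes are followed from the south boundary, where they are labelled by their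
columns, to the north and east, and when every crossing of two pipes that have already crossed is
ignored (the pipe from the west then leaves to the north, the one from the south to the east).
Labels of sides without a pipe have no meaning. -/
structure IsLabelling {n : ℕ} (D : Filling n) (v h : ℤ → ℤ → ℤ) : Prop where
  start : ∀ j, ((n : ℤ), j) ∈ rect n → v n j = j
  nw : ∀ i j, D.tile i j = Tile.nw → v (i - 1) j = h i j
  se : ∀ i j, D.tile i j = Tile.se → h i (j + 1) = v i j
  horiz : ∀ i j, D.tile i j = Tile.horiz → h i (j + 1) = h i j
  vert : ∀ i j, D.tile i j = Tile.vert → v (i - 1) j = v i j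
  cross : ∀ i j, D.tile i j = Tile.cross → ¬ AlreadyCrossed D v h i j →
    v (i - 1) j = v i j ∧ h i (j + 1) = h i j
  cross_again : ∀ i j, D.tile i j = Tile.cross → AlreadyCrossed D v h i j →
    v (i - 1) j = h i j ∧ h i (j + 1) = v i j

/-- `D` is a `w`-rectangular `K`-bumpless pipedream: the pipe that leaves to the east in row `i` has
the label `w i`, the pipes that leave to the north have nonpositive labels, and no pipe with a
nonpositive label crosses another pipe. -/
def IsRectBPD {n : ℕ} (w : Equiv.Perm ℤ) (D : Filling n) : Prop :=
  IsBumpless D ∧ ∃ v h : ℤ → ℤ → ℤ, IsLabelling D v h ∧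
    (∀ i, (i, (n : ℤ)) ∈ rect n → h i (n + 1) = w i) ∧
    (∀ j, (1, j) ∈ rect n → (D.tile 1 j).north → v 0 j ≤ 0) ∧
    (∀ i j, D.tile i j = Tile.cross → 0 < v i j ∧ 0 < h i j)

open Classical in
/-- The finite set of `w`-rectangular `K`-bumpless pipedreams. -/
def rectBPDs (n : ℕ) (w : Equiv.Perm ℤ) : Finset (Filling n) :=
  Finset.univ.filter fun D => IsRectBPD w D

/-- The weight of a rectangular `K`-bumpless pipedream: the product of `-(x_i ⊖ a_j)` over the empty
tiles `(i, j)` and of `1 - (x_i ⊖ a_j)` over the tiles `(i, j)` with a northwest elbow. -/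
def wt {n : ℕ} (D : Filling n) : BackRing :=
  (∏ c ∈ Finset.univ.filter (fun c => D c = Tile.empty),
    -ominus (BackRing.x c.1.1) (BackRing.a c.1.2)) *
  ∏ c ∈ Finset.univ.filter (fun c => D c = Tile.nw),
    (1 - ominus (BackRing.x c.1.1) (BackRing.a c.1.2))

open Classical in
/-- The partition `λ(D)`, whose boundary inside the `n × n` box is obtained by reading the edges of
the north boundary from right to left, an edge without a pipe being a step to the left and an edge
with a pipe a step down. So the row of the `r`-th pipe from the right has as many boxes as there are
edges without a pipe to the left of that pipe: the box `(r, s)` (counted from `0`) lies in `λ(D)` if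
and only if there is a pipe with at least `r` pipes to its right and more than `s` edges without a
pipe to its left. -/
def shape {n : ℕ} (D : Filling n) : YoungDiagram where
  cells := (Finset.range n ×ˢ Finset.range n).filter fun b =>
    ∃ c ∈ Finset.Icc (1 - (n : ℤ)) n, (D.tile 1 c).north ∧
      b.1 ≤ ((Finset.Ioc c n).filter fun c' => (D.tile 1 c').north).card ∧
      b.2 < ((Finset.Ico (1 - (n : ℤ)) c).filter fun c' => ¬ (D.tile 1 c').north).card
  isLowerSet := by
    rintro ⟨r, s⟩ ⟨r', s'⟩ hle hb
    obtain ⟨h1, h2⟩ : r' ≤ r ∧ s' ≤ s := hle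
    simp only [Finset.coe_filter, Finset.mem_product, Finset.mem_range, Set.mem_ofPred_eq] at hb ⊢
    obtain ⟨⟨hr, hs⟩, c, hc, hn, hbr, hbs⟩ := hb
    exact ⟨⟨by omega, by omega⟩, c, hc, hn, by omega, by omega⟩

end

end BackStable

open BackStable

/-! Every polynomial involved is a partition function of a coloured lattice model. The tile in row i
and column j has the parameter z = (1 - x_i)/(1 - a_j) = 1 - (x_i ⊖ a_j); an empty tile weighs z -
1, a northwest elbow z, every other tile 1. At a crossing the smaller label leaves to the east and
the larger one to the north, which encodes that repeated crossings are ignored. `gridSum` is the sum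
over the fillings of a square in which every column sends in a pipe from the south, the pipe w(i)
leaves to the east in row i, and nothing leaves to the north.

The model satisfies the Yang–Baxter equation (`rOp_tileOp`). It yields an exchange relation for two
adjacent rows (`latticeSum_exchange`), which up to sign is the recursion by isobaric divided
differences. For the longest permutation a single filling survives and gives the defining product.
Hence the double Grothendieck polynomial of w is (-1)^ℓ(w) times `gridSum`
(`doubleGroth_eq_gridSum`).

For w in S_n the square is cut between the rows 0 and 1. Above the cut the pipes 0, -1, ... leave in
decreasing order from bottom to top, and this part vanishes unless the labels increase along the cut
(`upperSum_eq_zero`). So below the cut the nonpositive pipes cross nothing, the columns left of 1 -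
n are straight, and what remains is a filling of the rectangle (`gridSum_eq_posCross`). The part
above the cut depends only on which edges of the cut carry a pipe. For a Grassmannian permutation
the part below the cut has one filling, of weight 1 (`gridSum_eq_upperSum`), and w_{λ(D)} is the
Grassmannian permutation with the same occupied edges as D. This gives the expansion
`gridSum_eq_sum_rectBPDs`. To match sorted labels with the rule about pipes that have already
crossed, one shows that two pipes have crossed exactly if their labels are inverted along the
frontier of the processed tiles (`frontierInv`).

The expansion has the same finite index set and the same weights for all p ≤ 1 - n and q ≥ n, so
limits are needed only for the w_λ. There coefficients stabilize because x_p = a_p = 0 removes row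
and column p (`gridSum_unit_corner`). The limit does not involve x_i for i > 0 and is symmetric in
the x_i with i ≤ 0; by the fundamental theorem on symmetric polynomials, applied degree by degree in
the a_i, it is a series in the e_k(x/a) (`IsBackSymm.exists_realizeLam`). It therefore lies in
Λ̂(x‖a), where η_a is the identity, and equals G_λ. Uniqueness is the injectivity of the realization
(`realize_injective`), which rests on the algebraic independence of the elementary symmetric
polynomials. The second formula is the image of the first under η_a. -/

namespace BackStable

noncomputable section

/-! ### The coloured lattice model -/

section Lattice

variable {A : Type*} [CommRing A]

open Classical in
/-- The weighted sum over the tiles with given west label `c` and south label `s`; the continuation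
`ψ` receives the labels of the east and the north side. Crossings of labels `h`, `v` are only
admitted if `P h v`. -/
def tileOp (P : ℤ → ℤ → Prop) (z : A) :
    Option ℤ → Option ℤ → (Option ℤ → Option ℤ → A) → A
  | none, none, ψ => (z - 1) * ψ none none
  | some h, none, ψ => z * ψ none (some h) + ψ (some h) none
  | none, some v, ψ => ψ none (some v) + ψ (some v) none
  | some h, some v, ψ => if P h v then ψ (some (min h v)) (some (max h v)) else 0

/-- The transfer operator of a row: `c` is the label at the west boundary, `ss` are the labels of
the south sides, and the continuation `φ` receives the labels of the north sides and the label at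
the east boundary. -/
def row (P : ℤ → ℤ → Prop) (X : A) :
    List A → Option ℤ → List (Option ℤ) → (List (Option ℤ) → Option ℤ → A) → A
  | [], c, [], φ => φ [] c
  | α :: as, c, s :: ss, φ =>
    tileOp P (X * α) c s fun m n => row P X as m ss fun ts d => φ (n :: ts) d
  | _, _, _, _ => 0

open Classical in
/-- The partition function of several rows, listed from bottom to top with their parameters and the
labels at their east ends. -/
def latticeSum (P : ℤ → ℤ → Prop) (as : List A) :
    List (A × ℤ) → List (Option ℤ) → (List (Option ℤ) → A) → A
  | [], ss, φ => φ ss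
  | r :: rs, ss, φ =>
    row P r.1 as none ss fun ts d => if d = some r.2 then latticeSum P as rs ts φ else 0

/-- Crossings are always admitted. -/
abbrev anyCross : ℤ → ℤ → Prop := fun _ _ => True

variable (P : ℤ → ℤ → Prop)

theorem tileOp_add (z : A) (c s : Option ℤ) (φ ψ : Option ℤ → Option ℤ → A) :
    tileOp P z c s (fun m n => φ m n + ψ m n) = tileOp P z c s φ + tileOp P z c s ψ := by
  rcases c with _ | c <;> rcases s with _ | s <;> simp only [tileOp]
  · ring
  · ring
  · ring
  · split_ifs <;> simp

theorem tileOp_smul (z k : A) (c s : Option ℤ) (φ : Option ℤ → Option ℤ → A) :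
    tileOp P z c s (fun m n => k * φ m n) = k * tileOp P z c s φ := by
  rcases c with _ | c <;> rcases s with _ | s <;> simp only [tileOp]
  · ring
  · ring
  · ring
  · split_ifs <;> simp

theorem row_add (X : A) (as : List A) (c : Option ℤ) (ss : List (Option ℤ))
    (φ ψ : List (Option ℤ) → Option ℤ → A) :
    row P X as c ss (fun ts d => φ ts d + ψ ts d) = row P X as c ss φ + row P X as c ss ψ := by
  induction as generalizing c ss φ ψ with
  | nil => cases ss <;> simp [row]
  | cons α as ih =>
    cases ss with
    | nil => simp [row]
    | cons s ss => simp only [row, ih, tileOp_add]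

theorem row_smul (X k : A) (as : List A) (c : Option ℤ) (ss : List (Option ℤ))
    (φ : List (Option ℤ) → Option ℤ → A) :
    row P X as c ss (fun ts d => k * φ ts d) = k * row P X as c ss φ := by
  induction as generalizing c ss φ with
  | nil => cases ss <;> simp [row]
  | cons α as ih =>
    cases ss with
    | nil => simp [row]
    | cons s ss => simp only [row, ih, tileOp_smul]

@[simp] theorem row_zero (X : A) (as : List A) (c : Option ℤ) (ss : List (Option ℤ)) :
    row P X as c ss (fun _ _ => (0 : A)) = 0 := by
  simpa using row_smul P X 0 as c ss fun _ _ => 0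

/-- A tile is a linear combination of values of its continuation, so it commutes with the linear
operator `row`. This allows two rows to be processed column by column. -/
theorem row_tileOp (X z : A) (as : List A) (c : Option ℤ) (ss : List (Option ℤ)) (u s : Option ℤ)
    (F : Option ℤ → Option ℤ → List (Option ℤ) → Option ℤ → A) :
    row P X as c ss (fun ts d => tileOp P z u s fun m n => F m n ts d) =
      tileOp P z u s fun m n => row P X as c ss (F m n) := by
  rcases u with _ | u <;> rcases s with _ | s <;> simp only [tileOp, row_add, row_smul]
  split_ifs <;> simp

theorem latticeSum_add (as : List A) (rs : List (A × ℤ)) (ss : List (Option ℤ))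
    (φ ψ : List (Option ℤ) → A) :
    latticeSum P as rs ss (fun ts => φ ts + ψ ts) =
      latticeSum P as rs ss φ + latticeSum P as rs ss ψ := by
  induction rs generalizing ss with
  | nil => rfl
  | cons r rs ih =>
    simp only [latticeSum, ← row_add]
    congr 1
    funext ts d
    split_ifs <;> simp [ih]

theorem latticeSum_smul (k : A) (as : List A) (rs : List (A × ℤ)) (ss : List (Option ℤ))
    (φ : List (Option ℤ) → A) :
    latticeSum P as rs ss (fun ts => k * φ ts) = k * latticeSum P as rs ss φ := by
  induction rs generalizing ss with
  | nil => rfl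
  | cons r rs ih =>
    simp only [latticeSum, ← row_smul]
    congr 1
    funext ts d
    split_ifs <;> simp [ih]

theorem latticeSum_append (as : List A) (rs rs' : List (A × ℤ)) (ss : List (Option ℤ))
    (φ : List (Option ℤ) → A) :
    latticeSum P as (rs ++ rs') ss φ =
      latticeSum P as rs ss fun ts => latticeSum P as rs' ts φ := by
  induction rs generalizing ss with
  | nil => rfl
  | cons r rs ih => simp only [List.cons_append, latticeSum, ih]

theorem map_tileOp {B : Type*} [CommRing B] (f : A →+* B) (z : A) (c s : Option ℤ)
    (ψ : Option ℤ → Option ℤ → A) :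
    f (tileOp P z c s ψ) = tileOp P (f z) c s fun m n => f (ψ m n) := by
  rcases c with _ | c <;> rcases s with _ | s <;> simp only [tileOp]
  · simp
  · simp
  · simp
  · split_ifs <;> simp

theorem map_row {B : Type*} [CommRing B] (f : A →+* B) (X : A) (as : List A) (c : Option ℤ)
    (ss : List (Option ℤ)) (φ : List (Option ℤ) → Option ℤ → A) :
    f (row P X as c ss φ) = row P (f X) (as.map f) c ss fun ts d => f (φ ts d) := by
  induction as generalizing c ss φ with
  | nil => cases ss <;> simp [row]
  | cons α as ih =>
    cases ss with
    | nil => simp [row]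
    | cons s ss => simp only [row, List.map_cons, map_tileOp, ih, map_mul]

theorem map_latticeSum {B : Type*} [CommRing B] (f : A →+* B) (as : List A) (rs : List (A × ℤ))
    (ss : List (Option ℤ)) (φ : List (Option ℤ) → A) :
    f (latticeSum P as rs ss φ) =
      latticeSum P (as.map f) (rs.map fun r => (f r.1, r.2)) ss fun ts => f (φ ts) := by
  induction rs generalizing ss with
  | nil => rfl
  | cons r rs ih =>
    simp only [latticeSum, List.map_cons, map_row]
    congr 1
    funext ts d
    split_ifs <;> simp [ih]

/-! ### The Yang–Baxter equation -/

/-- The `R`-matrix, acting on functions of the labels `u`, `l` at the east ends of an upper and a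
lower row. -/
def rOp (X Y : A) (φ : Option ℤ → Option ℤ → A) : Option ℤ → Option ℤ → A
  | none, none => X * φ none none
  | none, some l => Y * φ none (some l)
  | some u, none => X * φ (some u) none + (Y - X) * φ none (some u)
  | some u, some l =>
    if u < l then X * φ (some u) (some l) + (Y - X) * φ (some l) (some u)
    else Y * φ (some u) (some l)

/-- The Yang–Baxter equation for one column: the R-matrix moves from the west to the east of two
stacked tiles and exchanges their row parameters. It is checked for every relative order of the
three incoming labels. In `rOp` an empty edge next to a label acts like a larger label. -/
theorem rOp_tileOp (X Y α : A) (u l s : Option ℤ) (G : Option ℤ → Option ℤ → Option ℤ → A) :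
    rOp X Y (fun u l => tileOp anyCross (X * α) l s fun m n =>
        tileOp anyCross (Y * α) u n fun m' n' => G m' m n') u l =
      tileOp anyCross (Y * α) l s fun m n => tileOp anyCross (X * α) u n fun m' n' =>
        rOp X Y (fun u l => G u l n') m' m := by
  rcases u with _ | u <;> rcases l with _ | l <;> rcases s with _ | s <;>
    simp only [tileOp, rOp, if_true]
  · ring
  · ring
  · ring
  · rcases lt_trichotomy l s with h | h | h
    · simp [h.le, h.not_gt]; ring
    · simp [h]; ring
    · simp [h.le, h.not_gt]; ring
  · ring
  · rcases lt_trichotomy u s with h | h | h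
    · simp [h, h.le]; ring
    · simp [h]; ring
    · simp [h.le, h.not_gt]; ring
  · rcases lt_trichotomy u l with h | h | h
    · simp [h, h.le]; ring
    · simp [h]; ring
    · simp [h.le, h.not_gt]; ring
  · rcases lt_trichotomy u l with h1 | h1 | h1 <;> rcases lt_trichotomy l s with h2 | h2 | h2 <;>
      rcases lt_trichotomy u s with h3 | h3 | h3 <;> first | omega | skip
    all_goals
      subst_vars
      simp [*, le_of_lt, not_lt_of_gt]
    all_goals try ring

/-- The transfer operator of an upper row with parameter `U` and a lower row with parameter `L`. -/
def twoRow (U L : A) (as : List A) (u l : Option ℤ) (ss : List (Option ℤ))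
    (Ψ : List (Option ℤ) → Option ℤ → Option ℤ → A) : A :=
  row anyCross L as l ss fun ts d => row anyCross U as u ts fun us e => Ψ us e d

theorem twoRow_cons (U L α : A) (as : List A) (u l s : Option ℤ) (ss : List (Option ℤ))
    (Ψ : List (Option ℤ) → Option ℤ → Option ℤ → A) :
    twoRow U L (α :: as) u l (s :: ss) Ψ =
      tileOp anyCross (L * α) l s fun m n => tileOp anyCross (U * α) u n fun m' n' =>
        twoRow U L as m' m ss fun us => Ψ (n' :: us) := by
  simp only [twoRow, row, row_tileOp]

theorem rOp_twoRow (X Y : A) (as : List A) (u l : Option ℤ) (ss : List (Option ℤ))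
    (Ψ : List (Option ℤ) → Option ℤ → Option ℤ → A) :
    rOp X Y (fun u l => twoRow Y X as u l ss Ψ) u l =
      twoRow X Y as u l ss fun us => rOp X Y (Ψ us) := by
  induction as generalizing u l ss Ψ with
  | nil =>
    cases ss with
    | nil => simp [twoRow, row]
    | cons s ss => rcases u with _ | u <;> rcases l with _ | l <;> simp [twoRow, row, rOp]
  | cons α as ih =>
    cases ss with
    | nil => rcases u with _ | u <;> rcases l with _ | l <;> simp [twoRow, row, rOp]
    | cons s ss =>
      simp only [twoRow_cons]
      rw [rOp_tileOp]
      simp only [ih]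

/-- The exchange relation for two adjacent rows. -/
theorem latticeSum_exchange (X Y : A) (as : List A) (ss : List (Option ℤ))
    (φ : List (Option ℤ) → A) {c d : ℤ} (h : c < d) :
    X * latticeSum anyCross as [(X, c), (Y, d)] ss φ =
      (Y - X) * latticeSum anyCross as [(Y, d), (X, c)] ss φ +
        Y * latticeSum anyCross as [(Y, c), (X, d)] ss φ := by
  classical
  have key : ∀ (U L : A) (e f : ℤ), latticeSum anyCross as [(L, f), (U, e)] ss φ =
      twoRow U L as none none ss fun us u l =>
        if u = some e ∧ l = some f then φ us else 0 := by
    intro U L e f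
    simp only [latticeSum, twoRow]
    congr! with ts l
    split_ifs with hl
    · simp [hl]
    · simp [hl]
  -- Both west ends are empty, so there the R-matrix is the scalar `X`. At the east ends it turns
  -- the prescribed exits into the two terms of the right-hand side.
  have := rOp_twoRow X Y as none none ss fun us u l =>
        if u = some d ∧ l = some c then φ us else 0
  rw [rOp, ← key] at this
  rw [this, key, key, twoRow, twoRow, twoRow, ← row_smul, ← row_smul, ← row_add]
  congr! with ts l
  rw [← row_smul, ← row_smul, ← row_add]
  congr! with us u
  rcases u with _ | u <;> rcases l with _ | l <;> simp only [rOp] <;> simp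
  split_ifs <;> first | omega | simp

end Lattice

section Lattice

variable {A : Type*} [CommRing A]

/-! ### Reachable labellings -/

/-- The admissible labels `c`, `s`, `m`, `n` of the west, south, east and north side of a tile. -/
inductive TileRel (P : ℤ → ℤ → Prop) :
    Option ℤ → Option ℤ → Option ℤ → Option ℤ → Prop
  | empty : TileRel P none none none none
  | nw (h : ℤ) : TileRel P (some h) none none (some h)
  | horiz (h : ℤ) : TileRel P (some h) none (some h) none
  | vert (v : ℤ) : TileRel P none (some v) none (some v)
  | se (v : ℤ) : TileRel P none (some v) (some v) none
  | cross (h v : ℤ) (hP : P h v) :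
      TileRel P (some h) (some v) (some (min h v)) (some (max h v))

/-- The admissible labels `c`, `ss`, `ts`, `d` of the west end, the south sides, the north sides and
the east end of a row. -/
inductive RowRel (P : ℤ → ℤ → Prop) :
    Option ℤ → List (Option ℤ) → List (Option ℤ) → Option ℤ → Prop
  | nil (c : Option ℤ) : RowRel P c [] [] c
  | cons {c s m n d : Option ℤ} {ss ts : List (Option ℤ)} (h : TileRel P c s m n)
      (hr : RowRel P m ss ts d) : RowRel P c (s :: ss) (n :: ts) d

variable {P : ℤ → ℤ → Prop}

theorem tileOp_congr {z : A} {c s : Option ℤ} {φ ψ : Option ℤ → Option ℤ → A}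
    (h : ∀ m n, TileRel P c s m n → φ m n = ψ m n) : tileOp P z c s φ = tileOp P z c s ψ := by
  rcases c with _ | c <;> rcases s with _ | s <;> simp only [tileOp]
  · rw [h _ _ .empty]
  · rw [h _ _ (.vert s), h _ _ (.se s)]
  · rw [h _ _ (.nw c), h _ _ (.horiz c)]
  · split_ifs with hP
    · rw [h _ _ (.cross c s hP)]
    · rfl

/-- The continuation is evaluated only at reachable labels, so vanishing arguments can be carried
out on `RowRel`, free of weights. -/
theorem row_congr {X : A} {as : List A} {c : Option ℤ} {ss : List (Option ℤ)}
    {φ ψ : List (Option ℤ) → Option ℤ → A} (h : ∀ ts d, RowRel P c ss ts d → φ ts d = ψ ts d) :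
    row P X as c ss φ = row P X as c ss ψ := by
  induction as generalizing c ss φ ψ with
  | nil =>
    cases ss with
    | nil => exact h _ _ (.nil c)
    | cons s ss => rfl
  | cons α as ih =>
    cases ss with
    | nil => rfl
    | cons s ss =>
      exact tileOp_congr fun m n hmn => ih fun ts d hr => h _ _ (.cons hmn hr)

theorem row_eq_zero {X : A} {as : List A} {c : Option ℤ} {ss : List (Option ℤ)}
    {φ : List (Option ℤ) → Option ℤ → A} (h : ∀ ts d, RowRel P c ss ts d → φ ts d = 0) :
    row P X as c ss φ = 0 := by
  rw [row_congr h, row_zero]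

theorem TileRel.perm {c s m n : Option ℤ} (h : TileRel P c s m n) :
    [c, s].reduceOption.Perm [n, m].reduceOption := by
  cases h with
  | cross h v _ =>
    rcases le_total h v with hv | hv
    · simpa [List.reduceOption, hv] using List.Perm.swap v h []
    · simp [List.reduceOption, hv]
  | _ => simp [List.reduceOption]

/-- No label is created or lost: every tile merely permutes the labels that enter it. -/
theorem RowRel.perm {c d : Option ℤ} {ss ts : List (Option ℤ)} (h : RowRel P c ss ts d) :
    (c :: ss).reduceOption.Perm (ts ++ [d]).reduceOption := by
  induction h with
  | nil c => simp
  | @cons c s m n d ss ts h hr ih =>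
    have e1 : (c :: s :: ss).reduceOption = [c, s].reduceOption ++ ss.reduceOption := by
      rw [← List.reduceOption_append]; rfl
    have e2 : (n :: ts ++ [d]).reduceOption = [n].reduceOption ++ (ts ++ [d]).reduceOption := by
      rw [← List.reduceOption_append]; rfl
    have e3 : (m :: ss).reduceOption = [m].reduceOption ++ ss.reduceOption := by
      rw [← List.reduceOption_append]; rfl
    have e4 : [n, m].reduceOption = [n].reduceOption ++ [m].reduceOption := by
      rw [← List.reduceOption_append]; rfl
    rw [e1, e2]
    rw [e3] at ih
    refine (h.perm.append_right _).trans ?_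
    rw [e4, List.append_assoc]
    exact ih.append_left _

theorem RowRel.length_eq {c d : Option ℤ} {ss ts : List (Option ℤ)} (h : RowRel P c ss ts d) :
    ts.length = ss.length := by
  induction h <;> simp_all

theorem RowRel.mem_iff {c d : Option ℤ} {ss ts : List (Option ℤ)} (h : RowRel P c ss ts d) (v : ℤ) :
    (c = some v ∨ some v ∈ ss) ↔ (d = some v ∨ some v ∈ ts) := by
  have := h.perm.mem_iff (a := v)
  simp only [List.reduceOption_mem_iff, List.mem_cons, List.mem_append, List.not_mem_nil,
    or_false] at this
  rw [eq_comm (a := c), eq_comm (a := d), this, or_comm]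

/-! ### Rows with a prescribed exit -/

/-- A pipe that enters from the west and must leave to the east crosses all pipes that it meets. -/
theorem row_carry (X : A) {as : List A} {h : ℤ} {ss : List (Option ℤ)}
    (hl : as.length = ss.length) (hs : ∀ v, some v ∈ ss → h < v ∧ P h v)
    (F : List (Option ℤ) → A) :
    (open Classical in
      row P X as (some h) ss fun ts d => if d = some h then F ts else 0) = F ss := by
  induction as generalizing ss F with
  | nil =>
    cases ss with
    | nil => simp [row]
    | cons s ss => simp at hl
  | cons α as ih =>
    cases ss with
    | nil => simp at hl
    | cons s ss =>
      have hl' : as.length = ss.length := by simpa using hl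
      have hs' : ∀ v, some v ∈ ss → h < v ∧ P h v := fun v hv => hs v (List.mem_cons_of_mem _ hv)
      rcases s with _ | v
      · simp only [row, tileOp]
        rw [ih hl' hs' fun ts => F (none :: ts), row_eq_zero, mul_zero, zero_add]
        intro ts d hr
        refine if_neg ?_
        rintro rfl
        rcases (hr.mem_iff h).2 (Or.inl rfl) with h1 | h1
        · simp at h1
        · exact (hs' h h1).1.false
      · obtain ⟨h1, h2⟩ := hs v (List.mem_cons_self ..)
        simp only [row, tileOp]
        rw [if_pos h2, min_eq_left h1.le, max_eq_right h1.le, ih hl' hs' fun ts => F (some v :: ts)]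

/-- If there is no gap to the left of the label `e`, the label `e` cannot be reached by a carry with
a smaller label. -/
theorem RowRel.ne_of_carry_lt {v e : ℤ} {ls : List ℤ} {ss ts : List (Option ℤ)} {d : Option ℤ}
    (hr : RowRel P (some v) (ls.map some ++ some e :: ss) ts d)
    (hv : v < e) (hls : ∀ u ∈ ls, u < e) (hss : some e ∉ ss) : d ≠ some e := by
  induction ls generalizing v ts with
  | nil =>
    rw [List.map_nil, List.nil_append] at hr
    cases hr with
    | cons h hr =>
      cases h with
      | cross _ _ hP =>
        rintro rfl
        rcases (hr.mem_iff e).2 (Or.inl rfl) with h1 | h1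
        · rw [min_eq_left hv.le] at h1
          simp at h1
          omega
        · exact hss h1
  | cons u ls ih =>
    rw [List.map_cons, List.cons_append] at hr
    cases hr with
    | cons h hr =>
      cases h with
      | cross _ _ hP =>
        exact ih hr (min_lt_of_left_lt hv) (fun x hx => hls x (List.mem_cons_of_mem _ hx))

/-- The row is frozen. If a pipe left of `e` turned east, the carried label would stay below `e` at
each crossing and push `e` to the north for good. Thus these pipes go straight up, `e` turns east
and crosses everything to its right, and all tiles used have weight 1. -/
theorem row_exit (X : A) {as : List A} {ls : List ℤ} {e : ℤ} {ss : List (Option ℤ)}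
    (hl : as.length = ls.length + (ss.length + 1)) (hls : ∀ u ∈ ls, u < e)
    (hs : ∀ v, some v ∈ ss → e < v ∧ P e v) (F : List (Option ℤ) → A) :
    (open Classical in
      row P X as none (ls.map some ++ some e :: ss) fun ts d => if d = some e then F ts else 0) =
      F (ls.map some ++ none :: ss) := by
  classical
  induction ls generalizing as F with
  | nil =>
    cases as with
    | nil => simp at hl
    | cons α as =>
      have hl' : as.length = ss.length := by simpa using hl
      simp only [row, tileOp, List.map_nil, List.nil_append]
      rw [row_carry X hl' hs fun ts => F (none :: ts), row_eq_zero, zero_add]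
      intro ts d hr
      refine if_neg ?_
      rintro rfl
      rcases (hr.mem_iff e).2 (Or.inl rfl) with h1 | h1
      · simp at h1
      · exact (hs e h1).1.false
  | cons u ls ih =>
    cases as with
    | nil => simp at hl
    | cons α as =>
      have hl' : as.length = ls.length + (ss.length + 1) := by
        simp only [List.length_cons] at hl; omega
      have hls' : ∀ u ∈ ls, u < e := fun x hx => hls x (List.mem_cons_of_mem _ hx)
      simp only [row, tileOp, List.map_cons, List.cons_append]
      rw [ih hl' hls' fun ts => F (some u :: ts), row_eq_zero, add_zero]
      intro ts d hr
      exact if_neg (hr.ne_of_carry_lt (hls u (List.mem_cons_self ..)) hls'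
        fun h => (hs e h).1.false)

/-- A column without a pipe at its south end has only empty tiles. -/
theorem latticeSum_none_cons (α : A) (as : List A) (rs : List (A × ℤ)) (ss : List (Option ℤ))
    (φ : List (Option ℤ) → A) :
    latticeSum P (α :: as) rs (none :: ss) φ =
      (rs.map fun r => r.1 * α - 1).prod * latticeSum P as rs ss fun ts => φ (none :: ts) := by
  induction rs generalizing ss with
  | nil => simp [latticeSum]
  | cons r rs ih =>
    simp only [latticeSum, row, tileOp, List.map_cons, List.prod_cons, mul_assoc]
    rw [← row_smul P _ (rs.map fun r => r.1 * α - 1).prod]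
    congr 2
    funext ts d
    split_ifs
    · exact ih ts
    · simp

/-! ### Intervals as lists -/

/-- The list `[p, p + 1, …]` of length `m`. -/
def upInts (p : ℤ) : ℕ → List ℤ
  | 0 => []
  | m + 1 => p :: upInts (p + 1) m

/-- The list `[q, q - 1, …]` of length `m`. -/
def downInts (q : ℤ) : ℕ → List ℤ
  | 0 => []
  | m + 1 => q :: downInts (q - 1) m

@[simp] theorem length_upInts (p : ℤ) (m : ℕ) : (upInts p m).length = m := by
  induction m generalizing p <;> simp_all [upInts]

@[simp] theorem length_downInts (p : ℤ) (m : ℕ) : (downInts p m).length = m := by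
  induction m generalizing p <;> simp_all [downInts]

theorem mem_upInts {p x : ℤ} {m : ℕ} : x ∈ upInts p m ↔ p ≤ x ∧ x < p + m := by
  induction m generalizing p with
  | zero => simp [upInts]
  | succ m ih => simp only [upInts, List.mem_cons, ih]; push_cast; omega

theorem mem_downInts {q x : ℤ} {m : ℕ} : x ∈ downInts q m ↔ q - m < x ∧ x ≤ q := by
  induction m generalizing q with
  | zero => simp [downInts]
  | succ m ih => simp only [downInts, List.mem_cons, ih]; push_cast; omega

theorem upInts_add (p : ℤ) (k m : ℕ) : upInts p (k + m) = upInts p k ++ upInts (p + k) m := by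
  induction k generalizing p with
  | zero => simp [upInts]
  | succ k ih =>
    rw [Nat.add_right_comm, upInts, upInts, ih]
    simp only [List.cons_append, Nat.cast_add, Nat.cast_one]
    rw [show p + 1 + (k : ℤ) = p + (k + 1) by ring]

theorem downInts_add (q : ℤ) (k m : ℕ) :
    downInts q (k + m) = downInts q k ++ downInts (q - k) m := by
  induction k generalizing q with
  | zero => simp [downInts]
  | succ k ih =>
    rw [Nat.add_right_comm, downInts, downInts, ih]
    simp only [List.cons_append, Nat.cast_add, Nat.cast_one]
    rw [show q - 1 - (k : ℤ) = q - (k + 1) by ring]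

/-! ### The partition function of a permutation -/

open Classical in
/-- The indicator function of the empty labelling. -/
def noPipe (ts : List (Option ℤ)) : A := if ∀ t ∈ ts, t = none then 1 else 0

/-- The partition function of the permutation `w` on rows and columns `p, …, p + m - 1`. -/
def gridSum (X α : ℤ → A) (p : ℤ) (m : ℕ) (w : Equiv.Perm ℤ) : A :=
  latticeSum anyCross ((upInts p m).map α) ((downInts (p + m - 1) m).map fun i => (X i, w i))
    ((upInts p m).map some) noPipe

theorem map_gridSum {B : Type*} [CommRing B] (f : A →+* B) (X α : ℤ → A) (p : ℤ) (m : ℕ)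
    (w : Equiv.Perm ℤ) :
    f (gridSum X α p m w) = gridSum (fun i => f (X i)) (fun j => f (α j)) p m w := by
  simp only [gridSum, map_latticeSum, List.map_map]
  congr 1
  funext ts
  simp only [noPipe]
  split_ifs <;> simp

/-- Only the adjacent rows `i + 1` (lower) and `i` (upper) differ between the three terms, and they
satisfy `latticeSum_exchange`; the rows below and above them are carried along by linearity. -/
theorem gridSum_exchange (X α : ℤ → A) (p : ℤ) (m : ℕ) (w : Equiv.Perm ℤ) {i : ℤ} (hp : p ≤ i)
    (hm : i + 1 < p + m) (hi : w i < w (i + 1)) :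
    X i * gridSum (fun k => X (Equiv.swap i (i + 1) k)) α p m (w * Equiv.swap i (i + 1)) =
      (X (i + 1) - X i) * gridSum X α p m w +
        X (i + 1) * gridSum X α p m (w * Equiv.swap i (i + 1)) := by
  -- `k` rows lie below row `i + 1`, and the `k'` of the next line lie above row `i`.
  obtain ⟨k, hk⟩ : ∃ k : ℕ, p + m - 1 - k = i + 1 := ⟨(p + m - 1 - (i + 1)).toNat, by omega⟩
  obtain ⟨k', hk'⟩ : ∃ k' : ℕ, m = k + (k' + 2) := ⟨m - k - 2, by omega⟩
  have hd : downInts (p + m - 1) m =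
      downInts (p + m - 1) k ++ ((i + 1) :: i :: downInts (i - 1) k') := by
    conv_lhs => rw [hk', downInts_add, ← hk', hk]
    simp [downInts]
  have hne : ∀ x ∈ downInts (p + m - 1) k, Equiv.swap i (i + 1) x = x := by
    intro x hx
    rw [mem_downInts] at hx
    exact Equiv.swap_apply_of_ne_of_ne (by omega) (by omega)
  have hne' : ∀ x ∈ downInts (i - 1) k', Equiv.swap i (i + 1) x = x := by
    intro x hx
    rw [mem_downInts] at hx
    exact Equiv.swap_apply_of_ne_of_ne (by omega) (by omega)
  have hsplit : ∀ (Y : ℤ → A) (u : Equiv.Perm ℤ), gridSum Y α p m u =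
      latticeSum anyCross ((upInts p m).map α)
        ((downInts (p + m - 1) k).map fun i => (Y i, u i)) ((upInts p m).map some) fun ts =>
        latticeSum anyCross ((upInts p m).map α) [(Y (i + 1), u (i + 1)), (Y i, u i)] ts fun ts' =>
          latticeSum anyCross ((upInts p m).map α)
            ((downInts (i - 1) k').map fun i => (Y i, u i)) ts' noPipe := by
    intro Y u
    simp only [gridSum]
    rw [hd, List.map_append, latticeSum_append]
    simp only [List.map_cons]
    congr 1
  have h1 : ∀ l : List ℤ, (∀ x ∈ l, Equiv.swap i (i + 1) x = x) →
      l.map (fun j => (X (Equiv.swap i (i + 1) j), (w * Equiv.swap i (i + 1)) j)) =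
        l.map fun j => (X j, w j) := by
    intro l hl
    refine List.map_congr_left fun x hx => ?_
    rw [Equiv.Perm.mul_apply, hl x hx]
  have h2 : ∀ l : List ℤ, (∀ x ∈ l, Equiv.swap i (i + 1) x = x) →
      l.map (fun j => (X j, (w * Equiv.swap i (i + 1)) j)) = l.map fun j => (X j, w j) := by
    intro l hl
    refine List.map_congr_left fun x hx => ?_
    rw [Equiv.Perm.mul_apply, hl x hx]
  rw [hsplit, hsplit, hsplit, h1 _ hne, h1 _ hne', h2 _ hne, h2 _ hne', ← latticeSum_smul,
    ← latticeSum_smul, ← latticeSum_smul, ← latticeSum_add]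
  congr 1
  funext ts
  simp only [Equiv.Perm.mul_apply, Equiv.swap_apply_left, Equiv.swap_apply_right]
  exact latticeSum_exchange _ _ _ _ _ hi

/-- The lowest row releases the label of the first column. That row is frozen, and the first column
is empty above it, which contributes the factors `j = 0`; induction handles the other columns. -/
theorem latticeSum_longest (as : List A) (rs : List (A × ℤ)) (ls : List ℤ)
    (hl : as.length = ls.length) (hr : rs.map Prod.snd = ls) (hs : ls.Pairwise (· < ·)) :
    latticeSum anyCross as rs (ls.map some) noPipe =
      ∏ j ∈ Finset.range ls.length, ∏ i ∈ Finset.range (ls.length - 1 - j),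
        ((rs.map Prod.fst).getD (j + 1 + i) 0 * as.getD j 0 - 1) := by
  induction ls generalizing as rs with
  | nil =>
    cases rs with
    | nil => simp [latticeSum, noPipe]
    | cons r rs => simp at hr
  | cons e ls ih =>
    cases as with
    | nil => simp at hl
    | cons α as =>
      cases rs with
      | nil => simp at hr
      | cons r rs =>
        simp only [List.map_cons, List.cons.injEq] at hr
        have hl' : as.length = ls.length := by simpa using hl
        rw [List.pairwise_cons] at hs
        have := row_exit (P := anyCross) r.1 (as := α :: as) (ls := []) (e := e)
          (ss := ls.map some) (by simp [hl']) (by simp) (by simpa using hs.1)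
          fun ts => latticeSum anyCross (α :: as) rs ts noPipe
        simp only [List.map_nil, List.nil_append] at this
        rw [List.map_cons, latticeSum, hr.1, this, latticeSum_none_cons]
        have hn : (fun ts : List (Option ℤ) => (noPipe (none :: ts) : A)) = noPipe := by
          funext ts; simp [noPipe]
        rw [hn, ih as rs hl' hr.2 hs.2, List.length_cons, Finset.prod_range_succ', mul_comm]
        congr 1
        · refine Finset.prod_congr rfl fun j hj => ?_
          rw [show ls.length + 1 - 1 - (j + 1) = ls.length - 1 - j by omega]
          refine Finset.prod_congr rfl fun i _ => ?_
          rw [show j + 1 + 1 + i = (j + 1 + i) + 1 by ring]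
          simp
        · have hlen : rs.length = ls.length := by rw [← hr.2]; simp
          rw [← hlen]
          clear this hn hr hlen ih hl hl' hs
          simp only [Nat.add_sub_cancel, Nat.sub_zero, List.getD_cons_zero, zero_add, List.map_cons]
          induction rs with
          | nil => simp
          | cons r' rs ih =>
            rw [List.map_cons, List.prod_cons, List.length_cons, Finset.prod_range_succ', ih,
              mul_comm]
            congr 1
            refine Finset.prod_congr rfl fun i _ => ?_
            rw [show 1 + (i + 1) = (1 + i) + 1 by ring, List.getD_cons_succ, add_comm 1 i,
              List.getD_cons_succ, List.map_cons, List.getD_cons_succ]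

end Lattice

/-! ### Lengths -/

/-- The set of inversions. -/
def invSet (w : Equiv.Perm ℤ) : Set (ℤ × ℤ) := {c | c.1 < c.2 ∧ w c.2 < w c.1}

/-- The permutation `w` fixes every integer outside `[p, q]`. -/
def SuppIn (p q : ℤ) (w : Equiv.Perm ℤ) : Prop := ∀ i, i ∉ Set.Icc p q → w i = i

theorem SuppIn.mem {p q : ℤ} {w : Equiv.Perm ℤ} (h : SuppIn p q w) {i : ℤ} (hi : i ∈ Set.Icc p q) :
    w i ∈ Set.Icc p q := by
  by_contra hc
  exact hc (by rw [w.injective (h _ hc)]; exact hi)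

theorem SuppIn.mono {p q p' q' : ℤ} {w : Equiv.Perm ℤ} (h : SuppIn p q w) (hp : p' ≤ p)
    (hq : q ≤ q') : SuppIn p' q' w :=
  fun i hi => h i fun hi' => hi ⟨hp.trans hi'.1, hi'.2.trans hq⟩

theorem SuppIn.mul {p q : ℤ} {v w : Equiv.Perm ℤ} (hv : SuppIn p q v) (hw : SuppIn p q w) :
    SuppIn p q (v * w) := fun i hi => by rw [Equiv.Perm.mul_apply, hw i hi, hv i hi]

theorem suppIn_swap {p q i : ℤ} (hp : p ≤ i) (hq : i + 1 ≤ q) :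
    SuppIn p q (Equiv.swap i (i + 1)) := fun k hk => by
  rw [Set.mem_Icc] at hk
  exact Equiv.swap_apply_of_ne_of_ne (by omega) (by omega)

theorem SuppIn.invSet_subset {p q : ℤ} {w : Equiv.Perm ℤ} (h : SuppIn p q w) :
    invSet w ⊆ Set.Icc p q ×ˢ Set.Icc p q := by
  rintro ⟨a, b⟩ ⟨hab, hw⟩
  have key : ∀ x, (x ∈ Set.Icc p q ∧ w x ∈ Set.Icc p q) ∨ (x ∉ Set.Icc p q ∧ w x = x) := fun x => by
    by_cases hx : x ∈ Set.Icc p q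
    · exact Or.inl ⟨hx, h.mem hx⟩
    · exact Or.inr ⟨hx, h x hx⟩
  have ha := key a
  have hb := key b
  simp only [Set.mem_Icc, Set.mem_prod] at ha hb hab hw ⊢
  omega

theorem SuppIn.invSet_finite {p q : ℤ} {w : Equiv.Perm ℤ} (h : SuppIn p q w) :
    (invSet w).Finite :=
  ((Set.finite_Icc p q).prod (Set.finite_Icc p q)).subset h.invSet_subset

theorem len_mul_swap_of_lt {w : Equiv.Perm ℤ} (hf : (invSet w).Finite) {i : ℤ}
    (hi : w i < w (i + 1)) : len (w * Equiv.swap i (i + 1)) = len w + 1 := by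
  have hs : ∀ k : ℤ, (Equiv.swap i (i + 1) k = i + 1 ∧ k = i) ∨
      (Equiv.swap i (i + 1) k = i ∧ k = i + 1) ∨
      (Equiv.swap i (i + 1) k = k ∧ k ≠ i ∧ k ≠ i + 1) := by
    intro k
    rcases eq_or_ne k i with rfl | h1
    · simp
    rcases eq_or_ne k (i + 1) with rfl | h2
    · simp
    · simp [Equiv.swap_apply_of_ne_of_ne h1 h2, h1, h2]
  let s := Equiv.prodCongr (Equiv.swap i (i + 1)) (Equiv.swap i (i + 1))
  have h : invSet (w * Equiv.swap i (i + 1)) = insert (i, i + 1) (s '' invSet w) := by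
    ext ⟨a, b⟩
    rw [Set.mem_insert_iff, Equiv.image_eq_preimage_symm]
    simp only [invSet, Set.mem_ofPred_eq, Set.mem_preimage, Equiv.Perm.mul_apply, s,
      Equiv.prodCongr_symm, Equiv.prodCongr_apply, Equiv.symm_swap, Prod.map_apply, Prod.mk.injEq]
    rcases hs a with ⟨ea, rfl⟩ | ⟨ea, rfl⟩ | ⟨ea, na⟩ <;>
    rcases hs b with ⟨eb, hb⟩ | ⟨eb, hb⟩ | ⟨eb, nb⟩ <;> rw [ea, eb] <;> (try subst hb) <;> omega
  have hn : (i, i + 1) ∉ s '' invSet w := by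
    rw [Equiv.image_eq_preimage_symm]
    simp only [invSet, Set.mem_preimage, Set.mem_ofPred_eq, s,
      Equiv.prodCongr_symm, Equiv.prodCongr_apply, Equiv.symm_swap, Prod.map_apply,
      Equiv.swap_apply_left, Equiv.swap_apply_right]
    omega
  change (invSet _).ncard = (invSet w).ncard + 1
  rw [h, Set.ncard_insert_of_notMem hn (hf.image _), Set.ncard_image_of_injective _ s.injective]

theorem neg_one_pow_len_mul_swap {B : Type*} [CommRing B] {p q : ℤ} {w : Equiv.Perm ℤ}
    (h : SuppIn p q w) (i : ℤ) :
    (-1 : B) ^ len (w * Equiv.swap i (i + 1)) = -(-1) ^ len w := by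
  have h' : SuppIn (min p i) (max q (i + 1)) (w * Equiv.swap i (i + 1)) :=
    (h.mono (min_le_left ..) (le_max_left ..)).mul
      (suppIn_swap (min_le_right ..) (le_max_right ..))
  rcases lt_or_gt_of_ne (w.injective.ne (by omega : i ≠ i + 1)) with hi | hi
  · rw [len_mul_swap_of_lt h.invSet_finite hi, pow_succ]
    ring
  · have := len_mul_swap_of_lt h'.invSet_finite (i := i) (by simpa using hi)
    rw [mul_assoc, Equiv.swap_mul_self, mul_one] at this
    rw [this, pow_succ]
    ring

/-! ### Double Grothendieck polynomials as partition functions -/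

/-- The row parameters `1 - x_i`. -/
def polyX (i : ℤ) : MvPolynomial ℤ LamHat := 1 - MvPolynomial.X i

/-- The column parameters `1 / (1 - a_j)`. -/
def polyA (j : ℤ) : MvPolynomial ℤ LamHat := Ring.inverse (1 - MvPolynomial.C (LamHat.a j))

theorem isUnit_one_sub_C_a (j : ℤ) :
    IsUnit (1 - MvPolynomial.C (LamHat.a j) : MvPolynomial ℤ LamHat) := by
  simpa using (LamHat.isUnit_one_sub_a j).map (MvPolynomial.C : LamHat →+* MvPolynomial ℤ LamHat)

theorem one_sub_ominus {B : Type*} [CommRing B] (u v : B) (h : IsUnit (1 - v)) :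
    1 - ominus u v = (1 - u) * Ring.inverse (1 - v) := by
  have := Ring.mul_inverse_cancel _ h
  rw [ominus]
  linear_combination -this

theorem polyX_mul_polyA (i j : ℤ) :
    polyX i * polyA j = 1 - ominus (MvPolynomial.X i) (MvPolynomial.C (LamHat.a j)) :=
  (one_sub_ominus _ _ (isUnit_one_sub_C_a j)).symm

/-- The factor `polyX (i + 1) - polyX i` equals x_i - x_{i+1} and can be cancelled, so the operator
is determined by its relation with cleared denominator. -/
theorem demazure_eq_of {i : ℤ} {f g : MvPolynomial ℤ LamHat}
    (h : polyX (i + 1) * f - polyX i * MvPolynomial.rename (Equiv.swap i (i + 1)) f =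
      (polyX (i + 1) - polyX i) * g) : demazure i f = g := by
  have hs := divDiff_spec i ((1 - MvPolynomial.X (i + 1)) * f)
  have hne : (MvPolynomial.X i - MvPolynomial.X (i + 1) : MvPolynomial ℤ LamHat) ≠ 0 := by
    rw [sub_ne_zero]
    intro h
    have := MvPolynomial.X_injective h
    omega
  refine mul_left_cancel₀ hne ?_
  rw [demazure, ← hs]
  simp only [polyX] at h
  simp only [map_mul, map_sub, map_one, MvPolynomial.rename_X, Equiv.swap_apply_right]
  rw [h]
  ring

theorem rename_polyA (i j : ℤ) :
    MvPolynomial.rename (Equiv.swap i (i + 1)) (polyA j) = polyA j := by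
  set f : MvPolynomial ℤ LamHat →+* MvPolynomial ℤ LamHat :=
    (MvPolynomial.rename (Equiv.swap i (i + 1)) :
      MvPolynomial ℤ LamHat →ₐ[LamHat] MvPolynomial ℤ LamHat).toRingHom with hf
  have h : f (1 - MvPolynomial.C (LamHat.a j)) = 1 - MvPolynomial.C (LamHat.a j) := by
    simp [hf]
  have hu := isUnit_one_sub_C_a j
  have h1 := Ring.mul_inverse_cancel _ hu
  refine hu.mul_left_cancel ?_
  have h2 := congrArg f h1
  rw [map_mul, h, map_one] at h2
  exact h2.trans h1.symm

theorem gridSum_longest {A : Type*} [CommRing A] (X α : ℤ → A) {p q : ℤ} {w : Equiv.Perm ℤ}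
    {m : ℕ} (hm : p + m - 1 = q) (hw : ∀ i ∈ Set.Icc p q, w i = p + q - i) :
    gridSum X α p m w =
      ∏ c ∈ (Finset.Icc p q ×ˢ Finset.Icc p q).filter (fun c => c.1 + c.2 ≤ p + q - 1),
        (X c.1 * α c.2 - 1) := by
  have hsnd : ∀ k : ℕ, k ≤ m → ∀ p' q' : ℤ, p' + k - 1 = q' → p ≤ p' → q' ≤ q →
      (downInts q' k).map w = upInts (p + q - q') k := by
    intro k
    induction k with
    | zero => intros; rfl
    | succ k ih =>
      intro hk p' q' h1 h2 h3
      simp only [downInts, upInts, List.map_cons]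
      rw [hw q' ⟨by push_cast at h1; omega, h3⟩,
        ih (by omega) p' (q' - 1) (by push_cast at h1; omega) h2 (by omega)]
      rw [show p + q - (q' - 1) = p + q - q' + 1 by ring]
  have hpw : ∀ (k : ℕ) (p' : ℤ), (upInts p' k).Pairwise (· < ·) := by
    intro k
    induction k with
    | zero => simp [upInts]
    | succ k ih =>
      intro p'
      rw [upInts, List.pairwise_cons]
      exact ⟨fun x hx => by rw [mem_upInts] at hx; omega, ih _⟩
  rw [gridSum, latticeSum_longest (ls := upInts p m) _ _ (by simp) ?_ (hpw _ _)]
  · simp only [length_upInts]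
    have hgetU : ∀ (k j : ℕ) (p' : ℤ), j < k → ((upInts p' k).map α).getD j 0 = α (p' + j) := by
      intro k
      induction k with
      | zero => simp
      | succ k ih =>
        intro j p' hj
        cases j with
        | zero => simp [upInts]
        | succ j =>
          rw [upInts, List.map_cons, List.getD_cons_succ, ih j _ (by omega)]
          push_cast; ring_nf
    have hgetD : ∀ (k j : ℕ) (q' : ℤ), j < k → ((downInts q' k).map X).getD j 0 = X (q' - j) := by
      intro k
      induction k with
      | zero => simp
      | succ k ih =>
        intro j q' hj
        cases j with
        | zero => simp [downInts]
        | succ j =>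
          rw [downInts, List.map_cons, List.getD_cons_succ, ih j _ (by omega)]
          push_cast; ring_nf
    rw [Finset.prod_sigma']
    -- Index `c.1` counts columns from `p`; `c.1 + 1 + c.2` counts rows upwards from `q`. In that
    -- column the tiles strictly above row `q - c.1` are empty.
    refine Finset.prod_bij (fun c _ => (q - (c.1 + 1 + c.2 : ℕ), p + c.1)) ?_ ?_ ?_ ?_
    · rintro ⟨j, i⟩ h
      simp only [Finset.mem_sigma, Finset.mem_range] at h
      simp only [Finset.mem_filter, Finset.mem_product, Finset.mem_Icc]
      push_cast
      omega
    · rintro ⟨j, i⟩ h ⟨j', i'⟩ h' e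
      simp only [Prod.mk.injEq] at e
      obtain ⟨e1, e2⟩ := e
      push_cast at e1
      obtain rfl : j = j' := by omega
      obtain rfl : i = i' := by omega
      rfl
    · rintro ⟨a, b⟩ h
      simp only [Finset.mem_filter, Finset.mem_product, Finset.mem_Icc] at h
      refine ⟨⟨(b - p).toNat, (q - a - 1 - (b - p)).toNat⟩, ?_, ?_⟩
      · simp only [Finset.mem_sigma, Finset.mem_range]
        omega
      · simp only [Prod.mk.injEq]
        push_cast
        omega
    · rintro ⟨j, i⟩ h
      simp only [Finset.mem_sigma, Finset.mem_range] at h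
      simp only [List.map_map]
      rw [hgetU m j p h.1]
      have : (Prod.fst ∘ fun i => (X i, w i)) = X := rfl
      rw [this, hgetD m _ _ (by omega), hm]
  · have := hsnd m le_rfl p q hm le_rfl le_rfl
    rw [List.map_map, hm]
    rw [add_sub_cancel_right] at this
    exact this

/-- Without ascents the values drop by at least one at each step. Counting from `p` bounds `w i`
above by `p + q - i`, counting from `q` bounds it below by the same number. -/
theorem longest_apply {p q : ℤ} {w : Equiv.Perm ℤ} (hs : SuppIn p q w)
    (h : ∀ i ∈ Finset.Ico p q, ¬ w i < w (i + 1)) : ∀ i ∈ Set.Icc p q, w i = p + q - i := by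
  have h' : ∀ i, p ≤ i → i < q → w (i + 1) < w i := fun i h1 h2 =>
    lt_of_le_of_ne (not_lt.1 (h i (Finset.mem_Ico.2 ⟨h1, h2⟩))) (w.injective.ne (by omega))
  have up : ∀ k : ℕ, p + k ≤ q → w (p + k) ≤ q - k := by
    intro k
    induction k with
    | zero => intro hk; simpa using (hs.mem ⟨le_rfl, by simpa using hk⟩).2
    | succ k ih =>
      intro hk
      push_cast at hk ⊢
      have := h' (p + k) (by omega) (by omega)
      have := ih (by omega)
      rw [← add_assoc]
      omega
  have lo : ∀ k : ℕ, p ≤ q - k → p + k ≤ w (q - k) := by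
    intro k
    induction k with
    | zero => intro hk; simpa using (hs.mem ⟨by simpa using hk, le_rfl⟩).1
    | succ k ih =>
      intro hk
      push_cast at hk ⊢
      have := h' (q - (k + 1)) (by omega) (by omega)
      rw [show q - ((k : ℤ) + 1) + 1 = q - k by ring] at this
      have := ih (by omega)
      omega
  rintro i ⟨h1, h2⟩
  have h3 := up (i - p).toNat (by omega)
  have h4 := lo (q - i).toNat (by omega)
  rw [show p + ((i - p).toNat : ℤ) = i by omega] at h3
  rw [show q - ((q - i).toNat : ℤ) = i by omega] at h4
  omega

theorem len_longest {p q : ℤ} {w : Equiv.Perm ℤ} (hs : SuppIn p q w)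
    (hw : ∀ i ∈ Set.Icc p q, w i = p + q - i) :
    len w =
      ((Finset.Icc p q ×ˢ Finset.Icc p q).filter (fun c => c.1 + c.2 ≤ p + q - 1)).card := by
  change (invSet w).ncard = _
  rw [← Set.ncard_coe_finset]
  refine Set.ncard_congr (fun c _ => (c.1, p + q - c.2)) ?_ ?_ ?_
  · rintro ⟨a, b⟩ h
    have hm := hs.invSet_subset h
    have h1 := h.1
    simp only [Set.mem_prod, Set.mem_Icc] at hm h1
    simp only [Finset.coe_filter, Finset.mem_product, Finset.mem_Icc, Set.mem_ofPred_eq]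
    omega
  · rintro ⟨a, b⟩ ⟨a', b'⟩ _ _ e
    simp only [Prod.mk.injEq] at e ⊢
    omega
  · rintro ⟨a, b⟩ h
    simp only [Finset.coe_filter, Finset.mem_product, Finset.mem_Icc, Set.mem_ofPred_eq] at h
    refine ⟨(a, p + q - b), ⟨?_, ?_⟩, ?_⟩
    · change a < p + q - b
      omega
    · change w (p + q - b) < w a
      rw [hw a ⟨by omega, by omega⟩, hw (p + q - b) ⟨by omega, by omega⟩]
      omega
    · simp

/-- Induction along the recursion of `doubleGroth`. With row parameters 1 - x_i the exchange
relation is the recursion for `demazure`, the sign accounting for the change of length. The relation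
holds at every ascent, so the arbitrary choice made in `doubleGroth` does no harm and no braid
relations are needed. -/
theorem doubleGroth_eq_gridSum {p q : ℤ} {m : ℕ} (hm : p + m - 1 = q) {w : Equiv.Perm ℤ}
    (hw : SuppIn p q w) : doubleGroth p q w = (-1) ^ len w * gridSum polyX polyA p m w := by
  induction hc : (nonInv p q w).card using Nat.strong_induction_on generalizing w with
  | _ c ih =>
    rw [doubleGroth]
    split_ifs with h
    · have hi := h.choose_spec
      set i := h.choose
      have hi' := Finset.mem_Ico.1 hi.1
      have hsw : SuppIn p q (w * Equiv.swap i (i + 1)) :=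
        hw.mul (suppIn_swap hi'.1 (by omega))
      rw [ih _ (hc ▸ card_nonInv_lt hi) hsw rfl]
      apply demazure_eq_of
      have hex := gridSum_exchange polyX polyA p m w (i := i) hi'.1 (by omega) hi.2
      have hmap := map_gridSum (MvPolynomial.rename (Equiv.swap i (i + 1)) :
        MvPolynomial ℤ LamHat →ₐ[LamHat] MvPolynomial ℤ LamHat).toRingHom polyX polyA p m
        (w * Equiv.swap i (i + 1))
      simp only [AlgHom.toRingHom_eq_coe, RingHom.coe_coe, rename_polyA] at hmap
      rw [map_mul, hmap, map_pow, map_neg, map_one, neg_one_pow_len_mul_swap hw]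
      have hX : (fun k => MvPolynomial.rename (Equiv.swap i (i + 1)) (polyX k)) =
          fun k => polyX (Equiv.swap i (i + 1) k) := by
        funext k
        simp [polyX]
      rw [hX]
      linear_combination (-1) ^ len w * hex
    · have hl := longest_apply hw fun i hi hlt => h ⟨i, hi, hlt⟩
      rw [gridSum_longest polyX polyA hm hl, len_longest hw hl, ← Finset.prod_const,
        ← Finset.prod_mul_distrib]
      refine Finset.prod_congr rfl fun c _ => ?_
      rw [polyX_mul_polyA]
      ring

section Lattice

variable {A : Type*} [CommRing A] {P : ℤ → ℤ → Prop}

@[simp] theorem noPipe_nil : (noPipe [] : A) = 1 := by simp [noPipe]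

@[simp] theorem noPipe_cons_none (ts : List (Option ℤ)) :
    (noPipe (none :: ts) : A) = noPipe ts := by simp [noPipe]

@[simp] theorem noPipe_cons_some (v : ℤ) (ts : List (Option ℤ)) :
    (noPipe (some v :: ts) : A) = 0 := by simp [noPipe]

theorem noPipe_append_none (ts : List (Option ℤ)) :
    (noPipe (ts ++ [none]) : A) = noPipe ts := by
  induction ts with
  | nil => simp
  | cons t ts ih => rcases t with _ | t <;> simp [ih]

/-! ### Stability -/

theorem row_snoc (X : A) {as : List A} (α : A) (c : Option ℤ) {ss : List (Option ℤ)}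
    (s : Option ℤ) (hl : as.length = ss.length) (φ : List (Option ℤ) → Option ℤ → A) :
    row P X (as ++ [α]) c (ss ++ [s]) φ =
      row P X as c ss fun ts m => tileOp P (X * α) m s fun d n => φ (ts ++ [n]) d := by
  induction as generalizing c ss φ with
  | nil =>
    cases ss with
    | nil => simp [row]
    | cons s ss => simp at hl
  | cons β as ih =>
    cases ss with
    | nil => simp at hl
    | cons s' ss =>
      simp only [List.cons_append, row]
      congr 1
      funext m n
      exact ih m (by simpa using hl) _

/-- Every row must end with a pipe, so a last column without a pipe from the south consists of
horizontal tiles, of weight 1. -/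
theorem latticeSum_snoc_none {as : List A} (α : A) (rs : List (A × ℤ)) {ss : List (Option ℤ)}
    (hl : as.length = ss.length) (φ : List (Option ℤ) → A) :
    latticeSum P (as ++ [α]) rs (ss ++ [none]) φ =
      latticeSum P as rs ss fun ts => φ (ts ++ [none]) := by
  induction rs generalizing ss with
  | nil => rfl
  | cons r rs ih =>
    simp only [latticeSum]
    rw [row_snoc _ _ _ _ hl]
    refine row_congr fun ts d hr => ?_
    have hl' : as.length = ts.length := hl.trans hr.length_eq.symm
    rcases d with _ | d
    · simp [tileOp]
    · simp only [tileOp]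
      by_cases hd : d = r.2
      · simp [hd, ih hl']
      · simp [hd]

/-- The bottom row must release the largest label, which sits in the last column: the row is frozen
and leaves the last column without a pipe. -/
theorem gridSum_add_one (X α : ℤ → A) (p : ℤ) (m : ℕ) (w : Equiv.Perm ℤ)
    (hw : w (p + m) = p + m) : gridSum X α p (m + 1) w = gridSum X α p m w := by
  rw [gridSum, upInts_add, downInts]
  have hu : upInts (p + m) 1 = [p + m] := rfl
  have h1 : p + ((m + 1 : ℕ) : ℤ) - 1 = p + m := by push_cast; ring
  rw [hu, List.map_append, List.map_append, h1]
  simp only [List.map_cons, List.map_nil, latticeSum, hw]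
  rw [row_exit (P := anyCross) (X (p + m)) (ls := upInts p m) (e := p + m) (ss := [])
    (by simp) (fun u hu => (mem_upInts.1 hu).2) (by simp) fun ts =>
      latticeSum anyCross (List.map α (upInts p m) ++ [α (p + m)])
        (List.map (fun i => (X i, w i)) (downInts (p + m - 1) m)) ts noPipe,
    latticeSum_snoc_none _ _ (by simp), gridSum]
  congr 1
  funext ts
  exact noPipe_append_none ts

theorem gridSum_add (X α : ℤ → A) (p : ℤ) (m k : ℕ) (w : Equiv.Perm ℤ)
    (hw : ∀ i, p + m ≤ i → w i = i) : gridSum X α p (m + k) w = gridSum X α p m w := by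
  induction k with
  | zero => rfl
  | succ k ih =>
    rw [← add_assoc, gridSum_add_one _ _ _ _ _ (hw _ (by push_cast; omega)), ih]

theorem row_carry_noPipe (x : A) {as : List A} {ss : List (Option ℤ)} (hl : as.length = ss.length)
    (e : ℤ) :
    (open Classical in
      row P x as (some e) ss fun ts d => if d = some e then (noPipe ts : A) else 0) =
      noPipe ss := by
  induction as generalizing ss with
  | nil =>
    cases ss with
    | nil => simp [row]
    | cons s ss => simp at hl
  | cons α as ih =>
    cases ss with
    | nil => simp at hl
    | cons s ss =>
      have hl' : as.length = ss.length := by simpa using hl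
      rcases s with _ | v
      · simp [row, tileOp, ih hl']
      · simp [row, tileOp]

/-- The tile in the top row and first column would have weight `x * a - 1 = 0` if empty. Hence the
pipe `e` climbs the whole first column and leaves along the top row; all these tiles have weight 1
and do not affect the rest. -/
theorem latticeSum_unit_corner {x a : A} (h : x * a = 1) {as : List A} (rs : List (A × ℤ)) (e : ℤ)
    {ss : List (Option ℤ)} (hl : as.length = ss.length) :
    latticeSum P (a :: as) (rs ++ [(x, e)]) (some e :: ss) noPipe =
      latticeSum P as rs ss noPipe := by
  induction rs generalizing ss with
  | nil =>
    have := row_carry_noPipe (P := P) x hl e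
    simpa [latticeSum, row, tileOp] using this
  | cons r rs ih =>
    simp only [List.cons_append, latticeSum, row, tileOp]
    have h0 : ∀ ts, latticeSum P (a :: as) (rs ++ [(x, e)]) (none :: ts) noPipe = 0 := by
      intro ts
      rw [latticeSum_none_cons]
      simp [h]
    simp only [h0, ite_self, row_zero, add_zero]
    refine row_congr fun ts d hr => ?_
    rw [ih (hl.trans hr.length_eq.symm)]

theorem gridSum_unit_corner (X α : ℤ → A) (p : ℤ) (m : ℕ) (w : Equiv.Perm ℤ) (hw : w p = p)
    (h : X p * α p = 1) : gridSum X α p (m + 1) w = gridSum X α (p + 1) m w := by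
  rw [gridSum, gridSum, downInts_add]
  have h1 : p + ((m + 1 : ℕ) : ℤ) - 1 = p + 1 + m - 1 := by push_cast; ring
  have h2 : downInts (p + 1 + m - 1 - m) 1 = [p] := by simp only [downInts, List.cons.injEq, and_true]; ring
  rw [h1, h2, upInts, List.map_cons, List.map_cons, List.map_append, List.map_cons, hw]
  exact latticeSum_unit_corner h _ _ (by simp)

/-! ### Inverted pipes stay inverted -/

theorem reduceOption_cons (c : Option ℤ) (ss : List (Option ℤ)) :
    (c :: ss).reduceOption = c.toList ++ ss.reduceOption := by
  cases c <;> simp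

theorem TileRel.inverted {c s m n : Option ℤ} (h : TileRel P c s m n) {u v : ℤ} (huv : v < u)
    {ss : List (Option ℤ)} (hs : [u, v].Sublist (c :: s :: ss).reduceOption) :
    [u, v].Sublist (n :: m :: ss).reduceOption := by
  cases h with
  | cross h k _ =>
    rcases le_or_gt k h with hk | hk
    · rwa [min_eq_right hk, max_eq_left hk]
    · rw [min_eq_left hk.le, max_eq_right hk.le]
      simp only [List.reduceOption_cons_of_some] at hs ⊢
      rw [List.sublist_cons_iff] at hs
      rcases hs with hs | ⟨r, hr, hs⟩
      · rw [List.sublist_cons_iff] at hs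
        rcases hs with hs | ⟨r, hr, hs⟩
        · exact (hs.cons _).cons _
        · obtain ⟨rfl, rfl⟩ := List.cons.inj hr
          exact (hs.cons _).cons_cons _
      · obtain ⟨rfl, rfl⟩ := List.cons.inj hr
        rw [List.sublist_cons_iff] at hs
        rcases hs with hs | ⟨r, hr, hs⟩
        · exact (hs.cons_cons _).cons _
        · obtain ⟨rfl, rfl⟩ := List.cons.inj hr
          omega
  | _ => simpa using hs

/-- Edges are read from northwest to southeast, so the east end comes after the north sides. A
crossing sends the larger label north, that is, to the earlier edge, so a larger label in front of a
smaller one stays there. -/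
theorem RowRel.inverted {c d : Option ℤ} {ss ts : List (Option ℤ)} (h : RowRel P c ss ts d)
    {u v : ℤ} (huv : v < u) (hs : [u, v].Sublist (c :: ss).reduceOption) :
    [u, v].Sublist (ts ++ [d]).reduceOption := by
  induction h with
  | nil c => simpa using hs
  | @cons c s m n d ss ts h hr ih =>
    have h1 := h.inverted huv hs
    rw [List.cons_append]
    rcases n with _ | n
    · rw [List.reduceOption_cons_of_none] at h1 ⊢
      exact ih h1
    · rw [List.reduceOption_cons_of_some] at h1 ⊢
      rw [List.sublist_cons_iff] at h1
      rcases h1 with h1 | ⟨r, hr', h1⟩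
      · exact (ih h1).cons _
      · obtain ⟨rfl, rfl⟩ := List.cons.inj hr'
        rw [List.singleton_sublist] at h1
        refine List.Sublist.cons_cons _ ?_
        rw [List.singleton_sublist]
        exact hr.perm.mem_iff.1 h1

theorem latticeSum_eq_zero_of_mem (as : List A) {rs : List (A × ℤ)} {ss : List (Option ℤ)} {u : ℤ}
    (hu : some u ∈ ss) (hrs : ∀ r ∈ rs, r.2 ≠ u) : latticeSum P as rs ss noPipe = 0 := by
  induction rs generalizing ss with
  | nil =>
    simp only [latticeSum, noPipe]
    exact if_neg fun h => by simpa using h _ hu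
  | cons r rs ih =>
    refine row_eq_zero fun ts d hr => ?_
    split_ifs with hd
    · refine ih ?_ fun r' hr' => hrs r' (List.mem_cons_of_mem _ hr')
      rcases (hr.mem_iff u).1 (Or.inr hu) with h | h
      · exact absurd (Option.some_injective _ (hd.symm.trans h)) (hrs r (List.mem_cons_self ..))
      · exact h
    · rfl

theorem sublist_append_singleton {u v e : ℤ} {l : List ℤ} (h : [u, v].Sublist (l ++ [e])) :
    [u, v].Sublist l ∨ (v = e ∧ u ∈ l) := by
  rw [← List.reverse_sublist, List.reverse_append] at h
  simp only [List.reverse_cons, List.reverse_nil, List.nil_append, List.singleton_append] at h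
  rw [List.sublist_cons_iff] at h
  rcases h with h | ⟨r, hr, h⟩
  · left
    rw [← List.reverse_sublist]
    simpa using h
  · right
    obtain ⟨rfl, rfl⟩ := List.cons.inj hr
    rw [List.singleton_sublist] at h
    exact ⟨rfl, by simpa using h⟩

/-- The exits decrease from bottom to top, so `u` would have to leave before `v`. But `u` stays in
front of `v` and cannot take the east end while `v` is present; once `v` has left, all later exits
are too small for `u`. -/
theorem latticeSum_eq_zero_of_inverted (as : List A) {rs : List (A × ℤ)} {ss : List (Option ℤ)}
    {u v : ℤ} (huv : v < u) (hs : [u, v].Sublist ss.reduceOption)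
    (hrs : rs.Pairwise fun r r' => r'.2 < r.2) : latticeSum P as rs ss noPipe = 0 := by
  induction rs generalizing ss with
  | nil =>
    refine latticeSum_eq_zero_of_mem as (u := u) ?_ (by simp)
    rw [← List.reduceOption_mem_iff]
    exact hs.subset (by simp)
  | cons r rs ih =>
    rw [List.pairwise_cons] at hrs
    refine row_eq_zero fun ts d hr => ?_
    split_ifs with hd
    · have h1 := hr.inverted huv (by simpa using hs)
      subst hd
      rw [List.reduceOption_append] at h1
      rcases sublist_append_singleton h1 with h2 | ⟨rfl, h2⟩
      · exact ih h2 hrs.2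
      · refine latticeSum_eq_zero_of_mem as (List.reduceOption_mem_iff.1 h2) ?_
        intro r' hr' he
        have := hrs.1 r' hr'
        omega
    · rfl

/-! ### Pipes with nonpositive labels do not cross -/

/-- Only pipes with positive labels may cross. -/
abbrev posCross : ℤ → ℤ → Prop := fun h v => 0 < h ∧ 0 < v

/-- Some pipe with a nonpositive label is preceded by a pipe with a larger label. -/
def NonposInverted (l : List (Option ℤ)) : Prop :=
  ∃ u v : ℤ, v < u ∧ v ≤ 0 ∧ [u, v].Sublist l.reduceOption

theorem TileRel.nodup {c s m n : Option ℤ} {ss : List (Option ℤ)} (h : TileRel P c s m n)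
    (hn : (c :: s :: ss).reduceOption.Nodup) : (m :: ss).reduceOption.Nodup := by
  cases h with
  | cross h v _ =>
    simp only [List.reduceOption_cons_of_some, List.nodup_cons, List.mem_cons, not_or] at hn ⊢
    refine ⟨?_, hn.2.2⟩
    rcases min_choice h v with hm | hm <;> rw [hm]
    exacts [hn.1.2, hn.2.1]
  | _ =>
    simp only [List.reduceOption_cons_of_some, List.reduceOption_cons_of_none, List.nodup_cons]
      at hn ⊢
    first | exact hn | exact hn.2

/-- Forbidding the crossings of nonpositive labels removes only terms on which the continuation
vanishes. -/
theorem row_posCross (X : A) {as : List A} {c : Option ℤ} {ss : List (Option ℤ)}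
    (hn : (c :: ss).reduceOption.Nodup) {φ : List (Option ℤ) → Option ℤ → A}
    (hφ : ∀ ts d, NonposInverted (ts ++ [d]) → φ ts d = 0) :
    row anyCross X as c ss φ = row posCross X as c ss φ := by
  induction as generalizing c ss φ with
  | nil => cases ss <;> rfl
  | cons α as ih =>
    cases ss with
    | nil => rfl
    | cons s ss =>
      have hih : ∀ m n, TileRel anyCross c s m n →
          row anyCross X as m ss (fun ts d => φ (n :: ts) d) =
            row posCross X as m ss (fun ts d => φ (n :: ts) d) := by
        intro m n h
        refine ih (h.nodup hn) ?_
        rintro ts d ⟨u, v, h1, h2, h3⟩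
        refine hφ _ _ ⟨u, v, h1, h2, ?_⟩
        rw [List.cons_append, reduceOption_cons]
        exact h3.trans (List.sublist_append_right ..)
      simp only [row]
      rw [tileOp_congr hih]
      rcases c with _ | h <;> rcases s with _ | v
      · rfl
      · rfl
      · rfl
      · simp only [tileOp, if_true]
        split_ifs with hp
        · rfl
        · rw [← hih _ _ (.cross h v trivial)]
          -- At a forbidden crossing the smaller label is nonpositive and ends behind the larger
          -- one.
          refine row_eq_zero fun ts d hr => hφ _ _ ⟨max h v, min h v, ?_, ?_, ?_⟩
          · have : h ≠ v := by
              rintro rfl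
              simp at hn
            omega
          · omega
          · rw [List.cons_append, List.reduceOption_cons_of_some]
            refine List.Sublist.cons_cons _ ?_
            rw [List.singleton_sublist]
            exact hr.perm.mem_iff.1 (by simp)

/-- The exits are positive, so the nonpositive label `v` never leaves. It keeps `u` away from the
east end, and the inverted pair survives to the top, where `φ` vanishes. -/
theorem latticeSum_eq_zero_of_nonposInverted (as : List A) {rs : List (A × ℤ)}
    {ss : List (Option ℤ)} (hs : NonposInverted ss) (hrs : ∀ r ∈ rs, 0 < r.2)
    {φ : List (Option ℤ) → A} (hφ : ∀ ts, NonposInverted ts → φ ts = 0) :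
    latticeSum P as rs ss φ = 0 := by
  induction rs generalizing ss with
  | nil => exact hφ _ hs
  | cons r rs ih =>
    refine row_eq_zero fun ts d hr => ?_
    split_ifs with hd
    · obtain ⟨u, v, h1, h2, h3⟩ := hs
      have h4 := hr.inverted h1 (by simpa using h3)
      subst hd
      rw [List.reduceOption_append] at h4
      rcases sublist_append_singleton h4 with h5 | ⟨h5, -⟩
      · exact ih ⟨u, v, h1, h2, h5⟩ fun r' hr' => hrs r' (List.mem_cons_of_mem _ hr')
      · have := hrs r (List.mem_cons_self ..)
        omega
    · rfl

theorem latticeSum_posCross (as : List A) {rs : List (A × ℤ)} {ss : List (Option ℤ)}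
    (hn : ss.reduceOption.Nodup) (hrs : ∀ r ∈ rs, 0 < r.2)
    {φ : List (Option ℤ) → A} (hφ : ∀ ts, NonposInverted ts → φ ts = 0) :
    latticeSum anyCross as rs ss φ = latticeSum posCross as rs ss φ := by
  induction rs generalizing ss with
  | nil => rfl
  | cons r rs ih =>
    have hrs' : ∀ r' ∈ rs, 0 < r'.2 := fun r' hr' => hrs r' (List.mem_cons_of_mem _ hr')
    simp only [latticeSum]
    rw [row_posCross _ (by simpa using hn)]
    · refine row_congr fun ts d hr => ?_
      rw [ih ?_ hrs']
      have := hr.perm.nodup_iff.1 (by simpa using hn)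
      rw [List.reduceOption_append] at this
      exact this.of_append_left
    · rintro ts d ⟨u, v, h1, h2, h3⟩
      split_ifs with hd
      · subst hd
        rw [List.reduceOption_append] at h3
        rcases sublist_append_singleton h3 with h5 | ⟨h5, -⟩
        · exact latticeSum_eq_zero_of_nonposInverted as ⟨u, v, h1, h2, h5⟩ hrs' hφ
        · have := hrs r (List.mem_cons_self ..)
          omega
      · rfl

/-- A nonpositive pipe that turned east under an occupied neighbouring column would have to cross
there, which is forbidden; so the pipes of `ls` go straight up. -/
theorem row_prefix (X : A) {as₀ : List A} (as : List A) {ls : List ℤ}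
    (hl : as₀.length = ls.length) (hls : ∀ v ∈ ls, v ≤ 0) (u : ℤ) (ss : List (Option ℤ))
    (φ : List (Option ℤ) → Option ℤ → A) :
    row posCross X (as₀ ++ as) none (ls.map some ++ some u :: ss) φ =
      row posCross X as none (some u :: ss) fun ts d => φ (ls.map some ++ ts) d := by
  induction as₀ generalizing ls φ with
  | nil =>
    cases ls with
    | nil => rfl
    | cons v ls => simp at hl
  | cons α as₀ ih =>
    cases ls with
    | nil => simp at hl
    | cons v ls =>
      have hv := hls v (List.mem_cons_self ..)
      have hc : ∀ (bs : List A) (x : ℤ) (xs : List (Option ℤ))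
          (ψ : List (Option ℤ) → Option ℤ → A),
          row posCross X bs (some v) (some x :: xs) ψ = 0 := by
        intro bs x xs ψ
        cases bs with
        | nil => rfl
        | cons b bs =>
          simp only [row, tileOp]
          exact if_neg fun h => by omega
      simp only [List.map_cons, List.cons_append, row, tileOp]
      rw [ih (by simpa using hl) fun x hx => hls x (List.mem_cons_of_mem _ hx)]
      rw [add_eq_left]
      cases ls with
      | nil => exact hc _ _ _ _
      | cons y ls => exact hc _ _ _ _

/-- By `row_prefix` one row can disturb only the last of the contiguous nonpositive columns `qs`.
With at most `qs.length` rows the disturbance never reaches the columns of `ls`. -/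
theorem latticeSum_prefix {as₀ as : List A} {rs : List (A × ℤ)} {ls : List ℤ}
    (hl : as₀.length = ls.length) (hls : ∀ v ∈ ls, v ≤ 0) {qs : List ℤ} (hq : ∀ v ∈ qs, v ≤ 0)
    (hrs : rs.length ≤ qs.length) (has : qs.length ≤ as.length) (ss : List (Option ℤ))
    (φ : List (Option ℤ) → A) :
    latticeSum posCross (as₀ ++ as) rs (ls.map some ++ (qs.map some ++ ss)) φ =
      latticeSum posCross as rs (qs.map some ++ ss) fun ts => φ (ls.map some ++ ts) := by
  induction rs generalizing qs ss with
  | nil => rfl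
  | cons r rs ih =>
    rcases List.eq_nil_or_concat qs with rfl | ⟨qs, u, rfl⟩
    · simp at hrs
    · simp only [List.concat_eq_append, List.length_append, List.length_cons, List.length_nil,
        zero_add, List.mem_append, List.mem_singleton, add_le_add_iff_right] at hq hrs has
      have hq' : ∀ v ∈ qs, v ≤ 0 := fun v hv => hq v (Or.inl hv)
      obtain ⟨as₁, as₂, rfl, h1⟩ : ∃ as₁ as₂, as = as₁ ++ as₂ ∧ as₁.length = qs.length :=
        ⟨as.take qs.length, as.drop qs.length, by simp, by simp; omega⟩
      simp only [latticeSum, List.concat_eq_append, List.map_append, List.map_cons, List.map_nil,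
        List.append_assoc, List.cons_append, List.nil_append]
      rw [row_prefix _ as₂ h1 hq']
      rw [← List.append_assoc as₀, ← List.append_assoc (ls.map some), ← List.map_append,
        row_prefix _ as₂ (by simp [hl, h1]) (by
          intro v hv
          rcases List.mem_append.1 hv with h | h
          exacts [hls v h, hq' v h])]
      refine row_congr fun ts d hr => ?_
      rw [List.map_append, List.append_assoc, List.append_assoc, ih hq' hrs (by omega)]

end Lattice

section Lattice

variable {A : Type*} [CommRing A] {P : ℤ → ℤ → Prop}

/-! ### Relabelling -/

theorem tileOp_relabel {f : ℤ → ℤ} (hf : StrictMono f) (z : A) (c s : Option ℤ)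
    (ψ : Option ℤ → Option ℤ → A) :
    tileOp anyCross z (c.map f) (s.map f) ψ =
      tileOp anyCross z c s fun m n => ψ (m.map f) (n.map f) := by
  rcases c with _ | c <;> rcases s with _ | s <;>
    simp [tileOp, hf.monotone.map_min, hf.monotone.map_max]

theorem row_relabel {f : ℤ → ℤ} (hf : StrictMono f) (X : A) (as : List A) (c : Option ℤ)
    (ss : List (Option ℤ)) (φ : List (Option ℤ) → Option ℤ → A) :
    row anyCross X as (c.map f) (ss.map (Option.map f)) φ =
      row anyCross X as c ss fun ts d => φ (ts.map (Option.map f)) (d.map f) := by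
  induction as generalizing c ss φ with
  | nil => cases ss <;> rfl
  | cons α as ih =>
    cases ss with
    | nil => rfl
    | cons s ss =>
      simp only [List.map_cons, row, tileOp_relabel hf]
      congr 1
      funext m n
      exact ih _ _ _

/-- The model uses labels only through comparison, so an increasing relabelling changes nothing. -/
theorem latticeSum_relabel {f : ℤ → ℤ} (hf : StrictMono f) (as : List A) (rs : List (A × ℤ))
    (ss : List (Option ℤ)) (φ : List (Option ℤ) → A) :
    latticeSum anyCross as (rs.map fun r => (r.1, f r.2)) (ss.map (Option.map f)) φ =
      latticeSum anyCross as rs ss fun ts => φ (ts.map (Option.map f)) := by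
  classical
  induction rs generalizing ss with
  | nil => rfl
  | cons r rs ih =>
    simp only [List.map_cons, latticeSum]
    have := row_relabel hf r.1 as none ss fun ts d => if d = some (f r.2) then
      latticeSum anyCross as (rs.map fun r => (r.1, f r.2)) ts φ else 0
    rw [Option.map_none] at this
    rw [this]
    congr 1
    funext ts d
    rw [ih]
    rcases d with _ | d
    · simp
    · simp [hf.injective.eq_iff]

/-! ### Rows of a permutation with no descents -/

open Classical in
/-- The label of the column `j`, which is removed if `j ∈ H`. -/
def holeLabel (H : Set ℤ) (j : ℤ) : Option ℤ := if j ∈ H then none else some j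

theorem holeLabel_of_mem {H : Set ℤ} {j : ℤ} (h : j ∈ H) : holeLabel H j = none := if_pos h

theorem holeLabel_of_notMem {H : Set ℤ} {j : ℤ} (h : j ∉ H) : holeLabel H j = some j := if_neg h

/-- `H` collects the labels that have already left, all larger than those still to leave. Hence
every row is frozen by `row_exit`, with weight 1, and just adds its exit to `H`. -/
theorem latticeSum_exits {as : List A} {rs : List (A × ℤ)} {L : List ℤ} (H : Set ℤ)
    (hl : as.length = L.length) (hL : L.Pairwise (· < ·)) (hrs : rs.Pairwise fun r r' => r'.2 < r.2)
    (hmem : ∀ r ∈ rs, r.2 ∈ L) (hH : ∀ x ∈ H, ∀ r ∈ rs, r.2 < x) (φ : List (Option ℤ) → A) :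
    latticeSum anyCross as rs (L.map (holeLabel H)) φ =
      φ (L.map (holeLabel (H ∪ {x | ∃ r ∈ rs, r.2 = x}))) := by
  induction rs generalizing H with
  | nil => simp [latticeSum]
  | cons r rs ih =>
    obtain ⟨ls, L', rfl⟩ := List.append_of_mem (hmem r (List.mem_cons_self ..))
    rw [List.pairwise_append, List.pairwise_cons] at hL
    rw [List.pairwise_cons] at hrs
    have hHr : ∀ x ∈ H, r.2 < x := fun x hx => hH x hx r (List.mem_cons_self ..)
    have hls : ∀ u ∈ ls, u < r.2 := fun u hu => hL.2.2 u hu _ (List.mem_cons_self ..)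
    have e1 : (ls ++ r.2 :: L').map (holeLabel H) =
        ls.map some ++ some r.2 :: L'.map (holeLabel H) := by
      rw [List.map_append, List.map_cons, holeLabel_of_notMem fun h => (hHr _ h).false]
      congr 1
      exact List.map_congr_left fun u hu => holeLabel_of_notMem fun h => by
        have := hls u hu
        have := hHr u h
        omega
    have e2 : ls.map some ++ none :: L'.map (holeLabel H) =
        (ls ++ r.2 :: L').map (holeLabel (H ∪ {r.2})) := by
      rw [List.map_append, List.map_cons, holeLabel_of_mem (by simp)]
      congr 1
      · refine (List.map_congr_left fun u hu => holeLabel_of_notMem ?_).symm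
        rintro (h | h)
        · have := hls u hu
          have := hHr u h
          omega
        · exact (hls u hu).ne h
      · congr 1
        refine List.map_congr_left fun u hu => ?_
        have := hL.2.1.1 u hu
        by_cases h : u ∈ H
        · rw [holeLabel_of_mem h, holeLabel_of_mem (Or.inl h)]
        · rw [holeLabel_of_notMem h, holeLabel_of_notMem]
          rintro (h' | h')
          exacts [h h', this.ne' h']
    rw [e1, latticeSum]
    rw [row_exit (P := anyCross) r.1 (by simpa using hl) hls ?_ fun ts => latticeSum anyCross as rs ts φ,
      e2, ih _ hrs.2 (fun r' hr' => hmem r' (List.mem_cons_of_mem _ hr'))]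
    · congr 3
      ext x
      simp only [Set.mem_union, Set.mem_singleton_iff, Set.mem_ofPred_eq, List.mem_cons,
        exists_eq_or_imp]
      tauto
    · rintro x (hx | hx) r' hr'
      · exact hH x hx r' (List.mem_cons_of_mem _ hr')
      · rw [hx]
        exact hrs.1 r' hr'
    · intro v hv
      obtain ⟨u, hu, he⟩ := List.mem_map.1 hv
      have := hL.2.1.1 u hu
      by_cases h : u ∈ H
      · simp [holeLabel_of_mem h] at he
      · rw [holeLabel_of_notMem h] at he
        obtain rfl := Option.some_injective _ he
        exact ⟨this, trivial⟩

theorem optionList_ext {s t : List (Option ℤ)} (h : s.map Option.isSome = t.map Option.isSome)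
    (h' : s.reduceOption = t.reduceOption) : s = t := by
  induction s generalizing t with
  | nil => simpa using h.symm
  | cons a s ih =>
    cases t with
    | nil => simp at h
    | cons b t =>
      simp only [List.map_cons, List.cons.injEq] at h
      rcases a with _ | a <;> rcases b with _ | b
      · rw [ih h.2 (by simpa using h')]
      · simp at h
      · simp at h
      · simp only [List.reduceOption_cons_of_some, List.cons.injEq] at h'
        rw [ih h.2 h'.2, h'.1]

theorem pairwise_lt_upInts (p : ℤ) (m : ℕ) : (upInts p m).Pairwise (· < ·) := by
  induction m generalizing p with
  | zero => simp [upInts]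
  | succ m ih =>
    rw [upInts, List.pairwise_cons]
    exact ⟨fun x hx => by rw [mem_upInts] at hx; omega, ih _⟩

theorem pairwise_gt_downInts (q : ℤ) (m : ℕ) : (downInts q m).Pairwise fun i j => j < i := by
  induction m generalizing q with
  | zero => simp [downInts]
  | succ m ih =>
    rw [downInts, List.pairwise_cons]
    exact ⟨fun x hx => by rw [mem_downInts] at hx; omega, ih _⟩

theorem map_reduceOption (f : ℤ → ℤ) (s : List (Option ℤ)) :
    (s.map (Option.map f)).reduceOption = s.reduceOption.map f := by
  induction s with
  | nil => rfl
  | cons a s ih => rcases a with _ | a <;> simp [ih]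

theorem reduceOption_map_holeLabel (H : Set ℤ) (L : List ℤ) :
    (open Classical in (L.map (holeLabel H)).reduceOption = L.filter fun j => j ∉ H) := by
  induction L with
  | nil => rfl
  | cons j L ih =>
    by_cases h : j ∈ H
    · simp [holeLabel_of_mem h, h, ih]
    · simp [holeLabel_of_notMem h, h, ih]

/-! ### Splitting a partition function between the rows `0` and `1` -/

/-- The partition function of the rows `1 - k, …, 0` with the labels `1 - k, …, 0` at the east
ends. -/
def upperSum (X α : ℤ → A) (k n : ℕ) (s : List (Option ℤ)) : A :=
  latticeSum anyCross ((upInts (1 - k) (k + n)).map α) ((downInts 0 k).map fun i => (X i, i)) s noPipe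

theorem gridSum_split (X α : ℤ → A) (k n : ℕ) (w : Equiv.Perm ℤ) :
    gridSum X α (1 - k) (k + n) w =
      latticeSum anyCross ((upInts (1 - k) (k + n)).map α) ((downInts n n).map fun i => (X i, w i))
        ((upInts (1 - k) (k + n)).map some) fun ts =>
        latticeSum anyCross ((upInts (1 - k) (k + n)).map α)
          ((downInts 0 k).map fun i => (X i, w i)) ts noPipe := by
  have h : (1 - k : ℤ) + ((k + n : ℕ) : ℤ) - 1 = n := by push_cast; ring
  rw [gridSum, h, add_comm k n, downInts_add, sub_self, List.map_append, latticeSum_append]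

/-- Since `v` increases on the positive integers, its rows 1, ..., `n` are frozen and remove the
labels v(1), ..., v(n). The remaining labels v(1 - k) < ... < v(0) are renamed 1 - k, ..., 0, so
only their positions matter. -/
theorem gridSum_eq_upperSum (X α : ℤ → A) {k n : ℕ} {v : Equiv.Perm ℤ}
    (hv : SuppIn (1 - k) n v) (h0 : StrictMonoOn v (Set.Iic 0)) (h1 : StrictMonoOn v (Set.Ioi 0))
    {s : List (Option ℤ)} (hs : s.reduceOption = upInts (1 - k) k)
    (hs' : s.map Option.isSome =
      (upInts (1 - k) (k + n)).map fun j => decide (v.symm j ≤ 0)) :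
    gridSum X α (1 - k) (k + n) v = upperSum X α k n s := by
  classical
  set E : Set ℤ := {x | ∃ r ∈ (downInts n n).map fun i => (X i, v i), r.2 = x} with hE
  have hEmem : ∀ x, x ∈ E ↔ 1 ≤ v.symm x ∧ v.symm x ≤ n := by
    intro x
    simp only [hE, Set.mem_ofPred_eq, List.mem_map, mem_downInts]
    constructor
    · rintro ⟨_, ⟨i, hi, rfl⟩, rfl⟩
      rw [Equiv.symm_apply_apply]
      omega
    · intro h
      exact ⟨_, ⟨v.symm x, by omega, rfl⟩, by simp⟩
  have hv' : ∀ i : ℤ, i ≤ n → v i ≤ n := by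
    intro i hi
    by_cases hi' : i ∈ Set.Icc (1 - k : ℤ) n
    · exact (hv.mem hi').2
    · rwa [hv i hi']
  have hvs : ∀ j : ℤ, j ≤ n → v.symm j ≤ n := by
    intro j hj
    by_contra hc
    have h2 := hv (v.symm j) (by simp; omega)
    rw [Equiv.apply_symm_apply] at h2
    omega
  -- Only the values at `i ≤ 0` are used. Beyond 0 the shift by `n` keeps `f` increasing, as `v`
  -- sends nonpositive integers to integers at most `n`.
  set f : ℤ → ℤ := fun i => if i ≤ 0 then v i else i + n with hf
  have hfm : StrictMono f := by
    intro i j hij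
    simp only [hf]
    split_ifs with hi hj
    · exact h0 hi hj hij
    · have := hv' i (by omega)
      omega
    · omega
    · omega
  have hdec : ((upInts (1 - k) (k + n)).map (holeLabel E)) = s.map (Option.map f) := by
    apply optionList_ext
    · have : (s.map (Option.map f)).map Option.isSome = s.map Option.isSome := by
        rw [List.map_map]
        refine List.map_congr_left fun x _ => ?_
        simp
      rw [this, hs', List.map_map]
      refine List.map_congr_left fun j hj => ?_
      rw [mem_upInts] at hj
      have h2 := hvs j (by push_cast at hj; omega)
      by_cases h : j ∈ E
      · have := (hEmem j).1 h
        simp only [Function.comp_apply, holeLabel_of_mem h]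
        simp; omega
      · have := mt (hEmem j).2 h
        simp only [Function.comp_apply, holeLabel_of_notMem h]
        simp; omega
    · rw [map_reduceOption, hs, reduceOption_map_holeLabel]
      have hp2 : ((upInts (1 - k) k).map f).Pairwise (· < ·) := by
        rw [List.pairwise_map]
        exact (pairwise_lt_upInts (1 - k) k).imp fun h => hfm h
      refine List.Perm.eq_of_pairwise (le := (· < ·)) (fun a b _ _ h h' => (lt_asymm h h').elim)
        ((pairwise_lt_upInts _ _).filter _) hp2 ?_
      rw [List.perm_ext_iff_of_nodup (((pairwise_lt_upInts _ _).filter _).imp ne_of_lt)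
        (hp2.imp ne_of_lt)]
      intro j
      simp only [List.mem_filter, mem_upInts, List.mem_map, hEmem, decide_eq_true_eq]
      push_cast
      constructor
      · rintro ⟨⟨h2, h3⟩, h4⟩
        have h5 := hvs j (by omega)
        refine ⟨v.symm j, ⟨?_, by omega⟩, ?_⟩
        · by_contra hc
          have h2 := hv (v.symm j) (by simp; omega)
          rw [Equiv.apply_symm_apply] at h2
          omega
        · simp only [hf]
          rw [if_pos (by omega), Equiv.apply_symm_apply]
      · rintro ⟨i, hi, rfl⟩
        simp only [hf]
        rw [if_pos (by omega), Equiv.symm_apply_apply]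
        have h2 : i ∈ Set.Icc (1 - k : ℤ) n := ⟨by omega, by omega⟩
        have := hv.mem h2
        rw [Set.mem_Icc] at this
        omega
  have hexit := latticeSum_exits (as := (upInts (1 - k) (k + n)).map α)
    (rs := (downInts n n).map fun i => (X i, v i)) (L := upInts (1 - k) (k + n)) ∅ (by simp)
    (pairwise_lt_upInts ..) (by
      rw [List.pairwise_map]
      refine (pairwise_gt_downInts n n).imp_of_mem fun {i j} hi hj hij => ?_
      rw [mem_downInts] at hi hj
      exact h1 (Set.mem_Ioi.2 (by omega)) (Set.mem_Ioi.2 (by omega)) hij) (by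
      intro r hr
      obtain ⟨i, hi, rfl⟩ := List.mem_map.1 hr
      rw [mem_downInts] at hi
      have := hv.mem (i := i) ⟨by omega, by omega⟩
      rw [Set.mem_Icc] at this
      rw [mem_upInts]
      push_cast
      omega) (by simp)
  have hempty : holeLabel ∅ = some := by
    funext j
    exact holeLabel_of_notMem (Set.notMem_empty j)
  rw [hempty, Set.empty_union] at hexit
  have hrows : (downInts 0 k).map (fun i => (X i, v i)) =
      ((downInts 0 k).map fun i => (X i, i)).map fun r => (r.1, f r.2) := by
    rw [List.map_map]
    refine List.map_congr_left fun i hi => ?_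
    rw [mem_downInts] at hi
    simp only [Function.comp_apply, hf]
    rw [if_pos hi.2]
  rw [gridSum_split, hexit, ← hE, hdec, hrows, latticeSum_relabel hfm, upperSum]
  congr 1
  funext ts
  simp [noPipe]

theorem upperSum_eq_zero (X α : ℤ → A) (k n : ℕ) {s : List (Option ℤ)} {u v : ℤ} (huv : v < u)
    (hs : [u, v].Sublist s.reduceOption) : upperSum X α k n s = 0 := by
  refine latticeSum_eq_zero_of_inverted _ huv hs ?_
  rw [List.pairwise_map]
  exact pairwise_gt_downInts 0 k

/-- Above the cut `w` is the identity, so `upperSum` vanishes on inverted labels. Hence crossings of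
nonpositive pipes may be forbidden below the cut, and the `n` rows there cannot disturb the columns
left of `1 - n`. -/
theorem gridSum_eq_posCross (X α : ℤ → A) {k n : ℕ} (hk : n ≤ k) {w : Equiv.Perm ℤ}
    (hw : SuppIn 1 n w) :
    gridSum X α (1 - k) (k + n) w =
      latticeSum posCross ((upInts (1 - n) (n + n)).map α) ((downInts n n).map fun i => (X i, w i))
        ((upInts (1 - n) (n + n)).map some) fun ts =>
          upperSum X α k n ((upInts (1 - k) (k - n)).map some ++ ts) := by
  obtain ⟨e, rfl⟩ := Nat.exists_eq_add_of_le' hk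
  have hpos : ∀ r ∈ (downInts n n).map fun i => (X i, w i), 0 < r.2 := by
    intro r hr
    obtain ⟨i, hi, rfl⟩ := List.mem_map.1 hr
    rw [mem_downInts] at hi
    exact (hw.mem (i := i) ⟨by omega, by omega⟩).1
  have hrows : (downInts 0 (e + n)).map (fun i => (X i, w i)) =
      (downInts 0 (e + n)).map fun i => (X i, i) := by
    refine List.map_congr_left fun i hi => ?_
    rw [mem_downInts] at hi
    rw [hw i (by simp; omega)]
  have hup : upInts (1 - (e + n : ℕ)) (e + n + n) =
      upInts (1 - (e + n : ℕ)) e ++ (upInts (1 - n) n ++ upInts 1 n) := by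
    rw [add_assoc, upInts_add, upInts_add]
    push_cast
    rw [show (1 - (e + n) + e : ℤ) = 1 - n by ring, sub_add_cancel]
  have hup' : upInts (1 - n) (n + n) = upInts (1 - n) n ++ upInts 1 n := by
    rw [upInts_add, sub_add_cancel]
  rw [gridSum_split, hrows]
  have hnd : ((upInts (1 - (e + n : ℕ)) (e + n + n)).map some).reduceOption.Nodup := by
    have : ∀ l : List ℤ, (l.map some).reduceOption = l := by
      intro l
      induction l <;> simp_all
    rw [this]
    exact (pairwise_lt_upInts _ _).imp ne_of_lt
  have hinv : ∀ ts, NonposInverted ts → upperSum X α (e + n) n ts = 0 := by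
    rintro ts ⟨u, v, h1, -, h2⟩
    exact upperSum_eq_zero X α _ n h1 h2
  refine (latticeSum_posCross _ hnd hpos hinv).trans ?_
  rw [Nat.add_sub_cancel]
  rw [hup, List.map_append, List.map_append (f := some) (l₁ := upInts (1 - (e + n : ℕ)) e),
    List.map_append (f := some) (l₁ := upInts (1 - (n : ℤ)) n), latticeSum_prefix]
  · rw [hup', ← List.map_append]
  · simp
  · intro v hv
    rw [mem_upInts] at hv
    push_cast at hv
    omega
  · intro v hv
    rw [mem_upInts] at hv
    omega
  · simp
  · simp
end Lattice

section Lattice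

variable {A : Type*} [CommRing A]

/-! ### Partition functions as sums over fillings -/

/-- The weight of a tile with spectral parameter `z`. -/
def Tile.weight (z : A) : Tile → A
  | Tile.empty => z - 1
  | Tile.nw => z
  | _ => 1

open Classical in
/-- The labels of the east and the north side of a tile with given labels of the west and the south
side. Only pipes with positive labels may cross. -/
def tileRun : Tile → Option ℤ → Option ℤ → Option (Option ℤ × Option ℤ)
  | Tile.empty, none, none => some (none, none)
  | Tile.nw, some h, none => some (none, some h)
  | Tile.horiz, some h, none => some (some h, none)
  | Tile.vert, none, some v => some (none, some v)
  | Tile.se, none, some v => some (some v, none)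
  | Tile.cross, some h, some v =>
    if posCross h v then some (some (min h v), some (max h v)) else none
  | _, _, _ => none

/-- The labels of the north sides and of the east end of a row of tiles. -/
def rowRun : List Tile → Option ℤ → List (Option ℤ) → Option (List (Option ℤ) × Option ℤ)
  | [], c, [] => some ([], c)
  | t :: τ, c, s :: ss =>
    (tileRun t c s).bind fun r => (rowRun τ r.1 ss).map fun r' => (r.2 :: r'.1, r'.2)
  | _, _, _ => none

open Classical in
/-- The labels of the north sides of a rectangle of tiles, whose rows are listed from bottom to top,
with given labels at the east ends. -/
def gridRun : List (List Tile) → List ℤ → List (Option ℤ) → Option (List (Option ℤ))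
  | [], [], ss => some ss
  | τ :: T, e :: es, ss =>
    (rowRun τ none ss).bind fun r => if r.2 = some e then gridRun T es r.1 else none
  | _, _, _ => none

theorem sum_tile (f : Tile → A) : ∑ t, f t =
    f Tile.empty + f Tile.nw + f Tile.se + f Tile.horiz + f Tile.cross + f Tile.vert := by
  have : (Finset.univ : Finset Tile) =
    {Tile.empty, Tile.nw, Tile.se, Tile.horiz, Tile.cross, Tile.vert} := rfl
  rw [this]
  simp [Finset.sum_insert, add_assoc]

theorem tileOp_eq_sum (z : A) (c s : Option ℤ) (ψ : Option ℤ → Option ℤ → A) :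
    tileOp posCross z c s ψ =
      ∑ t : Tile, t.weight z * (tileRun t c s).elim 0 fun r => ψ r.1 r.2 := by
  rw [sum_tile]
  rcases c with _ | c <;> rcases s with _ | s <;> simp only [tileOp, tileRun, Tile.weight]
  · simp
  · simp [add_comm]
  · simp
  · by_cases h : posCross c s
    · simp only [if_pos h]
      simp
    · simp only [if_neg h]
      simp

theorem row_eq_sum (X : A) (as : List A) (c : Option ℤ) (ss : List (Option ℤ))
    (φ : List (Option ℤ) → Option ℤ → A) :
    row posCross X as c ss φ = ∑ τ : Fin as.length → Tile,
      (∏ i, (τ i).weight (X * as.get i)) *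
        (rowRun (List.ofFn τ) c ss).elim 0 fun r => φ r.1 r.2 := by
  induction as generalizing c ss φ with
  | nil => cases ss <;> simp [row, rowRun]
  | cons α as ih =>
    change _ = ∑ τ : Fin (as.length + 1) → Tile, _
    rw [← (Fin.consEquiv fun _ => Tile).sum_comp, Fintype.sum_prod_type]
    cases ss with
    | nil => simp [row, rowRun]
    | cons s ss =>
      simp only [row]
      rw [tileOp_eq_sum]
      refine Finset.sum_congr rfl fun t _ => ?_
      have hR : ∀ τ : Fin as.length → Tile,
          rowRun (List.ofFn (n := as.length + 1) (Fin.cons t τ)) c (s :: ss) =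
            (tileRun t c s).bind fun r => (rowRun (List.ofFn τ) r.1 ss).map fun r' =>
              (r.2 :: r'.1, r'.2) := by
        intro τ
        rw [List.ofFn_succ]
        rfl
      refine Eq.trans ?_ (Finset.sum_congr rfl fun τ _ =>
        (congrArg₂ (· * ·) (Fin.prod_univ_succ _)
          (congrArg (fun o => Option.elim o 0 fun r => φ r.1 r.2) (hR τ))).symm)
      rcases htr : tileRun t c s with _ | ⟨m, n⟩
      · simp
      · simp only [Option.elim_some, Option.bind_some]
        rw [ih, Finset.mul_sum]
        refine Finset.sum_congr rfl fun τ _ => ?_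
        simp only [← mul_assoc]
        congr 1
        rcases rowRun (List.ofFn τ) m ss with _ | ⟨ts, d⟩ <;> rfl

theorem latticeSum_eq_sum (as : List A) (rs : List (A × ℤ)) (ss : List (Option ℤ))
    (φ : List (Option ℤ) → A) :
    latticeSum posCross as rs ss φ = ∑ E : Fin rs.length → Fin as.length → Tile,
      (∏ i, ∏ j, (E i j).weight ((rs.get i).1 * as.get j)) *
        (gridRun (List.ofFn fun i => List.ofFn (E i)) (rs.map Prod.snd) ss).elim 0 φ := by
  induction rs generalizing ss with
  | nil => simp [latticeSum, gridRun]
  | cons r rs ih =>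
    change _ = ∑ E : Fin (rs.length + 1) → Fin as.length → Tile, _
    rw [← (Fin.consEquiv fun _ => Fin as.length → Tile).sum_comp, Fintype.sum_prod_type]
    simp only [latticeSum]
    rw [row_eq_sum]
    refine Finset.sum_congr rfl fun τ _ => ?_
    have hR : ∀ E : Fin rs.length → Fin as.length → Tile,
        gridRun (List.ofFn (n := rs.length + 1) fun i => List.ofFn
          ((Fin.cons τ E : Fin (rs.length + 1) → Fin as.length → Tile) i))
          ((r :: rs).map Prod.snd) ss =
        (rowRun (List.ofFn τ) none ss).bind fun r' => if r'.2 = some r.2 then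
          gridRun (List.ofFn fun i => List.ofFn (E i)) (rs.map Prod.snd) r'.1 else none := by
      intro E
      rw [List.ofFn_succ, List.map_cons, gridRun]
      rfl
    refine Eq.trans ?_ (Finset.sum_congr rfl fun E _ =>
        (congrArg₂ (· * ·) (Fin.prod_univ_succ _)
          (congrArg (fun o => Option.elim o 0 φ) (hR E))).symm)
    rcases rowRun (List.ofFn τ) none ss with _ | ⟨ts, d⟩
    · simp
    · simp only [Option.elim_some, Option.bind_some]
      split_ifs
      · rw [ih, Finset.mul_sum]
        refine Finset.sum_congr rfl fun E _ => ?_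
        simp only [← mul_assoc]
        congr 1
      · simp

theorem ofFn_eq_map_upInts {B : Type*} (p : ℤ) (m : ℕ) (f : ℤ → B) :
    (List.ofFn fun i : Fin m => f (p + i)) = (upInts p m).map f := by
  induction m generalizing p with
  | zero => rfl
  | succ m ih =>
    rw [List.ofFn_succ, upInts, List.map_cons, ← ih]
    simp only [Fin.val_zero, Fin.val_succ]
    push_cast
    simp only [add_zero, add_assoc, add_comm (1 : ℤ)]

theorem ofFn_eq_map_downInts {B : Type*} (q : ℤ) (m : ℕ) (f : ℤ → B) :
    (List.ofFn fun i : Fin m => f (q - i)) = (downInts q m).map f := by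
  induction m generalizing q with
  | zero => rfl
  | succ m ih =>
    rw [List.ofFn_succ, downInts, List.map_cons, ← ih]
    simp only [Fin.val_zero, Fin.val_succ]
    push_cast
    simp only [sub_zero, sub_sub, add_comm (1 : ℤ)]

/-- The rows of a filling, from bottom to top. -/
def Filling.rows {n : ℕ} (D : Filling n) : List (List Tile) :=
  (downInts n n).map fun i => (upInts (1 - n) (n + n)).map fun j => D.tile i j

/-- The cells of the rectangle, indexed by their distance to the bottom row and the first column. -/
def rectEquiv (n : ℕ) : Fin n × Fin (n + n) ≃ rect n where
  toFun c := ⟨(n - c.1, 1 - n + c.2), by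
    simp only [rect, Finset.mem_product, Finset.mem_Icc]
    omega⟩
  invFun c := ⟨⟨(n - c.1.1).toNat, by
      have := c.2
      simp only [rect, Finset.mem_product, Finset.mem_Icc] at this
      omega⟩, ⟨(c.1.2 - (1 - n)).toNat, by
      have := c.2
      simp only [rect, Finset.mem_product, Finset.mem_Icc] at this
      omega⟩⟩
  left_inv c := by
    rcases c with ⟨⟨i, hi⟩, ⟨j, hj⟩⟩
    ext <;> simp
  right_inv c := by
    have := c.2
    simp only [rect, Finset.mem_product, Finset.mem_Icc] at this
    ext
    · simp only [Int.toNat_of_nonneg (show (0 : ℤ) ≤ n - c.1.1 by omega)]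
      omega
    · simp only [Int.toNat_of_nonneg (show (0 : ℤ) ≤ c.1.2 - (1 - n) by omega)]
      omega

theorem latticeSum_eq_sum_filling (X α : ℤ → A) (n : ℕ) (w : ℤ → ℤ) (ss : List (Option ℤ))
    (φ : List (Option ℤ) → A) :
    latticeSum posCross ((upInts (1 - n) (n + n)).map α) ((downInts n n).map fun i => (X i, w i))
      ss φ = ∑ D : Filling n, (∏ c : rect n, (D c).weight (X c.1.1 * α c.1.2)) *
        (gridRun D.rows ((downInts n n).map w) ss).elim 0 φ := by
  -- The lists are kept general so that the casts between `Fin` types disappear on substituting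
  -- their lengths.
  have key : ∀ (as : List A) (rs : List (A × ℤ)) (has : as.length = n + n) (hrs : rs.length = n),
      latticeSum posCross as rs ss φ = ∑ E : Fin n → Fin (n + n) → Tile,
      (∏ i, ∏ j, (E i j).weight
        ((rs.get (Fin.cast hrs.symm i)).1 * as.get (Fin.cast has.symm j))) *
        (gridRun (List.ofFn fun i => List.ofFn (E i)) (rs.map Prod.snd) ss).elim 0 φ := by
    intro as rs has hrs
    rw [latticeSum_eq_sum]
    generalize n + n = k at has
    subst has
    subst hrs
    rfl
  rw [key _ _ (by simp) (by simp), List.map_map]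
  let e : Filling n ≃ (Fin n → Fin (n + n) → Tile) :=
    (Equiv.arrowCongr (rectEquiv n).symm (Equiv.refl Tile)).trans
      (Equiv.curry (Fin n) (Fin (n + n)) Tile)
  have he : ∀ (D : Filling n) i j, e D i j = D (rectEquiv n (i, j)) := fun D i j => rfl
  rw [← e.sum_comp]
  refine Finset.sum_congr rfl fun D _ => ?_
  have h1 : ∀ i : Fin n, ((List.map (fun i => (X i, w i)) (downInts n n)).get
      (Fin.cast (by simp) i)).1 = X (n - i) := by
    intro i
    have := congrArg (fun l => l[(i : ℕ)]?) (ofFn_eq_map_downInts (n : ℤ) n fun i => (X i, w i))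
    simp only [List.getElem?_ofFn, Fin.is_lt, dite_true] at this
    simp only [List.get_eq_getElem, Fin.val_cast]
    rw [(List.getElem_eq_iff _).2 this.symm]
  have h2 : ∀ j : Fin (n + n), ((List.map α (upInts (1 - n) (n + n))).get
      (Fin.cast (by simp) j)) = α (1 - n + j) := by
    intro i
    have := congrArg (fun l => l[(i : ℕ)]?) (ofFn_eq_map_upInts (1 - n : ℤ) (n + n) α)
    simp only [List.getElem?_ofFn, Fin.is_lt, dite_true] at this
    simp only [List.get_eq_getElem, Fin.val_cast]
    rw [(List.getElem_eq_iff _).2 this.symm]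
  simp only [h1, h2, he]
  congr 1
  · rw [← (rectEquiv n).prod_comp, Fintype.prod_prod_type]
    rfl
  · congr 1
    congr 1
    rw [Filling.rows, ← ofFn_eq_map_downInts]
    congr 1
    funext i
    rw [← ofFn_eq_map_upInts]
    congr 1
    funext j
    have hm : ((n : ℤ) - (i : ℕ), (1 - n : ℤ) + (j : ℕ)) ∈ rect n := (rectEquiv n (i, j)).2
    rw [he, Filling.tile, dif_pos hm]
    rfl

/-! ### Label functions -/

theorem rowRun_eq_some_iff (j : ℤ) (k : ℕ) (t : ℤ → Tile) (s : ℤ → Option ℤ) (c d : Option ℤ)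
    (ts : List (Option ℤ)) :
    rowRun ((upInts j k).map t) c ((upInts j k).map s) = some (ts, d) ↔
      ∃ hf nf : ℤ → Option ℤ, hf j = c ∧ hf (j + k) = d ∧ ts = (upInts j k).map nf ∧
        ∀ x, j ≤ x → x < j + k → tileRun (t x) (hf x) (s x) = some (hf (x + 1), nf x) := by
  induction k generalizing j c ts with
  | zero =>
    simp only [upInts, List.map_nil, rowRun, Option.some.injEq, Prod.mk.injEq, Nat.cast_zero,
      add_zero]
    constructor
    · rintro ⟨rfl, rfl⟩
      exact ⟨fun _ => c, fun _ => none, rfl, rfl, rfl, fun x h1 h2 => by omega⟩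
    · rintro ⟨hf, nf, rfl, rfl, rfl, -⟩
      exact ⟨rfl, rfl⟩
  | succ k ih =>
    simp only [upInts, List.map_cons, rowRun]
    have e : j + ((k + 1 : ℕ) : ℤ) = j + 1 + k := by push_cast; ring
    rw [e]
    constructor
    · intro h
      rcases htr : tileRun (t j) c (s j) with _ | ⟨m, n⟩
      · simp [htr] at h
      · simp only [htr, Option.bind_some, Option.map_eq_some_iff, Prod.mk.injEq,
          Prod.exists] at h
        obtain ⟨ts', d', h1, rfl, rfl⟩ := h
        obtain ⟨hf, nf, h2, h3, rfl, h4⟩ := (ih (j + 1) _ _).1 h1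
        refine ⟨fun x => if x ≤ j then c else hf x, fun x => if x ≤ j then n else nf x, ?_, ?_, ?_,
          ?_⟩
        · simp
        · simp only
          rw [if_neg (by omega), h3]
        · simp only
          rw [if_pos le_rfl]
          congr 1
          refine List.map_congr_left fun x hx => ?_
          rw [mem_upInts] at hx
          rw [if_neg (by omega)]
        · intro x hx hx'
          rcases hx.eq_or_lt with rfl | hx
          · simp [htr, h2]
          · simp only [if_neg (show ¬ x ≤ j by omega), if_neg (show ¬ x + 1 ≤ j by omega)]
            exact h4 x (by omega) hx'
    · rintro ⟨hf, nf, rfl, rfl, rfl, h⟩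
      rw [h j le_rfl (by omega)]
      simp only [Option.bind_some, Option.map_eq_some_iff, Prod.mk.injEq, Prod.exists]
      exact ⟨_, _, (ih (j + 1) _ _).2 ⟨hf, nf, rfl, rfl, rfl, fun x hx hx' => h x (by omega) hx'⟩,
        rfl, rfl⟩

/-- `V` and `H` record the labels of south and west sides; the north side of row `y` is therefore `V
(y - 1)`, and the east end is `H y (j + k)`. -/
theorem gridRun_eq_some_iff (i j : ℤ) (r k : ℕ) (t : ℤ → ℤ → Tile) (w : ℤ → ℤ)
    (s : ℤ → Option ℤ) (ts : List (Option ℤ)) :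
    gridRun ((downInts i r).map fun y => (upInts j k).map (t y)) ((downInts i r).map w)
      ((upInts j k).map s) = some ts ↔
      ∃ V H : ℤ → ℤ → Option ℤ, (∀ x, j ≤ x → x < j + k → V i x = s x) ∧
        (∀ y, i - r < y → y ≤ i → H y j = none ∧ H y (j + k) = some (w y)) ∧
        (∀ y, i - r < y → y ≤ i → ∀ x, j ≤ x → x < j + k →
          tileRun (t y x) (H y x) (V y x) = some (H y (x + 1), V (y - 1) x)) ∧
        ts = (upInts j k).map (V (i - r)) := by
  induction r generalizing i s ts with
  | zero =>
    simp only [downInts, List.map_nil, gridRun, Option.some.injEq, Nat.cast_zero, sub_zero]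
    constructor
    · rintro rfl
      exact ⟨fun _ => s, fun _ _ => none, fun _ _ _ => rfl, fun y _ _ => by omega,
        fun y _ _ => by omega, rfl⟩
    · rintro ⟨V, H, h1, -, -, rfl⟩
      refine List.map_congr_left fun x hx => ?_
      rw [mem_upInts] at hx
      exact (h1 x hx.1 hx.2).symm
  | succ r ih =>
    have e : i - ((r + 1 : ℕ) : ℤ) = i - 1 - r := by push_cast; ring
    simp only [downInts, List.map_cons, gridRun]
    rw [e]
    constructor
    · intro h
      rw [Option.bind_eq_some_iff] at h
      obtain ⟨⟨ts', d⟩, h1, h2⟩ := h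
      split_ifs at h2 with hd
      obtain ⟨hf, nf, h3, h4, rfl, h5⟩ := (rowRun_eq_some_iff ..).1 h1
      obtain ⟨V, H, h6, h7, h8, rfl⟩ := (ih (i - 1) _ _).1 h2
      refine ⟨fun y => if y = i then s else V y, fun y => if y = i then hf else H y, ?_, ?_, ?_, ?_⟩
      · intro x _ _
        simp
      · intro y hy hy'
        simp only
        by_cases hyi : y = i
        · subst hyi
          rw [if_pos rfl]
          exact ⟨h3, h4.trans hd⟩
        · rw [if_neg hyi]
          exact h7 y hy (by omega)
      · intro y hy hy' x hx hx'
        simp only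
        by_cases hyi : y = i
        · subst hyi
          rw [if_pos rfl, if_pos rfl, if_neg (by omega), h5 x hx hx', h6 x hx hx']
        · rw [if_neg hyi, if_neg hyi, if_neg (by omega)]
          exact h8 y hy (by omega) x hx hx'
      · simp only
        rw [if_neg (by omega)]
    · rintro ⟨V, H, h1, h2, h3, rfl⟩
      rw [Option.bind_eq_some_iff]
      refine ⟨((upInts j k).map (V (i - 1)), H i (j + k)), ?_, ?_⟩
      · refine (rowRun_eq_some_iff ..).2 ⟨H i, V (i - 1), (h2 i (by omega) le_rfl).1, rfl, rfl, ?_⟩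
        intro x hx hx'
        rw [← h1 x hx hx']
        exact h3 i (by omega) le_rfl x hx hx'
      · simp only
        rw [if_pos (h2 i (by omega) le_rfl).2]
        exact (ih (i - 1) _ _).2 ⟨V, H, fun _ _ _ => rfl, fun y hy hy' => h2 y hy (by omega),
          fun y hy hy' => h3 y hy (by omega), rfl⟩

end Lattice

/-! ### Pipes have crossed if and only if their labels are inverted -/

section Frontier

variable {n : ℕ} (D : Filling n) (V H : ℤ → ℤ → Option ℤ)

theorem Filling.mem_rect_of_tile_ne {D : Filling n} {i j : ℤ} (h : D.tile i j ≠ Tile.empty) :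
    (i, j) ∈ rect n := by
  by_contra hc
  exact h (dif_neg hc)

theorem mem_rect {i j : ℤ} : (i, j) ∈ rect n ↔ (1 ≤ i ∧ i ≤ n) ∧ 1 - (n : ℤ) ≤ j ∧ j ≤ n := by
  simp [rect]

/-- The two pipes that enter the tile `(i, j)` have already crossed. -/
def CrossedBefore (i j : ℤ) : Prop :=
  ∃ i' j', i ≤ i' ∧ j' ≤ j ∧ (i', j') ≠ (i, j) ∧ D.tile i' j' = Tile.cross ∧
    ((V i' j' = V i j ∧ H i' j' = H i j) ∨ (V i' j' = H i j ∧ H i' j' = V i j))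

/-- The labels `c`, `s`, `m`, `n` of the west, south, east and north side are compatible with the
tile `t`, where the labels are sorted at a crossing if `Q` holds for the labels that enter. -/
def LabelStep (Q : ℤ → ℤ → Prop) (t : Tile) (c s m n : Option ℤ) : Prop :=
  match t with
  | Tile.empty => c = none ∧ s = none ∧ m = none ∧ n = none
  | Tile.nw => ∃ h, c = some h ∧ s = none ∧ m = none ∧ n = some h
  | Tile.horiz => ∃ h, c = some h ∧ s = none ∧ m = some h ∧ n = none
  | Tile.vert => ∃ v, c = none ∧ s = some v ∧ m = none ∧ n = some v
  | Tile.se => ∃ v, c = none ∧ s = some v ∧ m = some v ∧ n = none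
  | Tile.cross => ∃ h v, c = some h ∧ s = some v ∧
      (Q h v → m = some (min h v) ∧ n = some (max h v))

/-- The pipe with label `a` passes through the edge number `k` of the path that separates the tiles
before `(i, j)` from the others, if the rows are processed from bottom to top and from left to
right. -/
inductive Frontier (n : ℕ) (i j : ℤ) : ℤ → ℤ → Prop
  | west (a : ℤ) (h : H i j = some a) : Frontier n i j (2 * j - 1) a
  | north (c a : ℤ) (h₁ : 1 - (n : ℤ) ≤ c) (h₂ : c < j) (h₃ : c ≤ n) (h : V (i - 1) c = some a) :
      Frontier n i j (2 * c) a
  | south (c a : ℤ) (h₁ : j ≤ c) (h₂ : 1 - (n : ℤ) ≤ c) (h₃ : c ≤ n) (h : V i c = some a) :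
      Frontier n i j (2 * c) a

/-- The tile `(i', j')` is a crossing that is processed before the tile `(i, j)`. -/
def EarlierCross (i j i' j' : ℤ) : Prop :=
  (i < i' ∨ i' = i ∧ j' < j) ∧ D.tile i' j' = Tile.cross

/-- The pipes with the labels `a` and `b` cross before the tile `(i, j)` is processed. -/
def HaveCrossed (i j a b : ℤ) : Prop :=
  ∃ i' j', EarlierCross D i j i' j' ∧
    ((V i' j' = some a ∧ H i' j' = some b) ∨ (V i' j' = some b ∧ H i' j' = some a))

/-- The invariant of the frontier. -/
structure FrontierInv (i j : ℤ) : Prop where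
  inj : ∀ k k' a, Frontier V H n i j k a → Frontier V H n i j k' a → k = k'
  pos : ∀ i' j' a k, EarlierCross D i j i' j' → (V i' j' = some a ∨ H i' j' = some a) →
    Frontier V H n i j k a → 2 * j' ≤ k
  inv : ∀ k k' a b, Frontier V H n i j k a → Frontier V H n i j k' b → k < k' →
    (b < a ↔ HaveCrossed D V H i j a b)

variable {D V H}

/-- The west and south edges of the tile are consecutive on the frontier, so `inv` decides whether
their pipes crossed at some tile processed earlier. Pipes never move west, hence `pos` places that
tile weakly to the left, as `CrossedBefore` demands. -/
theorem FrontierInv.crossedBefore_iff {i j : ℤ} (hI : FrontierInv D V H i j)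
    (hij : (i, j) ∈ rect n) {h v : ℤ} (hh : H i j = some h) (hv : V i j = some v) :
    CrossedBefore D V H i j ↔ v < h := by
  have hij' := mem_rect.1 hij
  have fh : Frontier V H n i j (2 * j - 1) h := .west h hh
  have fv : Frontier V H n i j (2 * j) v := .south j v le_rfl hij'.2.1 hij'.2.2 hv
  rw [hI.inv _ _ _ _ fh fv (by omega)]
  constructor
  · rintro ⟨i', j', h1, h2, h3, h4, h5⟩
    refine ⟨i', j', ⟨?_, h4⟩, ?_⟩
    · rcases h1.eq_or_lt with rfl | h1
      · right
        refine ⟨rfl, lt_of_le_of_ne h2 ?_⟩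
        rintro rfl
        exact h3 rfl
      · exact Or.inl h1
    · rw [hh, hv] at h5
      tauto
  · rintro ⟨i', j', hE, h5⟩
    have h6 : 2 * j' ≤ 2 * j := hI.pos i' j' v _ hE (by tauto) fv
    refine ⟨i', j', ?_, by omega, ?_, hE.2, ?_⟩
    · have := hE.1
      omega
    · intro he
      simp only [Prod.mk.injEq] at he
      have := hE.1
      omega
    · rw [hh, hv]
      tauto

theorem Frontier.step {i j : ℤ} (hij : (i, j) ∈ rect n) {k a : ℤ}
    (h : Frontier V H n i (j + 1) k a) :
    (Frontier V H n i j k a ∧ (k < 2 * j - 1 ∨ 2 * j + 1 < k)) ∨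
      (k = 2 * j + 1 ∧ H i (j + 1) = some a) ∨ (k = 2 * j ∧ V (i - 1) j = some a) := by
  cases h with
  | west _ h => exact Or.inr (Or.inl ⟨by ring, h⟩)
  | north c _ h1 h2 h3 h =>
    rcases (Int.lt_add_one_iff.1 h2).eq_or_lt with rfl | h2
    · exact Or.inr (Or.inr ⟨rfl, h⟩)
    · exact Or.inl ⟨.north c a h1 h2 h3 h, by omega⟩
  | south c _ h1 h2 h3 h =>
    exact Or.inl ⟨.south c a (by omega) h2 h3 h, by omega⟩

/-- Processing one tile replaces its west and south edges (numbers 2j - 1 and 2j) by its north and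
east edges (2j and 2j + 1). The relative order of two pipes on the frontier can change only if both
pass through this tile. -/
theorem FrontierInv.step {i j : ℤ} (hI : FrontierInv D V H i j) (hij : (i, j) ∈ rect n)
    (hs : LabelStep (fun h v => CrossedBefore D V H i j ↔ v < h) (D.tile i j) (H i j) (V i j)
      (H i (j + 1)) (V (i - 1) j)) : FrontierInv D V H i (j + 1) := by
  have hij' := mem_rect.1 hij
  have fh : ∀ a, H i j = some a → Frontier V H n i j (2 * j - 1) a := fun a h => .west a h
  have fv : ∀ a, V i j = some a → Frontier V H n i j (2 * j) a := fun a h =>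
    .south j a le_rfl hij'.2.1 hij'.2.2 h
  -- Labels that leave the tile have entered it. Two labels leave together only at a crossing, the
  -- larger one to the north, hence earlier on the frontier.
  obtain ⟨T1, T2⟩ : (∀ a, H i (j + 1) = some a ∨ V (i - 1) j = some a →
        H i j = some a ∨ V i j = some a) ∧
      (∀ a b, V (i - 1) j = some a → H i (j + 1) = some b → D.tile i j = Tile.cross ∧ b < a ∧
        ((V i j = some a ∧ H i j = some b) ∨ (V i j = some b ∧ H i j = some a))) := by
    rcases ht : D.tile i j with _ | _ | _ | _ | _ | _ <;> rw [ht] at hs <;>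
      simp only [LabelStep] at hs
    · obtain ⟨h1, h2, h3, h4⟩ := hs
      simp [h1, h2, h3, h4]
    · obtain ⟨h, h1, h2, h3, h4⟩ := hs
      simp [h1, h2, h3, h4]
    · obtain ⟨h, h1, h2, h3, h4⟩ := hs
      simp [h1, h2, h3, h4]
    · obtain ⟨h, h1, h2, h3, h4⟩ := hs
      simp [h1, h2, h3, h4]
    · obtain ⟨h, v, h1, h2, h3⟩ := hs
      obtain ⟨h3, h4⟩ := h3 (hI.crossedBefore_iff hij h1 h2)
      have hne : h ≠ v := by
        rintro rfl
        have := hI.inj _ _ _ (fh _ h1) (fv _ h2)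
        omega
      rw [h1, h2, h3, h4]
      simp only [Option.some.injEq, true_and]
      constructor
      · omega
      · omega
    · obtain ⟨h, h1, h2, h3, h4⟩ := hs
      simp [h1, h2, h3, h4]
  have old : ∀ k a, Frontier V H n i (j + 1) k a → ∃ k₀, Frontier V H n i j k₀ a ∧
      ((k₀ = k ∧ (k < 2 * j - 1 ∨ 2 * j + 1 < k)) ∨
        ((k₀ = 2 * j - 1 ∨ k₀ = 2 * j) ∧ (k = 2 * j ∨ k = 2 * j + 1))) := by
    intro k a h
    rcases h.step hij with ⟨h, hk⟩ | ⟨hk, h⟩ | ⟨hk, h⟩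
    · exact ⟨k, h, Or.inl ⟨rfl, hk⟩⟩
    · rcases T1 a (Or.inl h) with h | h
      · exact ⟨_, fh _ h, by omega⟩
      · exact ⟨_, fv _ h, by omega⟩
    · rcases T1 a (Or.inr h) with h | h
      · exact ⟨_, fh _ h, by omega⟩
      · exact ⟨_, fv _ h, by omega⟩
  have both : ∀ k k' a b, Frontier V H n i (j + 1) k a → Frontier V H n i (j + 1) k' b →
      k = 2 * j → k' = 2 * j + 1 → V (i - 1) j = some a ∧ H i (j + 1) = some b := by
    intro k k' a b h h' hk hk'
    constructor
    · rcases h.step hij with ⟨-, hc⟩ | ⟨hc, -⟩ | ⟨-, h⟩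
      · omega
      · omega
      · exact h
    · rcases h'.step hij with ⟨-, hc⟩ | ⟨-, h⟩ | ⟨hc, -⟩
      · omega
      · exact h
      · omega
  refine ⟨?_, ?_, ?_⟩
  · intro k k' a h h'
    obtain ⟨k₀, hk₀, hk⟩ := old k a h
    obtain ⟨k₀', hk₀', hk'⟩ := old k' a h'
    have he := hI.inj _ _ _ hk₀ hk₀'
    by_contra hne
    rcases (show (k = 2 * j ∧ k' = 2 * j + 1) ∨ (k' = 2 * j ∧ k = 2 * j + 1) by omega)
      with ⟨e1, e2⟩ | ⟨e1, e2⟩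
    · obtain ⟨b1, b2⟩ := both k k' a a h h' e1 e2
      exact (T2 a a b1 b2).2.1.false
    · obtain ⟨b1, b2⟩ := both k' k a a h' h e1 e2
      exact (T2 a a b1 b2).2.1.false
  · rintro i' j' a k ⟨hE, ht⟩ ha h
    obtain ⟨k₀, hk₀, hk⟩ := old k a h
    rcases (show (i < i' ∨ i' = i ∧ j' < j) ∨ (i' = i ∧ j' = j) by omega) with hE | ⟨rfl, rfl⟩
    · have := hI.pos i' j' a k₀ ⟨hE, ht⟩ ha hk₀
      omega
    · rcases ha with ha | ha
      · have := hI.inj _ _ _ hk₀ (fv _ ha)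
        omega
      · have := hI.inj _ _ _ hk₀ (fh _ ha)
        omega
  · intro k k' a b h h' hkk
    obtain ⟨k₀, hk₀, hk⟩ := old k a h
    obtain ⟨k₀', hk₀', hk'⟩ := old k' b h'
    by_cases hb : k = 2 * j ∧ k' = 2 * j + 1
    · obtain ⟨b1, b2⟩ := both k k' a b h h' hb.1 hb.2
      obtain ⟨t1, t2, t3⟩ := T2 a b b1 b2
      exact iff_of_true t2 ⟨i, j, ⟨Or.inr ⟨rfl, by omega⟩, t1⟩, t3⟩
    · rw [hI.inv _ _ _ _ hk₀ hk₀' (by omega)]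
      constructor
      · rintro ⟨i', j', ⟨hE, ht⟩, hl⟩
        exact ⟨i', j', ⟨by omega, ht⟩, hl⟩
      · rintro ⟨i', j', ⟨hE, ht⟩, hl⟩
        rcases (show (i < i' ∨ i' = i ∧ j' < j) ∨ (i' = i ∧ j' = j) by omega) with hE | ⟨rfl, rfl⟩
        · exact ⟨i', j', ⟨hE, ht⟩, hl⟩
        · exfalso
          rcases hl with ⟨ha, hb⟩ | ⟨hb, ha⟩
          · have e1 := hI.inj _ _ _ hk₀ (fv _ ha)
            have e2 := hI.inj _ _ _ hk₀' (fh _ hb)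
            omega
          · have e1 := hI.inj _ _ _ hk₀ (fh _ ha)
            have e2 := hI.inj _ _ _ hk₀' (fv _ hb)
            omega

/-- Between rows the frontier only loses the east end of the finished row, since the next row has no
pipe at its west end. -/
theorem FrontierInv.next_row {i : ℤ} (hI : FrontierInv D V H i (n + 1))
    (hw : H (i - 1) (1 - n) = none) : FrontierInv D V H (i - 1) (1 - n) := by
  have hF : ∀ k a, Frontier V H n (i - 1) (1 - n) k a → Frontier V H n i (n + 1) k a := by
    intro k a h
    cases h with
    | west _ h => rw [hw] at h; cases h
    | north c _ h1 h2 => omega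
    | south c _ h1 h2 h3 h => exact .north c a h2 (by omega) h3 h
  have hE : ∀ i' j', EarlierCross D (i - 1) (1 - n) i' j' ↔ EarlierCross D i (n + 1) i' j' := by
    intro i' j'
    refine and_congr_left fun ht => ?_
    have := mem_rect.1 (Filling.mem_rect_of_tile_ne (D := D) (i := i') (j := j') (by simp [ht]))
    omega
  refine ⟨fun k k' a h h' => hI.inj k k' a (hF _ _ h) (hF _ _ h'),
    fun i' j' a k h ha h' => hI.pos i' j' a k ((hE _ _).1 h) ha (hF _ _ h'), ?_⟩
  intro k k' a b h h' hk
  rw [hI.inv _ _ _ _ (hF _ _ h) (hF _ _ h') hk]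
  simp only [HaveCrossed, hE]

/-- Initially the labels increase along the south boundary and nothing has crossed. The hypothesis
on crossings is conditional on the equivalence that the invariant itself supplies, so both are
established in one induction. -/
theorem frontierInv (hstart : ∀ j, ((n : ℤ), j) ∈ rect n → V n j = some j)
    (hwest : ∀ i : ℤ, 1 ≤ i → i ≤ n → H i (1 - n) = none)
    (hstep : ∀ i j, (i, j) ∈ rect n → LabelStep (fun h v => CrossedBefore D V H i j ↔ v < h)
      (D.tile i j) (H i j) (V i j) (H i (j + 1)) (V (i - 1) j))
    {i j : ℤ} (hij : (i, j) ∈ rect n) : FrontierInv D V H i j := by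
  have hcol : ∀ i : ℤ, 1 ≤ i → i ≤ n → FrontierInv D V H i (1 - n) → ∀ k : ℕ, k ≤ n + n →
      FrontierInv D V H i (1 - n + k) := by
    intro i h1 h2 hI k
    induction k with
    | zero => intro; simpa using hI
    | succ k ih =>
      intro hk
      have hm : (i, (1 - n + k : ℤ)) ∈ rect n := mem_rect.2 (by omega)
      have := (ih (by omega)).step hm (hstep _ _ hm)
      push_cast
      rwa [← add_assoc]
  have hrow : ∀ r : ℕ, r < n → FrontierInv D V H (n - r) (1 - n) := by
    intro r
    induction r with
    | zero =>
      intro hr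
      rw [Nat.cast_zero, sub_zero]
      have hF : ∀ k a, Frontier V H n n (1 - n) k a → k = 2 * a := by
        intro k a h
        cases h with
        | west _ h => rw [hwest n (by omega) le_rfl] at h; cases h
        | north c _ h1 h2 => omega
        | south c _ h1 h2 h3 h =>
          rw [hstart c (mem_rect.2 (by omega))] at h
          rw [Option.some_injective _ h]
      have hE : ∀ i' j', ¬ EarlierCross D (n : ℤ) (1 - n) i' j' := by
        rintro i' j' ⟨h, ht⟩
        have := mem_rect.1 (Filling.mem_rect_of_tile_ne (D := D) (i := i') (j := j') (by simp [ht]))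
        omega
      refine ⟨fun k k' a h h' => (hF _ _ h).trans (hF _ _ h').symm,
        fun i' j' a k h => (hE _ _ h).elim, ?_⟩
      intro k k' a b h h' hk
      refine iff_of_false ?_ ?_
      · rw [hF _ _ h, hF _ _ h'] at hk
        omega
      · rintro ⟨i', j', h, -⟩
        exact hE _ _ h
    | succ r ih =>
      intro hr
      have h1 := hcol (n - r) (by omega) (by omega) (ih (by omega)) (n + n) le_rfl
      rw [show (1 - n + ((n + n : ℕ) : ℤ) : ℤ) = n + 1 by push_cast; ring] at h1
      have := h1.next_row (hwest (n - r - 1) (by omega) (by omega))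
      push_cast
      rwa [← sub_sub]
  have hij' := mem_rect.1 hij
  have h1 := hrow (n - i).toNat (by omega)
  rw [show (n - ((n - i).toNat : ℤ) : ℤ) = i by omega] at h1
  have h2 := hcol i hij'.1.1 hij'.1.2 h1 (j - (1 - n)).toNat (by omega)
  rwa [show (1 - n + ((j - (1 - n)).toNat : ℤ) : ℤ) = j by omega] at h2

end Frontier

/-! ### Rectangular bumpless pipedreams and label functions -/

section Labelling

variable {n : ℕ}

theorem tileRun_eq_some_iff {t : Tile} {c s m n : Option ℤ} :
    tileRun t c s = some (m, n) ↔ LabelStep (fun _ _ => True) t c s m n ∧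
      (t = Tile.cross → ∀ h v, c = some h → s = some v → posCross h v) := by
  rcases t with _ | _ | _ | _ | _ | _ <;> rcases c with _ | c <;> rcases s with _ | s <;>
    simp [tileRun, LabelStep, eq_comm, and_comm]

theorem tileRun_sides {t : Tile} {c s m n : Option ℤ} (h : tileRun t c s = some (m, n)) :
    (t.west ↔ c.isSome) ∧ (t.south ↔ s.isSome) ∧ (t.east ↔ m.isSome) ∧ (t.north ↔ n.isSome) := by
  obtain ⟨h, -⟩ := tileRun_eq_some_iff.1 h
  rcases t with _ | _ | _ | _ | _ | _ <;> simp only [LabelStep] at h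
  · obtain ⟨rfl, rfl, rfl, rfl⟩ := h
    simp [Tile.west, Tile.south, Tile.east, Tile.north]
  · obtain ⟨x, rfl, rfl, rfl, rfl⟩ := h
    simp [Tile.west, Tile.south, Tile.east, Tile.north]
  · obtain ⟨x, rfl, rfl, rfl, rfl⟩ := h
    simp [Tile.west, Tile.south, Tile.east, Tile.north]
  · obtain ⟨x, rfl, rfl, rfl, rfl⟩ := h
    simp [Tile.west, Tile.south, Tile.east, Tile.north]
  · obtain ⟨x, y, rfl, rfl, hq⟩ := h
    obtain ⟨rfl, rfl⟩ := hq trivial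
    simp [Tile.west, Tile.south, Tile.east, Tile.north]
  · obtain ⟨x, rfl, rfl, rfl, rfl⟩ := h
    simp [Tile.west, Tile.south, Tile.east, Tile.north]

/-- The labels `V i j` of the south sides and `H i j` of the west sides of the tiles of `D`, where
pipes are sorted at each crossing. -/
structure IsLocalLabelling (w : ℤ → ℤ) (D : Filling n) (V H : ℤ → ℤ → Option ℤ) : Prop where
  start : ∀ j, ((n : ℤ), j) ∈ rect n → V n j = some j
  west : ∀ i : ℤ, 1 ≤ i → i ≤ n → H i (1 - n) = none
  east : ∀ i : ℤ, 1 ≤ i → i ≤ n → H i (n + 1) = some (w i)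
  step : ∀ i j, (i, j) ∈ rect n →
    tileRun (D.tile i j) (H i j) (V i j) = some (H i (j + 1), V (i - 1) j)

theorem TileRel.of_tileRun {t : Tile} {c s m n : Option ℤ} (h : tileRun t c s = some (m, n)) :
    TileRel posCross c s m n := by
  obtain ⟨h, hp⟩ := tileRun_eq_some_iff.1 h
  rcases t with _ | _ | _ | _ | _ | _ <;> simp only [LabelStep] at h
  · obtain ⟨rfl, rfl, rfl, rfl⟩ := h
    exact .empty
  · obtain ⟨x, rfl, rfl, rfl, rfl⟩ := h
    exact .nw x
  · obtain ⟨x, rfl, rfl, rfl, rfl⟩ := h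
    exact .se x
  · obtain ⟨x, rfl, rfl, rfl, rfl⟩ := h
    exact .horiz x
  · obtain ⟨x, y, rfl, rfl, hq⟩ := h
    obtain ⟨rfl, rfl⟩ := hq trivial
    exact .cross x y (hp rfl x y rfl rfl)
  · obtain ⟨x, rfl, rfl, rfl, rfl⟩ := h
    exact .vert x

theorem RowRel.of_tileRun {t : ℤ → Tile} {hf s nf : ℤ → Option ℤ} {j : ℤ} {k : ℕ}
    (h : ∀ x, j ≤ x → x < j + k → tileRun (t x) (hf x) (s x) = some (hf (x + 1), nf x)) :
    RowRel posCross (hf j) ((upInts j k).map s) ((upInts j k).map nf) (hf (j + k)) := by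
  induction k generalizing j with
  | zero => simpa [upInts] using RowRel.nil (hf j)
  | succ k ih =>
    have e : j + ((k + 1 : ℕ) : ℤ) = j + 1 + k := by push_cast; ring
    rw [e] at h ⊢
    exact .cons (.of_tileRun (h j le_rfl (by omega))) (ih fun x hx hx' => h x (by omega) hx')

/-- Nonpositive labels never meet a crossing, so their order along the frontier does not change. -/
theorem RowRel.filter_nonpos {c d : Option ℤ} {ss ts : List (Option ℤ)}
    (h : RowRel posCross c ss ts d) :
    (c :: ss).reduceOption.filter (· ≤ 0) = (ts ++ [d]).reduceOption.filter (· ≤ 0) := by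
  induction h with
  | nil c => simp
  | @cons c s m n d ss ts h hr ih =>
    have e1 : (c :: s :: ss).reduceOption = [c, s].reduceOption ++ ss.reduceOption := by
      rw [← List.reduceOption_append]; rfl
    have e2 : (n :: m :: ss).reduceOption = [n, m].reduceOption ++ ss.reduceOption := by
      rw [← List.reduceOption_append]; rfl
    have e3 : [c, s].reduceOption.filter (· ≤ 0) = [n, m].reduceOption.filter (· ≤ 0) := by
      cases h with
      | cross h v hP =>
        have h1 : ¬ h ≤ 0 := by have := hP.1; omega
        have h2 : ¬ v ≤ 0 := by have := hP.2; omega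
        have h3 : ¬ min h v ≤ 0 := by omega
        have h4 : ¬ max h v ≤ 0 := by omega
        simp only [List.reduceOption_cons_of_some]
        simp [h1, h2, h3, h4]
      | _ => rfl
    rw [e1, List.filter_append, e3, ← List.filter_append, ← e2, List.cons_append,
      reduceOption_cons n, List.filter_append, ih, reduceOption_cons n, List.filter_append]

/-- Each row removes the label `w i`. After all `n` rows the labels of S_n are gone, and the
nonpositive ones remain in their original order. -/
theorem IsLocalLabelling.top_labels {w : Equiv.Perm ℤ} (hw : SuppIn 1 n w) {D : Filling n}
    {V H : ℤ → ℤ → Option ℤ} (hL : IsLocalLabelling w D V H) :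
    ((upInts (1 - n) (n + n)).map (V 0)).reduceOption = upInts (1 - n) n := by
  have hsome : ∀ l : List ℤ, (l.map some).reduceOption = l := by
    intro l
    induction l <;> simp_all
  have key : ∀ r : ℕ, r ≤ n →
      ((upInts (1 - n) (n + n)).map (V (n - r))).reduceOption.Nodup ∧
      ((upInts (1 - n) (n + n)).map (V (n - r))).reduceOption.filter (· ≤ 0) = upInts (1 - n) n ∧
      ∀ x ∈ ((upInts (1 - n) (n + n)).map (V (n - r))).reduceOption, w.symm x ≤ n - r := by
    intro r
    induction r with
    | zero =>
      intro _
      have h0 : (upInts (1 - n) (n + n)).map (V n) = (upInts (1 - n) (n + n)).map some := by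
        refine List.map_congr_left fun j hj => ?_
        rw [mem_upInts] at hj
        push_cast at hj
        exact hL.start j (mem_rect.2 (by omega))
      rw [Nat.cast_zero, sub_zero, h0, hsome]
      refine ⟨(pairwise_lt_upInts _ _).imp ne_of_lt, ?_, ?_⟩
      · rw [upInts_add, List.filter_append, List.filter_eq_self.2, List.filter_eq_nil_iff.2,
          List.append_nil]
        · intro x hx
          rw [mem_upInts] at hx
          simp only [decide_eq_true_eq]
          omega
        · intro x hx
          rw [mem_upInts] at hx
          simp only [decide_eq_true_eq]
          omega
      · intro x hx
        rw [mem_upInts] at hx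
        push_cast at hx
        by_contra hc
        have := hw (w.symm x) (by simp; omega)
        rw [Equiv.apply_symm_apply] at this
        omega
    | succ r ih =>
      intro hr
      obtain ⟨i1, i2, i3⟩ := ih (by omega)
      have hrow := RowRel.of_tileRun (t := D.tile (n - r)) (hf := H (n - r)) (s := V (n - r))
        (nf := V (n - r - 1)) (j := 1 - n) (k := n + n) fun x hx hx' =>
          hL.step _ _ (mem_rect.2 (by push_cast at hx'; omega))
      have he : (1 - n + ((n + n : ℕ) : ℤ) : ℤ) = n + 1 := by push_cast; ring
      rw [he, hL.west _ (by omega) (by omega), hL.east _ (by omega) (by omega), sub_sub] at hrow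
      have e : ((r + 1 : ℕ) : ℤ) = r + 1 := by push_cast; ring
      have hperm := hrow.perm
      have hfil := hrow.filter_nonpos
      have hpos := hw.mem (i := n - r) ⟨by omega, by omega⟩
      rw [Set.mem_Icc] at hpos
      rw [List.reduceOption_append] at hperm hfil
      simp only [List.reduceOption_cons_of_none, List.reduceOption_cons_of_some,
        List.reduceOption_nil] at hperm hfil
      rw [List.filter_append, i2, List.filter_cons_of_neg (by simp; omega), List.filter_nil,
        List.append_nil] at hfil
      have hnd := hperm.nodup_iff.1 i1
      rw [e]
      refine ⟨hnd.of_append_left, hfil.symm, fun x hx => ?_⟩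
      have h1 := i3 x (hperm.mem_iff.2 (List.mem_append_left _ hx))
      have h2 : w.symm x ≠ n - r := by
        intro h
        have h3 : x = w (n - r) := by rw [← h, Equiv.apply_symm_apply]
        rw [List.nodup_append] at hnd
        exact hnd.2.2 x hx _ (by simp) h3
      omega
  obtain ⟨-, k2, k3⟩ := key n le_rfl
  rw [sub_self] at k2 k3
  rw [← k2, eq_comm, List.filter_eq_self]
  intro x hx
  have h1 := k3 x hx
  have h2 := hw (w.symm x) (by simp; omega)
  rw [Equiv.apply_symm_apply] at h2
  simp only [decide_eq_true_eq]
  omega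

/-- In a labelling a crossing is transmitted or ignored according to the history of its two pipes.
This agrees with sorting their labels provided that having crossed means being inverted, which
`frontierInv` proves; hence the conditional form of `LabelStep`. -/
theorem exists_isLocalLabelling {w : Equiv.Perm ℤ} {D : Filling n} (hD : IsRectBPD w D) :
    ∃ V H, IsLocalLabelling w D V H := by
  classical
  obtain ⟨hB, v, h, hL, he, -, hp⟩ := hD
  set T := D.tile with hT
  -- Row 0 lies outside the rectangle, so the top edge is read from the north side of row 1.
  set V : ℤ → ℤ → Option ℤ := fun i j =>
    if (if i = 0 then (T 1 j).north else (T i j).south) then some (v i j) else none with hVdef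
  -- Reading the east side of the left neighbour makes `H i (n + 1)` meaningful; outside the
  -- rectangle the tile is empty and gives `none`.
  set H : ℤ → ℤ → Option ℤ := fun i j => if (T i (j - 1)).east then some (h i j) else none
    with hHdef
  have hV : ∀ i j, (i, j) ∈ rect n → V i j = if (T i j).south then some (v i j) else none := by
    intro i j hij
    have := mem_rect.1 hij
    simp only [hVdef, if_neg (show i ≠ 0 by omega)]
  have hV' : ∀ i j, (i, j) ∈ rect n →
      V (i - 1) j = if (T i j).north then some (v (i - 1) j) else none := by
    intro i j hij
    have hm := mem_rect.1 hij
    rcases eq_or_ne i 1 with rfl | hi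
    · simp [hVdef]
    · have hm' : (i - 1, j) ∈ rect n := mem_rect.2 (by omega)
      have := hB.fit_vert (i - 1) j hm' (by simpa using hij)
      rw [sub_add_cancel] at this
      rw [hV _ _ hm']
      simp only [hT, this]
  have hH : ∀ i j, (i, j) ∈ rect n → H i j = if (T i j).west then some (h i j) else none := by
    intro i j hij
    have hm := mem_rect.1 hij
    rcases eq_or_ne j (1 - n) with rfl | hj
    · have h1 : T i (1 - n - 1) = Tile.empty := dif_neg fun hc => by
        have := mem_rect.1 hc
        omega
      have h2 := hB.west_bdry i hij
      rw [← hT] at h2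
      simp only [hHdef, h1]
      simp [Tile.east, h2]
    · have hm' : (i, j - 1) ∈ rect n := mem_rect.2 (by omega)
      have := hB.fit_horiz i (j - 1) hm' (by simpa using hij)
      rw [sub_add_cancel] at this
      simp only [hHdef, hT, this]
  have hH' : ∀ i j, H i (j + 1) = if (T i j).east then some (h i (j + 1)) else none := by
    intro i j
    simp only [hHdef, add_sub_cancel_right]
  have hcr : ∀ i j, T i j = Tile.cross → V i j = some (v i j) ∧ H i j = some (h i j) := by
    intro i j ht
    have hij := Filling.mem_rect_of_tile_ne (D := D) (i := i) (j := j) (by rw [← hT, ht]; simp)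
    rw [hV i j hij, hH i j hij, ht]
    simp [Tile.south, Tile.west]
  have hcb : ∀ i j, T i j = Tile.cross → (CrossedBefore D V H i j ↔ AlreadyCrossed D v h i j) := by
    intro i j ht
    obtain ⟨h1, h2⟩ := hcr i j ht
    refine exists_congr fun i' => exists_congr fun j' => ?_
    refine and_congr_right fun _ => and_congr_right fun _ => and_congr_right fun _ =>
      and_congr_right fun ht' => ?_
    obtain ⟨h1', h2'⟩ := hcr i' j' ht'
    rw [h1, h2, h1', h2']
    simp
  have hstep : ∀ i j, (i, j) ∈ rect n → LabelStep (fun h v => CrossedBefore D V H i j ↔ v < h)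
      (D.tile i j) (H i j) (V i j) (H i (j + 1)) (V (i - 1) j) := by
    intro i j hij
    rw [hH i j hij, hV i j hij, hH' i j, hV' i j hij, ← hT]
    rcases ht : T i j with _ | _ | _ | _ | _ | _
    · simp [LabelStep, Tile.west, Tile.south, Tile.east, Tile.north]
    · simp [LabelStep, Tile.west, Tile.south, Tile.east, Tile.north, hL.nw i j ht]
    · simp [LabelStep, Tile.west, Tile.south, Tile.east, Tile.north, hL.se i j ht]
    · simp [LabelStep, Tile.west, Tile.south, Tile.east, Tile.north, hL.horiz i j ht]
    · simp only [LabelStep, Tile.west, Tile.south, Tile.east, Tile.north, if_true, or_true, true_or]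
      refine ⟨_, _, rfl, rfl, fun hQ => ?_⟩
      rw [hcb i j ht] at hQ
      by_cases ha : AlreadyCrossed D v h i j
      · obtain ⟨e1, e2⟩ := hL.cross_again i j ht ha
        have := hQ.1 ha
        rw [e1, e2, min_eq_right this.le, max_eq_left this.le]
        exact ⟨rfl, rfl⟩
      · obtain ⟨e1, e2⟩ := hL.cross i j ht ha
        have := not_lt.1 (mt hQ.2 ha)
        rw [e1, e2, min_eq_left this, max_eq_right this]
        exact ⟨rfl, rfl⟩
    · simp [LabelStep, Tile.west, Tile.south, Tile.east, Tile.north, hL.vert i j ht]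
  have hstart : ∀ j, ((n : ℤ), j) ∈ rect n → V n j = some j := by
    intro j hj
    rw [hV _ _ hj, if_pos (hB.south_bdry j hj), hL.start j hj]
  have hwest : ∀ i : ℤ, 1 ≤ i → i ≤ n → H i (1 - n) = none := by
    intro i h1 h2
    have hm : (i, (1 - n : ℤ)) ∈ rect n := mem_rect.2 (by omega)
    rw [hH _ _ hm, if_neg (hB.west_bdry i hm)]
  refine ⟨V, H, hstart, hwest, ?_, ?_⟩
  · intro i h1 h2
    have hm : (i, (n : ℤ)) ∈ rect n := mem_rect.2 (by omega)
    rw [hH', if_pos (hB.east_bdry i hm), he i hm]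
  · intro i j hij
    have hI := frontierInv hstart hwest hstep hij
    have hs := hstep i j hij
    refine tileRun_eq_some_iff.2 ⟨?_, fun ht a b ha hb => ?_⟩
    · rcases ht : D.tile i j with _ | _ | _ | _ | _ | _ <;> rw [ht] at hs <;> try exact hs
      obtain ⟨a, b, ha, hb, hq⟩ := hs
      exact ⟨a, b, ha, hb, fun _ => hq (hI.crossedBefore_iff hij ha hb)⟩
    · obtain ⟨h1, h2⟩ := hcr i j ht
      rw [h1] at hb
      rw [h2] at ha
      obtain rfl := Option.some_injective _ ha
      obtain rfl := Option.some_injective _ hb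
      exact (hp i j ht).symm

theorem IsLocalLabelling.isRectBPD {w : Equiv.Perm ℤ} (hw : SuppIn 1 n w) {D : Filling n}
    {V H : ℤ → ℤ → Option ℤ} (hL : IsLocalLabelling w D V H) : IsRectBPD w D := by
  have hstep : ∀ i j, (i, j) ∈ rect n → LabelStep (fun h v => CrossedBefore D V H i j ↔ v < h)
      (D.tile i j) (H i j) (V i j) (H i (j + 1)) (V (i - 1) j) := by
    intro i j hij
    have hs := (tileRun_eq_some_iff.1 (hL.step i j hij)).1
    rcases ht : D.tile i j with _ | _ | _ | _ | _ | _ <;> rw [ht] at hs <;> try exact hs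
    obtain ⟨a, b, ha, hb, hq⟩ := hs
    exact ⟨a, b, ha, hb, fun _ => hq trivial⟩
  have hsides := fun i j hij => tileRun_sides (hL.step i j hij)
  have hmem : ∀ i j, D.tile i j ≠ Tile.empty → (i, j) ∈ rect n := fun i j h =>
    Filling.mem_rect_of_tile_ne h
  have hls : ∀ i j, (i, j) ∈ rect n → LabelStep (fun _ _ => True) (D.tile i j) (H i j) (V i j)
      (H i (j + 1)) (V (i - 1) j) := fun i j hij => (tileRun_eq_some_iff.1 (hL.step i j hij)).1
  have hcr : ∀ i j, D.tile i j = Tile.cross → ∃ a b, H i j = some a ∧ V i j = some b ∧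
      H i (j + 1) = some (min a b) ∧ V (i - 1) j = some (max a b) ∧ posCross a b ∧
        (CrossedBefore D V H i j ↔ b < a) := by
    intro i j ht
    have hij := hmem i j (by simp [ht])
    obtain ⟨h1, h2⟩ := tileRun_eq_some_iff.1 (hL.step i j hij)
    rw [ht] at h1
    obtain ⟨a, b, ha, hb, hq⟩ := h1
    exact ⟨a, b, ha, hb, (hq trivial).1, (hq trivial).2, h2 ht a b ha hb,
      (frontierInv hL.start hL.west hstep hij).crossedBefore_iff hij ha hb⟩
  have hcb : ∀ i j, D.tile i j = Tile.cross → (CrossedBefore D V H i j ↔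
      AlreadyCrossed D (fun i j => (V i j).getD 0) (fun i j => (H i j).getD 0) i j) := by
    intro i j ht
    obtain ⟨a, b, ha, hb, -⟩ := hcr i j ht
    refine exists_congr fun i' => exists_congr fun j' => ?_
    refine and_congr_right fun _ => and_congr_right fun _ => and_congr_right fun _ =>
      and_congr_right fun ht' => ?_
    obtain ⟨a', b', ha', hb', -⟩ := hcr i' j' ht'
    simp [ha, hb, ha', hb']
  -- Sides without a pipe receive the default label 0, which is never consulted.
  refine ⟨⟨?_, ?_, ?_, ?_, ?_⟩, fun i j => (V i j).getD 0, fun i j => (H i j).getD 0,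
    ⟨?_, ?_, ?_, ?_, ?_, ?_, ?_⟩, ?_, ?_, ?_⟩
  · intro i j h1 h2
    have := (hsides _ _ h2).2.2.2
    rw [add_sub_cancel_right] at this
    rw [(hsides _ _ h1).2.1, this]
  · intro i j h1 h2
    rw [(hsides _ _ h1).2.2.1, (hsides _ _ h2).1]
  · intro j hj
    rw [(hsides _ _ hj).2.1, hL.start j hj]
    rfl
  · intro i hi
    have := mem_rect.1 hi
    rw [(hsides _ _ hi).1, hL.west i (by omega) (by omega)]
    simp
  · intro i hi
    have := mem_rect.1 hi
    rw [(hsides _ _ hi).2.2.1, hL.east i (by omega) (by omega)]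
    rfl
  · intro j hj
    simp [hL.start j hj]
  · intro i j ht
    have := hls i j (hmem i j (by simp [ht]))
    rw [ht] at this
    obtain ⟨a, h1, h2, h3, h4⟩ := this
    simp [h1, h4]
  · intro i j ht
    have := hls i j (hmem i j (by simp [ht]))
    rw [ht] at this
    obtain ⟨a, h1, h2, h3, h4⟩ := this
    simp [h2, h3]
  · intro i j ht
    have := hls i j (hmem i j (by simp [ht]))
    rw [ht] at this
    obtain ⟨a, h1, h2, h3, h4⟩ := this
    simp [h1, h3]
  · intro i j ht
    have := hls i j (hmem i j (by simp [ht]))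
    rw [ht] at this
    obtain ⟨a, h1, h2, h3, h4⟩ := this
    simp [h2, h4]
  · intro i j ht ha
    obtain ⟨a, b, h1, h2, h3, h4, -, h5⟩ := hcr i j ht
    rw [← hcb i j ht, h5, not_lt] at ha
    simp [h1, h2, h3, h4, ha]
  · intro i j ht ha
    obtain ⟨a, b, h1, h2, h3, h4, -, h5⟩ := hcr i j ht
    rw [← hcb i j ht, h5] at ha
    simp [h1, h2, h3, h4, ha.le]
  · intro i hi
    have := mem_rect.1 hi
    simp [hL.east i (by omega) (by omega)]
  · intro j hj ht
    have h1 := (hsides _ _ hj).2.2.2.1 ht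
    rw [sub_self] at h1
    obtain ⟨x, hx⟩ := Option.isSome_iff_exists.1 h1
    have hm := mem_rect.1 hj
    have h2 : x ∈ ((upInts (1 - n) (n + n)).map (V 0)).reduceOption := by
      rw [List.reduceOption_mem_iff, List.mem_map]
      exact ⟨j, mem_upInts.2 (by push_cast; omega), hx⟩
    rw [hL.top_labels hw, mem_upInts] at h2
    simp only [hx, Option.getD_some]
    omega
  · intro i j ht
    obtain ⟨a, b, h1, h2, -, -, h5, -⟩ := hcr i j ht
    simp only [h1, h2, Option.getD_some]
    exact h5.symm

theorem gridRun_eq_some_iff_isLocalLabelling (w : ℤ → ℤ) (D : Filling n) (ts : List (Option ℤ)) :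
    gridRun D.rows ((downInts n n).map w) ((upInts (1 - n) (n + n)).map some) = some ts ↔
      ∃ V H, IsLocalLabelling w D V H ∧ ts = (upInts (1 - n) (n + n)).map (V 0) := by
  rw [Filling.rows, gridRun_eq_some_iff]
  have he : (1 - n + ((n + n : ℕ) : ℤ) : ℤ) = n + 1 := by push_cast; ring
  rw [he, sub_self]
  constructor
  · rintro ⟨V, H, h1, h2, h3, rfl⟩
    refine ⟨V, H, ⟨?_, ?_, ?_, ?_⟩, rfl⟩
    · intro j hj
      have := mem_rect.1 hj
      exact h1 j (by omega) (by omega)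
    · exact fun i hi hi' => (h2 i (by omega) hi').1
    · exact fun i hi hi' => (h2 i (by omega) hi').2
    · intro i j hij
      have := mem_rect.1 hij
      exact h3 i (by omega) (by omega) j (by omega) (by omega)
  · rintro ⟨V, H, hL, rfl⟩
    refine ⟨V, H, ?_, ?_, ?_, rfl⟩
    · exact fun x hx hx' => hL.start x (mem_rect.2 (by omega))
    · exact fun y hy hy' => ⟨hL.west y (by omega) hy', hL.east y (by omega) hy'⟩
    · exact fun y hy hy' x hx hx' => hL.step y x (mem_rect.2 (by omega))

end Labelling

/-! ### Grassmannian permutations -/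

theorem swap_prod_range_apply (i ℓ : ℕ) (x : ℤ) :
    ((List.range ℓ).reverse.map fun j : ℕ =>
      Equiv.swap ((j : ℤ) - i) ((j : ℤ) - i + 1)).prod x =
      if x = -i then (ℓ : ℤ) - i else if -(i : ℤ) < x ∧ x ≤ ℓ - i then x - 1 else x := by
  induction ℓ with
  | zero =>
    simp only [List.range_zero, List.reverse_nil, List.map_nil, List.prod_nil,
      Equiv.Perm.coe_one, id_eq, Nat.cast_zero]
    split_ifs <;> omega
  | succ ℓ ih =>
    rw [List.range_succ, List.reverse_append, List.map_append, List.prod_append,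
      Equiv.Perm.mul_apply, ih]
    simp only [List.reverse_singleton, List.map_singleton, List.prod_singleton,
      Equiv.swap_apply_def]
    push_cast
    split_ifs <;> omega

/-- The product of the first `k` rows in the definition of `grassPerm`. -/
def grassPermRows (μ : YoungDiagram) (k : ℕ) : Equiv.Perm ℤ :=
  ((List.range k).reverse.map fun i =>
    ((List.range (μ.rowLen i)).reverse.map fun j : ℕ =>
      Equiv.swap ((j : ℤ) - i) ((j : ℤ) - i + 1)).prod).prod

theorem grassPerm_eq_grassPermRows (μ : YoungDiagram) :
    grassPerm μ = grassPermRows μ (μ.colLen 0) := by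
  -- The integer indices in `grassPerm` come from lists of naturals coerced through the list monad.
  have h : ∀ l : List ℕ, (do let a ← l; pure (a : ℤ) : List ℤ) = l.map Nat.cast := by
    intro l
    induction l <;> simp_all
  simp only [grassPerm, grassPermRows, h, List.map_map]
  rfl

/-- The row with index `k` acts by a cycle that sends `-k` to `μ.rowLen k - k` and lowers the values
in between by one. Earlier rows have arms too long to be affected; the value started at `x + 1` is
lowered once for each row that contains a box in column `x`. -/
theorem grassPermRows_apply (μ : YoungDiagram) (k : ℕ) :
    (∀ r : ℕ, grassPermRows μ k (-r) = if r < k then (μ.rowLen r : ℤ) - r else -r) ∧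
      ∀ x : ℕ, grassPermRows μ k (x + 1) = x + 1 - min k (μ.colLen x) := by
  induction k with
  | zero => simp [grassPermRows]
  | succ k ih =>
    have h : ∀ x, grassPermRows μ (k + 1) x =
        if grassPermRows μ k x = -k then (μ.rowLen k : ℤ) - k
        else if -(k : ℤ) < grassPermRows μ k x ∧ grassPermRows μ k x ≤ μ.rowLen k - k
          then grassPermRows μ k x - 1 else grassPermRows μ k x := by
      intro x
      rw [← swap_prod_range_apply]
      simp only [grassPermRows]
      rw [List.range_succ, List.reverse_append, List.map_append, List.prod_append,
        Equiv.Perm.mul_apply]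
      simp only [List.reverse_singleton, List.map_singleton, List.prod_singleton]
    refine ⟨fun r => ?_, fun x => ?_⟩
    · rw [h, ih.1]
      have := μ.rowLen_anti r k
      rcases lt_trichotomy r k with hr | rfl | hr
      · rw [if_pos hr]
        split_ifs <;> omega
      · simp
      · split_ifs <;> omega
    · rw [h, ih.2]
      have : k < μ.colLen x ↔ x < μ.rowLen k := by
        rw [← YoungDiagram.mem_iff_lt_colLen, YoungDiagram.mem_iff_lt_rowLen]
      by_cases hk : k < μ.colLen x
      · have := this.1 hk
        rw [min_eq_left hk.le, min_eq_left (by omega : k + 1 ≤ μ.colLen x)]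
        push_cast
        split_ifs <;> omega
      · have := mt this.2 hk
        rw [min_eq_right (not_lt.1 hk), min_eq_right (by omega : μ.colLen x ≤ k + 1)]
        split_ifs <;> omega

theorem grassPerm_neg (μ : YoungDiagram) (r : ℕ) : grassPerm μ (-r) = μ.rowLen r - r := by
  rw [grassPerm_eq_grassPermRows, (grassPermRows_apply μ _).1]
  split_ifs with h
  · rfl
  · have : ¬ 0 < μ.rowLen r := by
      rwa [← YoungDiagram.mem_iff_lt_rowLen, YoungDiagram.mem_iff_lt_colLen]
    omega

theorem grassPerm_add_one (μ : YoungDiagram) (x : ℕ) :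
    grassPerm μ (x + 1) = x + 1 - μ.colLen x := by
  rw [grassPerm_eq_grassPermRows, (grassPermRows_apply μ _).2, min_eq_right (μ.colLen_anti 0 x (by omega))]

theorem grassPerm_strictMonoOn_Iic (μ : YoungDiagram) : StrictMonoOn (grassPerm μ) (Set.Iic 0) := by
  intro x hx y hy hxy
  rw [Set.mem_Iic] at hx hy
  obtain ⟨r, rfl⟩ : ∃ r : ℕ, x = -r := ⟨(-x).toNat, by omega⟩
  obtain ⟨s, rfl⟩ : ∃ r : ℕ, y = -r := ⟨(-y).toNat, by omega⟩
  rw [grassPerm_neg, grassPerm_neg]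
  have := μ.rowLen_anti s r (by omega)
  omega

theorem grassPerm_strictMonoOn_Ioi (μ : YoungDiagram) : StrictMonoOn (grassPerm μ) (Set.Ioi 0) := by
  intro x hx y hy hxy
  rw [Set.mem_Ioi] at hx hy
  obtain ⟨r, rfl⟩ : ∃ r : ℕ, x = r + 1 := ⟨(x - 1).toNat, by omega⟩
  obtain ⟨s, rfl⟩ : ∃ r : ℕ, y = r + 1 := ⟨(y - 1).toNat, by omega⟩
  rw [grassPerm_add_one, grassPerm_add_one]
  have := μ.colLen_anti r s (by omega)
  omega

theorem suppIn_grassPerm {μ : YoungDiagram} {n : ℕ} (hr : μ.rowLen 0 ≤ n) (hc : μ.colLen 0 ≤ n) :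
    SuppIn (1 - n) n (grassPerm μ) := by
  intro x hx
  rw [Set.mem_Icc] at hx
  rcases le_or_gt x 0 with h | h
  · obtain ⟨r, rfl⟩ : ∃ r : ℕ, x = -r := ⟨(-x).toNat, by omega⟩
    have : ¬ 0 < μ.rowLen r := by
      rw [← YoungDiagram.mem_iff_lt_rowLen, YoungDiagram.mem_iff_lt_colLen]
      omega
    rw [grassPerm_neg]
    omega
  · obtain ⟨r, rfl⟩ : ∃ r : ℕ, x = r + 1 := ⟨(x - 1).toNat, by omega⟩
    have : ¬ 0 < μ.colLen r := by
      rw [← YoungDiagram.mem_iff_lt_colLen, YoungDiagram.mem_iff_lt_rowLen]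
      omega
    rw [grassPerm_add_one]
    omega

theorem neg_one_pow_len_swap_prod {B : Type*} [CommRing B] (l : List ℤ) :
    (-1 : B) ^ len (l.map fun i => Equiv.swap i (i + 1)).prod = (-1) ^ l.length ∧
      ∃ p q, SuppIn p q (l.map fun i => Equiv.swap i (i + 1)).prod := by
  induction l using List.reverseRecOn with
  | nil =>
    refine ⟨?_, 0, 0, fun _ _ => rfl⟩
    have : len 1 = 0 := by
      have : {c : ℤ × ℤ | c.1 < c.2 ∧ c.2 < c.1} = ∅ := by
        ext c
        simp only [Set.mem_ofPred_eq, Set.mem_empty_iff_false, iff_false]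
        exact fun h => lt_asymm h.1 h.2
      simp [len, this]
    simp [this]
  | append_singleton l i ih =>
    obtain ⟨h, p, q, hpq⟩ := ih
    rw [List.map_append, List.prod_append, List.map_singleton, List.prod_singleton]
    refine ⟨?_, min p i, max q (i + 1), (hpq.mono (min_le_left ..) (le_max_left ..)).mul
      (suppIn_swap (min_le_right ..) (le_max_right ..))⟩
    rw [neg_one_pow_len_mul_swap hpq, h, List.length_append, List.length_singleton, pow_succ]
    ring

theorem card_eq_sum_rowLen (μ : YoungDiagram) :
    μ.card = ∑ i ∈ Finset.range (μ.colLen 0), μ.rowLen i := by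
  have h : ∑ i ∈ Finset.range (μ.colLen 0), μ.rowLen i =
      ((Finset.range (μ.colLen 0)).sigma fun i => Finset.range (μ.rowLen i)).card := by simp
  rw [h]
  refine Finset.card_bij' (fun c _ => ⟨c.1, c.2⟩) (fun c _ => (c.1, c.2)) ?_ ?_ ?_ ?_
  · rintro ⟨i, j⟩ h
    rw [YoungDiagram.mem_cells] at h
    simp only [Finset.mem_sigma, Finset.mem_range]
    exact ⟨YoungDiagram.mem_iff_lt_colLen.1 (μ.up_left_mem le_rfl (Nat.zero_le j) h),
      YoungDiagram.mem_iff_lt_rowLen.1 h⟩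
  · rintro ⟨i, j⟩ h
    simp only [Finset.mem_sigma, Finset.mem_range] at h
    rw [YoungDiagram.mem_cells]
    exact YoungDiagram.mem_iff_lt_rowLen.2 h.2
  · intros; rfl
  · intros; rfl

/-- Only the parity of the length is needed: each simple reflection changes it, and there is one per
box. That the word is reduced plays no role. -/
theorem neg_one_pow_len_grassPerm {B : Type*} [CommRing B] (μ : YoungDiagram) :
    (-1 : B) ^ len (grassPerm μ) = (-1) ^ μ.card := by
  set l : List ℤ := (List.range (μ.colLen 0)).reverse.flatMap fun i =>
    (List.range (μ.rowLen i)).reverse.map fun j : ℕ => (j : ℤ) - i with hl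
  have h1 : grassPerm μ = (l.map fun i => Equiv.swap i (i + 1)).prod := by
    rw [hl, List.map_flatMap, List.flatMap_def, List.prod_flatten, List.map_map, grassPerm_eq_grassPermRows,
      grassPermRows]
    refine congrArg List.prod (List.map_congr_left fun i _ => ?_)
    simp only [Function.comp_apply, List.map_map]
    rfl
  have h2 : l.length = μ.card := by
    rw [hl, List.length_flatMap, card_eq_sum_rowLen, ← List.sum_toFinset _
      (List.nodup_reverse.2 List.nodup_range), List.toFinset_reverse, List.toFinset_range]
    simp
  rw [h1, (neg_one_pow_len_swap_prod l).1, h2]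

/-! ### The shape of a bumpless pipedream -/

section Shape

variable {n : ℕ}

open Classical in
theorem mem_shape {D : Filling n} {b : ℕ × ℕ} : b ∈ shape D ↔ (b.1 < n ∧ b.2 < n) ∧
    ∃ c ∈ Finset.Icc (1 - (n : ℤ)) n, (D.tile 1 c).north ∧
      b.1 ≤ ((Finset.Ioc c n).filter fun c' => (D.tile 1 c').north).card ∧
      b.2 < ((Finset.Ico (1 - (n : ℤ)) c).filter fun c' => ¬ (D.tile 1 c').north).card := by
  rw [← YoungDiagram.mem_cells]
  simp only [shape, Finset.mem_filter, Finset.mem_product, Finset.mem_range]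

theorem shape_rowLen_zero_le (D : Filling n) : (shape D).rowLen 0 ≤ n := by
  by_contra h
  have := YoungDiagram.mem_iff_lt_rowLen.2 (not_le.1 h)
  simp [mem_shape] at this

theorem shape_colLen_zero_le (D : Filling n) : (shape D).colLen 0 ≤ n := by
  by_contra h
  have := YoungDiagram.mem_iff_lt_colLen.2 (not_le.1 h)
  simp [mem_shape] at this

theorem suppIn_grassPerm_shape (D : Filling n) : SuppIn (1 - n) n (grassPerm (shape D)) :=
  suppIn_grassPerm (shape_rowLen_zero_le D) (shape_colLen_zero_le D)

open Classical in
-- A pipe at `c` with R pipes to its right and L gaps to its left belongs to the row of index R, of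
-- length L. Since there are `n` pipes in all, L - R = `c`, and this is the image of -R under
-- `grassPerm (shape D)`.
theorem grassPerm_shape_symm_nonpos {D : Filling n}
    (hD : ((Finset.Icc (1 - (n : ℤ)) n).filter fun c => (D.tile 1 c).north).card = n)
    {c : ℤ} (hc : c ∈ Finset.Icc (1 - (n : ℤ)) n) (hN : (D.tile 1 c).north) :
    (grassPerm (shape D)).symm c ≤ 0 := by
  have hc' := Finset.mem_Icc.1 hc
  set N : Finset ℤ := (Finset.Icc (1 - (n : ℤ)) n).filter fun c => (D.tile 1 c).north with hNdef
  set R : ℤ → Finset ℤ := fun c => (Finset.Ioc c n).filter fun c' => (D.tile 1 c').north with hR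
  set L : ℤ → Finset ℤ := fun c =>
    (Finset.Ico (1 - (n : ℤ)) c).filter fun c' => ¬ (D.tile 1 c').north with hL
  have hRlt : ∀ c c' : ℤ, c < c' → c' ≤ n → (D.tile 1 c').north → (R c').card < (R c).card := by
    intro c c' h h' hn
    refine Finset.card_lt_card (Finset.ssubset_iff_of_subset ?_ |>.2 ⟨c', ?_, ?_⟩)
    · intro x hx
      simp only [hR, Finset.mem_filter, Finset.mem_Ioc] at hx ⊢
      exact ⟨⟨by omega, hx.1.2⟩, hx.2⟩
    · simp only [hR, Finset.mem_filter, Finset.mem_Ioc]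
      exact ⟨⟨h, h'⟩, hn⟩
    · simp [hR]
  have hLle : ∀ c c' : ℤ, c' ≤ c → (L c').card ≤ (L c).card := by
    intro c c' h
    refine Finset.card_le_card fun x hx => ?_
    simp only [hL, Finset.mem_filter, Finset.mem_Ico] at hx ⊢
    exact ⟨⟨by omega, by omega⟩, hx.2⟩
  have hcount : (((Finset.Ico (1 - (n : ℤ)) c).filter fun c' => (D.tile 1 c').north).card +
      1 + (R c).card) = n := by
    refine Eq.trans ?_ hD
    rw [← Finset.card_insert_of_notMem (a := c) (by simp), ← Finset.card_union_of_disjoint]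
    · congr 1
      ext x
      simp only [hR, Finset.mem_union, Finset.mem_insert, Finset.mem_filter, Finset.mem_Ico,
        Finset.mem_Ioc, hNdef, Finset.mem_Icc]
      constructor
      · rintro ((rfl | h) | h)
        · exact ⟨hc', hN⟩
        · exact ⟨by omega, h.2⟩
        · exact ⟨by omega, h.2⟩
      · rintro ⟨h, h'⟩
        rcases lt_trichotomy x c with hx | rfl | hx
        · exact Or.inl (Or.inr ⟨by omega, h'⟩)
        · exact Or.inl (Or.inl rfl)
        · exact Or.inr ⟨by omega, h'⟩
    · rw [Finset.disjoint_left]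
      intro x hx hx'
      simp only [hR, Finset.mem_insert, Finset.mem_filter, Finset.mem_Ico,
        Finset.mem_Ioc] at hx hx'
      omega
  have hcount' : ((Finset.Ico (1 - (n : ℤ)) c).filter fun c' => (D.tile 1 c').north).card +
      (L c).card = (c - (1 - n)).toNat := by
    rw [← Int.card_Ico]
    convert Finset.card_filter_add_card_filter_not (s := Finset.Ico (1 - (n : ℤ)) c)
      (fun c' => (D.tile 1 c').north)
  have hLn : (L c).card ≤ n := by
    have h1 : (R c).card ≤ (n - c).toNat := by
      rw [← Int.card_Ioc]
      exact Finset.card_filter_le _ _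
    omega
  have hrow : (shape D).rowLen (R c).card = (L c).card := by
    refine eq_of_forall_lt_iff fun s => ?_
    rw [← YoungDiagram.mem_iff_lt_rowLen, mem_shape]
    constructor
    · rintro ⟨-, c', hc2, hn, h1, h2⟩
      refine lt_of_lt_of_le h2 (hLle _ _ ?_)
      by_contra hlt
      exact absurd h1 (not_le.2 (hRlt c c' (not_le.1 hlt) (Finset.mem_Icc.1 hc2).2 hn))
    · exact fun h => ⟨⟨by omega, by omega⟩, c, hc, hN, le_rfl, h⟩
  have : grassPerm (shape D) (-(R c).card) = c := by
    rw [grassPerm_neg, hrow]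
    omega
  rw [← this, Equiv.symm_apply_apply]
  omega

open Classical in
-- One implication is known, and both sets of columns have at most `n` elements, the first exactly
-- `n`; so they coincide.
theorem north_iff_grassPerm_shape {D : Filling n}
    (hD : ((Finset.Icc (1 - (n : ℤ)) n).filter fun c => (D.tile 1 c).north).card = n)
    {c : ℤ} (hc : c ∈ Finset.Icc (1 - (n : ℤ)) n) :
    (D.tile 1 c).north ↔ (grassPerm (shape D)).symm c ≤ 0 := by
  have hsub : ((Finset.Icc (1 - (n : ℤ)) n).filter fun c => (D.tile 1 c).north) ⊆
      ((Finset.Icc (1 - (n : ℤ)) n).filter fun c => (grassPerm (shape D)).symm c ≤ 0) := by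
    intro c hc
    rw [Finset.mem_filter] at hc ⊢
    exact ⟨hc.1, grassPerm_shape_symm_nonpos hD hc.1 hc.2⟩
  have hle : ((Finset.Icc (1 - (n : ℤ)) n).filter fun c =>
      (grassPerm (shape D)).symm c ≤ 0).card ≤ n := by
    have : (Finset.Icc (1 - (n : ℤ)) 0).card = n := by simp
    conv_rhs => rw [← this]
    refine Finset.card_le_card_of_injOn (grassPerm (shape D)).symm ?_ ?_
    · intro x hx
      rw [Finset.mem_coe, Finset.mem_filter, Finset.mem_Icc] at hx
      rw [Finset.mem_coe, Finset.mem_Icc]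
      refine ⟨?_, hx.2⟩
      by_contra hlt
      have := suppIn_grassPerm_shape D ((grassPerm (shape D)).symm x) (by simp; omega)
      rw [Equiv.apply_symm_apply] at this
      omega
    · exact (grassPerm (shape D)).symm.injective.injOn
  have heq := Finset.eq_of_subset_of_card_le hsub (by rw [hD]; exact hle)
  have := congrArg (c ∈ ·) heq
  simpa only [Finset.mem_filter, hc, true_and, eq_iff_iff] using this

theorem upInts_nodup (p : ℤ) (m : ℕ) : (upInts p m).Nodup :=
  (pairwise_lt_upInts p m).imp ne_of_lt

open Classical in
theorem IsLocalLabelling.card_north {w : Equiv.Perm ℤ} (hw : SuppIn 1 n w) {D : Filling n}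
    {V H : ℤ → ℤ → Option ℤ} (hL : IsLocalLabelling w D V H) :
    ((Finset.Icc (1 - (n : ℤ)) n).filter fun c => (D.tile 1 c).north).card = n := by
  rcases Nat.eq_zero_or_pos n with rfl | hn
  · simp
  have h := congrArg List.length (hL.top_labels hw)
  rw [List.reduceOption_length_eq, List.filter_map, List.length_map, length_upInts] at h
  have h2 : ((upInts (1 - n) (n + n)).filter (Option.isSome ∘ V 0)).toFinset.card = n := by
    rw [List.toFinset_card_of_nodup ((upInts_nodup _ _).filter _), h]
  convert h2 using 2
  ext x
  rw [Finset.mem_filter, Finset.mem_Icc, List.mem_toFinset, List.mem_filter, mem_upInts]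
  push_cast
  refine (and_congr_left' (by omega)).trans (and_congr_right fun hx => ?_)
  have h1 : ((1 : ℤ), x) ∈ rect n := mem_rect.2 (by omega)
  have h2 := (tileRun_sides (hL.step 1 x h1)).2.2.2
  rw [sub_self] at h2
  exact h2

/-- Each admissible filling below the cut is a pipedream `D`. It leaves the nonpositive labels in
order, at the positions where w_{λ(D)} leaves its own, so the part above the cut is the whole
partition function of w_{λ(D)}. -/
theorem gridSum_eq_sum_rectBPDs {A : Type*} [CommRing A] (X α : ℤ → A) {k : ℕ} (hk : n ≤ k)
    {w : Equiv.Perm ℤ} (hw : SuppIn 1 n w) :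
    gridSum X α (1 - k) (k + n) w =
      ∑ D ∈ rectBPDs n w, (∏ c : rect n, (D c).weight (X c.1.1 * α c.1.2)) *
        gridSum X α (1 - k) (k + n) (grassPerm (shape D)) := by
  rw [gridSum_eq_posCross X α hk hw, latticeSum_eq_sum_filling, rectBPDs, Finset.sum_filter]
  refine Finset.sum_congr rfl fun D _ => ?_
  split_ifs with hD
  · obtain ⟨V, H, hL⟩ := exists_isLocalLabelling hD
    rw [(gridRun_eq_some_iff_isLocalLabelling w D _).2 ⟨V, H, hL, rfl⟩, Option.elim_some]
    congr 1
    obtain ⟨e, rfl⟩ := Nat.exists_eq_add_of_le' hk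
    rw [Nat.add_sub_cancel]
    have hsupp := suppIn_grassPerm_shape D
    -- The cut consists of the straight columns left of `1 - n` followed by the north boundary of
    -- `D`.
    refine (gridSum_eq_upperSum X α (hsupp.mono (by omega) le_rfl)
      (grassPerm_strictMonoOn_Iic _) (grassPerm_strictMonoOn_Ioi _) ?_ ?_).symm
    · rw [List.reduceOption_append, hL.top_labels hw, upInts_add]
      congr 1
      · generalize upInts (1 - ((e + n : ℕ) : ℤ)) e = l
        induction l <;> simp_all
      · congr 1
        push_cast
        ring
    · rw [add_assoc e n n, upInts_add _ e, List.map_append, List.map_append, List.map_map,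
        show (1 - ((e + n : ℕ) : ℤ) + e : ℤ) = 1 - n by push_cast; ring, List.map_map]
      congr 1
      · refine List.map_congr_left fun x hx => ?_
        rw [mem_upInts] at hx
        have : (grassPerm (shape D)).symm x = x := by
          rw [Equiv.symm_apply_eq, hsupp x]
          rw [Set.mem_Icc]
          omega
        simp only [Function.comp_apply, Option.isSome_some, this]
        rw [eq_comm, decide_eq_true_eq]
        push_cast at hx
        omega
      · refine List.map_congr_left fun x hx => ?_
        rw [mem_upInts] at hx
        push_cast at hx
        have h1 := north_iff_grassPerm_shape (hL.card_north hw) (c := x)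
          (Finset.mem_Icc.2 (by omega))
        have h2 := (tileRun_sides (hL.step 1 x (mem_rect.2 (by omega)))).2.2.2
        rw [sub_self] at h2
        rw [Function.comp_apply, Bool.eq_iff_iff, decide_eq_true_eq, ← h1, h2]
  · have : gridRun D.rows ((downInts n n).map w) ((upInts (1 - n) (n + n)).map some) = none := by
      rw [Option.eq_none_iff_forall_ne_some]
      intro ts hts
      obtain ⟨V, H, hL, -⟩ := (gridRun_eq_some_iff_isLocalLabelling w D ts).1 hts
      exact hD (hL.isRectBPD hw)
    rw [this, Option.elim_none, mul_zero]

end Shape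

/-! ### Weights of pipedreams and the expansion of double Grothendieck polynomials on a finite
interval -/

theorem prod_tileWeight {n : ℕ} {A : Type*} [CommRing A] (D : Filling n) (z : rect n → A) :
    ∏ c, (D c).weight (z c) = (∏ c ∈ Finset.univ.filter (fun c => D c = Tile.empty), (z c - 1)) *
      ∏ c ∈ Finset.univ.filter (fun c => D c = Tile.nw), z c := by
  rw [Finset.prod_filter, Finset.prod_filter, ← Finset.prod_mul_distrib]
  refine Finset.prod_congr rfl fun c _ => ?_
  rcases D c with _ | _ | _ | _ | _ | _ <;> simp [Tile.weight]

theorem map_ringInverse {A B : Type*} [CommRing A] [CommRing B] (f : A →+* B) {u : A}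
    (hu : IsUnit u) : f (Ring.inverse u) = Ring.inverse (f u) := by
  have h := congrArg f (Ring.mul_inverse_cancel _ hu)
  rw [map_mul, map_one] at h
  exact (hu.map f).mul_left_cancel (h.trans (Ring.mul_inverse_cancel _ (hu.map f)).symm)

theorem map_ominus {A B : Type*} [CommRing A] [CommRing B] (f : A →+* B) {u v : A}
    (hv : IsUnit (1 - v)) : f (ominus u v) = ominus (f u) (f v) := by
  rw [ominus, ominus, map_mul, map_ringInverse f hv, map_sub, map_sub, map_one]

/-- The weight of a bumpless pipedream as an element of a ring in which the variables are
evaluated. -/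
def weightAt {A : Type*} [CommRing A] (x a : ℤ → A) {n : ℕ} (D : Filling n) : A :=
  (∏ c ∈ Finset.univ.filter (fun c => D c = Tile.empty), -ominus (x c.1.1) (a c.1.2)) *
  ∏ c ∈ Finset.univ.filter (fun c => D c = Tile.nw), (1 - ominus (x c.1.1) (a c.1.2))

theorem map_weightAt {A B : Type*} [CommRing A] [CommRing B] (f : A →+* B) (x : ℤ → A) {a : ℤ → A}
    (ha : ∀ j, IsUnit (1 - a j)) {n : ℕ} (D : Filling n) :
    f (weightAt x a D) = weightAt (fun i => f (x i)) (fun j => f (a j)) D := by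
  simp only [weightAt, map_mul, map_prod, map_neg, map_sub, map_one, map_ominus f (ha _)]

theorem map_prod_tileWeight {B : Type*} [CommRing B] (f : MvPolynomial ℤ LamHat →+* B) {n : ℕ}
    (D : Filling n) : f (∏ c : rect n, (D c).weight (polyX c.1.1 * polyA c.1.2)) =
      weightAt (fun i => f (MvPolynomial.X i)) (fun j => f (MvPolynomial.C (LamHat.a j))) D := by
  have h : ∀ i j, f (polyX i * polyA j) =
      1 - ominus (f (MvPolynomial.X i)) (f (MvPolynomial.C (LamHat.a j))) := by
    intro i j
    rw [polyX_mul_polyA, map_sub, map_one, map_ominus f (isUnit_one_sub_C_a j)]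
  rw [prod_tileWeight, weightAt, map_mul, map_prod, map_prod]
  simp only [map_sub, map_one, h]
  congr 1
  refine Finset.prod_congr rfl fun c _ => ?_
  ring

theorem doubleGroth_eq_gridSum_of_suppIn {n k : ℕ} (hk : n ≤ k) (t : ℕ) {v : Equiv.Perm ℤ}
    (hv : SuppIn (1 - n) n v) : doubleGroth (1 - k) (n + t) v =
      (-1) ^ len v * gridSum polyX polyA (1 - k) (k + n) v := by
  rw [doubleGroth_eq_gridSum (m := k + n + t) (by push_cast; ring)
    (hv.mono (by omega) (by omega)), gridSum_add]
  intro i hi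
  refine hv i ?_
  rw [Set.mem_Icc]
  push_cast at hi
  omega

theorem neg_one_pow_len_mul_gridSum {B : Type*} [CommRing B] (X α : ℤ → B) {n k : ℕ} (hk : n ≤ k)
    {w : Equiv.Perm ℤ} (hw : SuppIn 1 n w) :
    (-1) ^ len w * gridSum X α (1 - k) (k + n) w = (-1) ^ len w * ∑ D ∈ rectBPDs n w,
      (-1) ^ (shape D).card * (∏ c : rect n, (D c).weight (X c.1.1 * α c.1.2)) *
        ((-1) ^ len (grassPerm (shape D)) *
          gridSum X α (1 - k) (k + n) (grassPerm (shape D))) := by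
  rw [gridSum_eq_sum_rectBPDs X α hk hw]
  refine congrArg _ (Finset.sum_congr rfl fun D _ => ?_)
  rw [neg_one_pow_len_grassPerm]
  have : ((-1 : B) ^ (shape D).card) * (-1) ^ (shape D).card = 1 := by
    rw [← mul_pow, neg_one_mul, neg_neg, one_pow]
  linear_combination (-(∏ c : rect n, (D c).weight (X c.1.1 * α c.1.2)) *
    gridSum X α (1 - k) (k + n) (grassPerm (shape D))) * this

theorem map_doubleGroth {B : Type*} [CommRing B] (f : MvPolynomial ℤ LamHat →+* B) {n k : ℕ}
    (hk : n ≤ k) (t : ℕ) {v : Equiv.Perm ℤ} (hv : SuppIn (1 - n) n v) :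
    f (doubleGroth (1 - k) (n + t) v) = (-1) ^ len v *
      gridSum (fun i => f (polyX i)) (fun j => f (polyA j)) (1 - k) (k + n) v := by
  rw [doubleGroth_eq_gridSum_of_suppIn hk t hv, map_mul, map_gridSum, map_pow, map_neg, map_one]

/-- The index set and the weights do not depend on `p` and `q`, which enter only through the
Grassmannian polynomials. This makes the passage to the limit a termwise one. -/
theorem map_doubleGroth_eq_sum_rectBPDs {B : Type*} [CommRing B] (f : MvPolynomial ℤ LamHat →+* B)
    {n : ℕ} {w : Equiv.Perm ℤ} (hw : SuppIn 1 n w) {p q : ℤ} (hp : p ≤ 1 - n) (hq : n ≤ q) :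
    f (doubleGroth p q w) = (-1) ^ len w * ∑ D ∈ rectBPDs n w, (-1) ^ (shape D).card *
      weightAt (fun i => f (MvPolynomial.X i)) (fun j => f (MvPolynomial.C (LamHat.a j))) D *
        f (doubleGroth p q (grassPerm (shape D))) := by
  obtain ⟨k, rfl⟩ : ∃ k : ℕ, p = 1 - k := ⟨(1 - p).toNat, by omega⟩
  obtain ⟨t, rfl⟩ : ∃ t : ℕ, q = n + t := ⟨(q - n).toNat, by omega⟩
  have hk : n ≤ k := by omega
  rw [map_doubleGroth f hk t (hw.mono (by omega) le_rfl), neg_one_pow_len_mul_gridSum _ _ hk hw]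
  refine congrArg _ (Finset.sum_congr rfl fun D _ => ?_)
  rw [map_doubleGroth f hk t (suppIn_grassPerm_shape D), ← map_prod_tileWeight f D, map_prod]
  refine congrArg (· * _) (congrArg _ (Finset.prod_congr rfl fun c _ => ?_))
  rw [← map_mul]
  rcases D c with _ | _ | _ | _ | _ | _ <;> simp [Tile.weight]

open MvPowerSeries (coeff)

/-! ### Coefficients of realizations -/

theorem coeff_esymm_fin {m : ℕ} (k : ℕ) (u : Fin m →₀ ℕ) :
    MvPolynomial.coeff u (MvPolynomial.esymm (Fin m) ℤ k) =
      if u.degree = k ∧ ∀ i, u i ≤ 1 then 1 else 0 := by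
  classical
  have hval : ∀ (t : Finset (Fin m)) i, (∑ i ∈ t, Finsupp.single i 1 : Fin m →₀ ℕ) i =
      if i ∈ t then 1 else 0 := by
    intro t i
    rw [Finsupp.finsetSum_apply]
    simp [Finsupp.single_apply]
  rw [MvPolynomial.esymm_eq_sum_monomial, MvPolynomial.coeff_sum]
  simp only [MvPolynomial.coeff_monomial]
  split_ifs with h
  · have hu : (∑ i ∈ u.support, Finsupp.single i 1 : Fin m →₀ ℕ) = u := by
      ext i
      rw [hval]
      have := h.2 i
      simp only [Finsupp.mem_support_iff]
      split_ifs <;> omega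
    have hc : u.support.card = k := by
      rw [← h.1, Finsupp.degree_apply, Finset.card_eq_sum_ones]
      refine Finset.sum_congr rfl fun i hi => ?_
      have := h.2 i
      rw [Finsupp.mem_support_iff] at hi
      omega
    rw [Finset.sum_eq_single u.support, if_pos hu]
    · intro t _ ht
      rw [if_neg]
      rintro rfl
      refine ht (Finset.ext fun i => ?_)
      rw [Finsupp.mem_support_iff, hval]
      simp
    · intro hn
      exact absurd (Finset.mem_powersetCard.2 ⟨Finset.subset_univ _, hc⟩) hn
  · refine Finset.sum_eq_zero fun t ht => if_neg ?_
    rintro rfl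
    refine h ⟨?_, fun i => ?_⟩
    · rw [map_sum]
      simp [(Finset.mem_powersetCard.1 ht).2]
    · rw [hval]
      split_ifs <;> omega

theorem degree_embDomain {σ τ : Type*} (f : σ ↪ τ) (u : σ →₀ ℕ) :
    (u.embDomain f).degree = u.degree := by
  rw [Finsupp.degree_apply, Finsupp.degree_apply, Finsupp.support_embDomain, Finset.sum_map]
  simp

theorem degree_sumElim {σ τ : Type*} (x : σ →₀ ℕ) (y : τ →₀ ℕ) :
    (x.sumElim y).degree = x.degree + y.degree := by
  rw [Finsupp.sumElim_eq_add, map_add, Finsupp.degree_mapDomain, Finsupp.degree_mapDomain]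

theorem killCompl_eX {m : ℕ} (y : Fin m ↪ ℤ) (hy : ∀ j, y j ≤ 0) (k : ℕ) :
    MvPowerSeries.killCompl (y.trans ⟨Sum.inl, Sum.inl_injective⟩) (eX k) =
      (MvPolynomial.esymm (Fin m) ℤ k : MvPowerSeries (Fin m) ℤ) := by
  classical
  ext u
  rw [MvPowerSeries.coeff_killCompl, MvPolynomial.coeff_coe, coeff_esymm_fin,
    MvPowerSeries.coeff_apply, eX, degree_embDomain]
  refine if_congr (and_congr_right fun _ => ⟨?_, ?_⟩) rfl rfl
  · rintro ⟨-, -, h⟩ i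
    have := h (y i)
    rwa [show (Sum.inl (y i) : ℤ ⊕ ℤ) = (y.trans ⟨Sum.inl, Sum.inl_injective⟩) i from rfl,
      Finsupp.embDomain_apply_self] at this
  · intro h
    refine ⟨fun i => ?_, fun i hi => ?_, fun i => ?_⟩
    · refine Finsupp.embDomain_of_notMem_range _ _ _ ?_
      rintro ⟨j, hj⟩
      simp at hj
    · refine Finsupp.embDomain_of_notMem_range _ _ _ ?_
      rintro ⟨j, hj⟩
      have := Sum.inl_injective hj
      have := hy j
      simp_all
      omega
    · by_cases hi : (Sum.inl i : ℤ ⊕ ℤ) ∈ Set.range (y.trans ⟨Sum.inl, Sum.inl_injective⟩)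
      · obtain ⟨j, hj⟩ := hi
        rw [← hj, Finsupp.embDomain_apply_self]
        exact h j
      · rw [Finsupp.embDomain_of_notMem_range _ _ _ hi]
        omega

theorem killCompl_hA {m : ℕ} (y : Fin m ↪ ℤ) (k : ℕ) :
    MvPowerSeries.killCompl (y.trans ⟨Sum.inl, Sum.inl_injective⟩) (hA k) =
      if k = 0 then 1 else 0 := by
  classical
  ext u
  have : coeff u (if k = 0 then 1 else 0 : MvPowerSeries (Fin m) ℤ) =
      if u = 0 ∧ k = 0 then 1 else 0 := by
    split_ifs <;> simp_all [MvPowerSeries.coeff_one]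
  rw [MvPowerSeries.coeff_killCompl, MvPowerSeries.coeff_apply, hA, degree_embDomain, this]
  refine if_congr ⟨?_, ?_⟩ rfl rfl
  · rintro ⟨h, h', -⟩
    have hu : u = 0 := by
      ext i
      have := h' (y i)
      rwa [show (Sum.inl (y i) : ℤ ⊕ ℤ) = (y.trans ⟨Sum.inl, Sum.inl_injective⟩) i from rfl,
        Finsupp.embDomain_apply_self] at this
    refine ⟨hu, ?_⟩
    rw [← h, hu, map_zero]
  · rintro ⟨rfl, rfl⟩
    simp

/-- Setting all a_i and all but `m` of the x_i to zero turns e_k(x/a) into an elementary symmetric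
polynomial; this is the bridge to the classical theory. -/
theorem killCompl_eSuper {m : ℕ} (y : Fin m ↪ ℤ) (hy : ∀ j, y j ≤ 0) (k : ℕ) :
    MvPowerSeries.killCompl (y.trans ⟨Sum.inl, Sum.inl_injective⟩) (eSuper k) =
      (MvPolynomial.esymm (Fin m) ℤ k : MvPowerSeries (Fin m) ℤ) := by
  rw [eSuper, map_sum, Finset.sum_eq_single 0]
  · simp [killCompl_hA, killCompl_eX y hy]
  · intro j _ hj
    rw [map_mul, killCompl_hA, if_neg hj, mul_zero]
  · simp

/-! ### Coefficients of monomials in the e_k(x/a) -/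

/-- The product of the `e_k(x/a)` with the given exponents. -/
def eProd (β : ℕ+ →₀ ℕ) : Series := β.prod fun k n => eSuper k ^ n

/-- The degree of `eProd β`. -/
def wtE (β : ℕ+ →₀ ℕ) : ℕ := β.sum fun k n => n * k

/-- The series is homogeneous of degree `n` for the grading `φ`. -/
def IsHomog {σ : Type*} (φ : (σ →₀ ℕ) →+ ℕ) (f : MvPowerSeries σ ℤ) (n : ℕ) : Prop :=
  ∀ d, coeff d f ≠ 0 → φ d = n

section IsHomog

variable {σ : Type*} {φ : (σ →₀ ℕ) →+ ℕ}

theorem IsHomog.mul {f g : MvPowerSeries σ ℤ} {a b : ℕ} (hf : IsHomog φ f a)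
    (hg : IsHomog φ g b) : IsHomog φ (f * g) (a + b) := by
  classical
  intro d h
  rw [MvPowerSeries.coeff_mul] at h
  obtain ⟨⟨s, t⟩, hst, h⟩ := Finset.exists_ne_zero_of_sum_ne_zero h
  rw [Finset.HasAntidiagonal.mem_antidiagonal] at hst
  rw [← hst, map_add, hf s (left_ne_zero_of_mul h), hg t (right_ne_zero_of_mul h)]

theorem isHomog_one : IsHomog φ 1 0 := by
  classical
  intro d h
  rw [MvPowerSeries.coeff_one] at h
  split_ifs at h with hd
  · rw [hd, map_zero]
  · exact absurd rfl h

theorem IsHomog.pow {f : MvPowerSeries σ ℤ} {a : ℕ} (hf : IsHomog φ f a) (n : ℕ) :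
    IsHomog φ (f ^ n) (n * a) := by
  induction n with
  | zero => simpa using isHomog_one
  | succ n ih =>
    rw [pow_succ, Nat.succ_mul]
    exact ih.mul hf

theorem IsHomog.finsuppProd {ι : Type*} {v : ι → MvPowerSeries σ ℤ} {a : ι → ℕ}
    (h : ∀ i, IsHomog φ (v i) (a i)) (e : ι →₀ ℕ) :
    IsHomog φ (e.prod fun i n => v i ^ n) (e.sum fun i n => n * a i) := by
  rw [Finsupp.prod, Finsupp.sum]
  induction e.support using Finset.cons_induction with
  | empty => simpa using isHomog_one
  | cons k s hk ih =>
    rw [Finset.prod_cons, Finset.sum_cons]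
    exact ((h k).pow _).mul ih

end IsHomog

theorem isHomog_eProd (β : ℕ+ →₀ ℕ) : IsHomog Finsupp.degree (eProd β) (wtE β) :=
  IsHomog.finsuppProd (fun _ _ h => degree_of_coeff_eSuper_ne_zero h) β

theorem prod_lamVal_sumElim (β : ℕ+ →₀ ℕ) (δ : ℤ →₀ ℕ) :
    ((β.sumElim δ).prod fun s k => lamVal s ^ k) =
      eProd β * MvPowerSeries.monomial ((0 : ℤ →₀ ℕ).sumElim δ) 1 := by
  rw [Finsupp.prod_sumElim]
  congr 1
  have h : (0 : ℤ →₀ ℕ).sumElim δ = ∑ i ∈ δ.support, Finsupp.single (Sum.inr i) (δ i) := by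
    conv_lhs => rw [← Finsupp.sum_single δ]
    rw [Finsupp.sum, Finsupp.sumElim_eq_add, Finsupp.mapDomain_zero, zero_add,
      Finsupp.mapDomain_finsetSum]
    simp
  rw [h, ← Finset.prod_const_one (s := δ.support), ← MvPowerSeries.prod_monomial]
  refine Finset.prod_congr rfl fun i _ => ?_
  simp [lamVal, MvPowerSeries.X_pow_eq]

theorem sumElim_le_sumElim {σ τ : Type*} {x x' : σ →₀ ℕ} {y y' : τ →₀ ℕ} :
    x.sumElim y ≤ x'.sumElim y' ↔ x ≤ x' ∧ y ≤ y' := by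
  simp [Finsupp.le_def]

theorem sumElim_sub_sumElim {σ τ : Type*} {x x' : σ →₀ ℕ} {y y' : τ →₀ ℕ} :
    x.sumElim y - x'.sumElim y' = (x - x').sumElim (y - y') := by
  ext (i | i) <;> simp

theorem coeff_prod_lamVal (β : ℕ+ →₀ ℕ) (δ x γ : ℤ →₀ ℕ) :
    coeff (x.sumElim γ) ((β.sumElim δ).prod fun s k => lamVal s ^ k) =
      if δ ≤ γ then coeff (x.sumElim (γ - δ)) (eProd β) else 0 := by
  classical
  rw [prod_lamVal_sumElim, MvPowerSeries.coeff_mul_monomial]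
  refine if_congr ?_ ?_ rfl
  · rw [sumElim_le_sumElim]
    simp
  · rw [sumElim_sub_sumElim, tsub_zero, mul_one]

theorem coeff_realizeLam (g : LamHat) (d : ℤ ⊕ ℤ →₀ ℕ) :
    coeff d (realizeLam g) =
      finsum fun e => coeff e g * coeff d (e.prod fun s k => lamVal s ^ k) := by
  rw [realizeLam, MvPowerSeries.substAlgHom_apply, MvPowerSeries.coeff_subst hasSubst_lamVal]
  simp only [smul_eq_mul]

/-- The numbering of the elementary symmetric functions. -/
def finPNat (m : ℕ) : Fin m ↪ ℕ+ :=
  ⟨fun i => Nat.succPNat i, Nat.succPNat_injective.comp Fin.val_injective⟩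

theorem finPNat_coe {m : ℕ} (i : Fin m) : (finPNat m i : ℕ) = i + 1 := rfl

theorem coeff_eProd_embDomain {m : ℕ} (y : Fin m ↪ ℤ) (hy : ∀ j, y j ≤ 0) (u : Fin m →₀ ℕ)
    (b : Fin m →₀ ℕ) : coeff ((u.embDomain y).sumElim 0) (eProd (b.embDomain (finPNat m))) =
      MvPolynomial.coeff u (b.prod fun i n => MvPolynomial.esymm (Fin m) ℤ (i + 1) ^ n) := by
  have h : (u.embDomain y).sumElim (0 : ℤ →₀ ℕ) =
      u.embDomain (y.trans ⟨Sum.inl, Sum.inl_injective⟩) := by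
    rw [Finsupp.sumElim_eq_add, Finsupp.mapDomain_zero, add_zero, Finsupp.embDomain_eq_mapDomain,
      Finsupp.embDomain_eq_mapDomain, ← Finsupp.mapDomain_comp]
    rfl
  rw [h, ← MvPowerSeries.coeff_killCompl, eProd, Finsupp.prod_embDomain, ← MvPolynomial.coeff_coe,
    Finsupp.prod, Finsupp.prod, map_prod]
  congr 1
  rw [← MvPolynomial.coeToMvPowerSeries.ringHom_apply, map_prod]
  refine Finset.prod_congr rfl fun i _ => ?_
  rw [map_pow, killCompl_eSuper y hy, map_pow, MvPolynomial.coeToMvPowerSeries.ringHom_apply]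
  rfl

theorem exists_embDomain_finPNat {m : ℕ} {β : ℕ+ →₀ ℕ} (h : wtE β = m) :
    ∃ b : Fin m →₀ ℕ, b.embDomain (finPNat m) = β := by
  rw [← Set.mem_range, Finsupp.mem_range_embDomain_iff]
  intro k hk
  have h1 : β k * k ≤ wtE β := Finset.single_le_sum (f := fun k : ℕ+ => β k * (k : ℕ))
    (fun _ _ => Nat.zero_le _) hk
  have h2 : 1 ≤ β k := Nat.one_le_iff_ne_zero.2 (Finsupp.mem_support_iff.1 hk)
  have h3 : (k : ℕ) ≤ m := by nlinarith
  have h4 := k.pos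
  exact ⟨⟨k - 1, by omega⟩, PNat.eq (by rw [finPNat_coe]; simp only []; omega)⟩

/-- If `γ` is the only exponent of the a_i below `γ` that occurs in `g`, a coefficient at `γ` sees
only the a-free parts of the products of the e_k(x/a). By homogeneity only products of degree `m`
contribute at degree `m` in the x_i, so e_1, ..., e_m in `m` variables suffice. -/
theorem coeff_realizeLam_eq_coeff_aeval {m : ℕ} (y : Fin m ↪ ℤ) (hy : ∀ j, y j ≤ 0) (g : LamHat)
    (γ : ℤ →₀ ℕ) (u : Fin m →₀ ℕ) (hu : u.degree = m)
    (hg : ∀ β δ, δ ≤ γ → coeff (Finsupp.sumElim β δ) g ≠ 0 → δ = γ) (P : MvPolynomial (Fin m) ℤ)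
    (hP : ∀ b : Fin m →₀ ℕ, wtE (b.embDomain (finPNat m)) = m →
      P.coeff b = coeff ((b.embDomain (finPNat m)).sumElim γ) g) :
    coeff ((u.embDomain y).sumElim γ) (realizeLam g) =
      (MvPolynomial.aeval (fun i : Fin m => MvPolynomial.esymm (Fin m) ℤ (i + 1)) P).coeff u := by
  classical
  have hdeg : ∀ β, coeff ((u.embDomain y).sumElim 0) (eProd β) ≠ 0 → wtE β = m := by
    intro β h
    rw [← isHomog_eProd β _ h, degree_sumElim, degree_embDomain, hu, map_zero, add_zero]
  have hinj : Function.Injective fun b : Fin m →₀ ℕ =>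
      (b.embDomain (finPNat m)).sumElim γ := by
    intro b b' h
    have := congrArg (Finsupp.comapDomain Sum.inl · Sum.inl_injective.injOn) h
    simp only [Finsupp.comapDomain_inl_sumElim] at this
    exact Finsupp.embDomain_injective _ this
  rw [coeff_realizeLam, finsum_eq_sum_of_support_subset
    (s := P.support.image fun b => (b.embDomain (finPNat m)).sumElim γ),
    Finset.sum_image hinj.injOn]
  · rw [MvPolynomial.aeval_def, MvPolynomial.eval₂_eq, MvPolynomial.coeff_sum]
    refine Finset.sum_congr rfl fun b _ => ?_
    rw [coeff_prod_lamVal, if_pos le_rfl, tsub_self, MvPolynomial.algebraMap_eq,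
      MvPolynomial.coeff_C_mul]
    have h1 := coeff_eProd_embDomain y hy u b
    rw [Finsupp.prod] at h1
    rw [← h1]
    by_cases h : wtE (b.embDomain (finPNat m)) = m
    · rw [hP b h]
    · rw [not_ne_iff.1 (mt (hdeg _) h), mul_zero, mul_zero]
  · intro e he
    rw [Function.mem_support] at he
    obtain ⟨⟨β, δ⟩, rfl⟩ := Finsupp.sumFinsuppEquivProdFinsupp.symm.surjective e
    change coeff (Finsupp.sumElim β δ) g * coeff _ ((Finsupp.sumElim β δ).prod _) ≠ 0 at he
    change Finsupp.sumElim β δ ∈ _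
    rw [coeff_prod_lamVal] at he
    split_ifs at he with hle
    · obtain rfl := hg β δ hle (left_ne_zero_of_mul he)
      have h2 := right_ne_zero_of_mul he
      rw [tsub_self] at h2
      obtain ⟨b, rfl⟩ := exists_embDomain_finPNat (hdeg _ h2)
      rw [Finset.mem_coe, Finset.mem_image]
      refine ⟨b, ?_, rfl⟩
      rw [MvPolynomial.mem_support_iff, hP b (hdeg _ h2)]
      exact left_ne_zero_of_mul he
    · simp at he

/-! ### Injectivity of the realization -/

theorem coeff_realizeLam_eq_zero {g : LamHat} {γ : ℤ →₀ ℕ} (x : ℤ →₀ ℕ)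
    (h : ∀ β δ, δ ≤ γ → coeff (Finsupp.sumElim β δ) g = 0) :
    coeff (x.sumElim γ) (realizeLam g) = 0 := by
  rw [coeff_realizeLam]
  refine finsum_eq_zero_of_forall_eq_zero fun e => ?_
  obtain ⟨⟨β, δ⟩, rfl⟩ := Finsupp.sumFinsuppEquivProdFinsupp.symm.surjective e
  change coeff (Finsupp.sumElim β δ) g * coeff _ ((Finsupp.sumElim β δ).prod _) = 0
  rw [coeff_prod_lamVal]
  split_ifs with hle
  · rw [h β δ hle, zero_mul]
  · rw [mul_zero]

theorem exists_mvPolynomial_coeff {σ : Type*} {s : Set (σ →₀ ℕ)} (hs : s.Finite)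
    (c : (σ →₀ ℕ) → ℤ) : ∃ P : MvPolynomial σ ℤ, (∀ b ∈ s, P.coeff b = c b) ∧
      ∀ b ∉ s, P.coeff b = 0 := by
  classical
  have h : ∀ b, (∑ b ∈ hs.toFinset, MvPolynomial.monomial b (c b)).coeff b =
      if b ∈ s then c b else 0 := by
    intro b
    simp [MvPolynomial.coeff_sum, MvPolynomial.coeff_monomial]
  exact ⟨_, fun b hb => (h b).trans (if_pos hb), fun b hb => (h b).trans (if_neg hb)⟩

theorem finite_wtE (m : ℕ) :
    {b : Fin m →₀ ℕ | wtE (b.embDomain (finPNat m)) = m}.Finite := by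
  refine (Set.finite_Iic (Finsupp.equivFunOnFinite.symm fun _ : Fin m => m)).subset ?_
  intro b hb i
  by_cases hi : b i = 0
  · rw [hi]
    exact Nat.zero_le _
  have h1 : b i * finPNat m i ≤ wtE (b.embDomain (finPNat m)) := by
    rw [wtE, Finsupp.sum_embDomain]
    exact Finset.single_le_sum (f := fun i => b i * (finPNat m i : ℕ))
      (fun _ _ => Nat.zero_le _) (Finsupp.mem_support_iff.2 hi)
  rw [Set.mem_ofPred_eq] at hb
  rw [hb, finPNat_coe] at h1
  change b i ≤ m
  nlinarith

/-- The first `m` nonpositive integers, in decreasing order. -/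
def negEmb (m : ℕ) : Fin m ↪ ℤ := ⟨fun j => -j, fun i j h => Fin.ext (by simpa using h)⟩

theorem negEmb_apply {m : ℕ} (j : Fin m) : negEmb m j = -j := rfl

theorem negEmb_nonpos {m : ℕ} (j : Fin m) : negEmb m j ≤ 0 := by
  rw [negEmb_apply]
  omega

theorem degree_of_coeff_aeval_esymm {m : ℕ} {P : MvPolynomial (Fin m) ℤ}
    (hP : ∀ b : Fin m →₀ ℕ, wtE (b.embDomain (finPNat m)) ≠ m → P.coeff b = 0) {u : Fin m →₀ ℕ}
    (hu : (MvPolynomial.aeval (fun i : Fin m => MvPolynomial.esymm (Fin m) ℤ (i + 1)) P).coeff u ≠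
      0) : u.degree = m := by
  rw [MvPolynomial.aeval_def, MvPolynomial.eval₂_eq, MvPolynomial.coeff_sum] at hu
  obtain ⟨b, hb, h⟩ := Finset.exists_ne_zero_of_sum_ne_zero hu
  rw [MvPolynomial.algebraMap_eq, MvPolynomial.coeff_C_mul] at h
  have h1 := left_ne_zero_of_mul h
  have h2 := right_ne_zero_of_mul h
  have h3 := coeff_eProd_embDomain (negEmb m) negEmb_nonpos u b
  rw [Finsupp.prod] at h3
  rw [← h3] at h2
  have h4 := isHomog_eProd _ _ h2
  rw [degree_sumElim, degree_embDomain, map_zero, add_zero] at h4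
  rw [h4]
  exact not_ne_iff.1 (mt (hP b) h1)

/-- The evaluation of polynomials in the `x_i` over `Λ̂(x‖a)`. -/
def realizePoly : MvPolynomial ℤ LamHat →+* Series :=
  MvPolynomial.eval₂Hom (realizeLam : LamHat →+* Series) fun i => MvPowerSeries.X (Sum.inl i)

theorem coeff_realizePoly (f : MvPolynomial ℤ LamHat) (x γ : ℤ →₀ ℕ) :
    coeff (x.sumElim γ) (realizePoly f) = ∑ α ∈ f.support,
      if α ≤ x then coeff ((x - α).sumElim γ) (realizeLam (f.coeff α)) else 0 := by
  classical
  rw [realizePoly, MvPolynomial.coe_eval₂Hom, MvPolynomial.eval₂_eq, map_sum]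
  refine Finset.sum_congr rfl fun α _ => ?_
  have h : (∏ i ∈ α.support, (MvPowerSeries.X (Sum.inl i) : Series) ^ α i) =
      MvPowerSeries.monomial (α.sumElim (0 : ℤ →₀ ℕ)) 1 := by
    have h : α.sumElim (0 : ℤ →₀ ℕ) = ∑ i ∈ α.support, Finsupp.single (Sum.inl i) (α i) := by
      conv_lhs => rw [← Finsupp.sum_single α]
      rw [Finsupp.sum, Finsupp.sumElim_eq_add, Finsupp.mapDomain_zero, add_zero,
        Finsupp.mapDomain_finsetSum]
      simp
    rw [h, ← Finset.prod_const_one (s := α.support), ← MvPowerSeries.prod_monomial]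
    refine Finset.prod_congr rfl fun i _ => ?_
    simp [MvPowerSeries.X_pow_eq]
  rw [h, MvPowerSeries.coeff_mul_monomial]
  refine if_congr ?_ ?_ rfl
  · rw [sumElim_le_sumElim]
    simp
  · rw [sumElim_sub_sumElim, tsub_zero, mul_one]
    rfl

theorem eq_of_le_of_degree_le {σ : Type*} {x y : σ →₀ ℕ} (h : x ≤ y) (h' : y.degree ≤ x.degree) :
    x = y := by
  obtain ⟨z, rfl⟩ := exists_add_of_le h
  rw [map_add] at h'
  rw [(Finsupp.degree_eq_zero_iff z).1 (by omega), add_zero]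

/-- A leading part of a nonzero `f` is isolated and becomes a polynomial relation between elementary
symmetric polynomials in variables that `f` does not adjoin explicitly; such relations are trivial.
-/
theorem realizePoly_injective : Function.Injective realizePoly := by
  classical
  rw [injective_iff_map_eq_zero]
  intro f hf
  by_contra hne
  set S : Set (ℤ →₀ ℕ) := {γ | ∃ α β, coeff (Finsupp.sumElim β γ) (f.coeff α) ≠ 0} with hS
  have hSne : S.Nonempty := by
    obtain ⟨α, hα⟩ := MvPolynomial.ne_zero_iff.1 hne
    obtain ⟨e, he⟩ := (MvPowerSeries.ne_zero_iff_exists_coeff_ne_zero _).1 hα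
    obtain ⟨⟨β, δ⟩, rfl⟩ := Finsupp.sumFinsuppEquivProdFinsupp.symm.surjective e
    exact ⟨δ, α, β, he⟩
  -- `γ` is an exponent of the a_i of least degree in `f`; among the terms with this `γ`, the
  -- exponent `α` of the adjoined x_i is then taken of least degree.
  obtain ⟨γ, ⟨α₁, β₁, h₁⟩, hγ⟩ := (measure (Finsupp.degree : (ℤ →₀ ℕ) → ℕ)).wf.has_min S hSne
  obtain ⟨α, ⟨β, hβ⟩, hα⟩ := (measure (Finsupp.degree : (ℤ →₀ ℕ) → ℕ)).wf.has_min
    {α | ∃ β, coeff (Finsupp.sumElim β γ) (f.coeff α) ≠ 0} ⟨α₁, β₁, h₁⟩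
  have hγ' : ∀ α β δ, δ ≤ γ → coeff (Finsupp.sumElim β δ) (f.coeff α) ≠ 0 → δ = γ := by
    intro α β δ hle h
    exact eq_of_le_of_degree_le hle (not_lt.1 (hγ δ ⟨α, β, h⟩))
  have hα' : ∀ α', α' ≤ α → α' ≠ α → ∀ β, coeff (Finsupp.sumElim β γ) (f.coeff α') = 0 := by
    intro α' hle hne β
    by_contra h
    exact hne (eq_of_le_of_degree_le hle (not_lt.1 (hα α' ⟨β, h⟩)))
  obtain ⟨m, hm⟩ : ∃ m, wtE β = m := ⟨_, rfl⟩
  -- The x_i with i ≤ 0 occur both in the e_k and as adjoined variables. Indices far to the left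
  -- separate the two roles.
  obtain ⟨y, hy, hfresh⟩ : ∃ y : Fin m ↪ ℤ, (∀ j, y j ≤ 0) ∧
      ∀ α' ∈ f.support, ∀ j, α' (y j) = 0 := by
    set T : Finset ℤ := f.support.biUnion Finsupp.support with hT
    refine ⟨⟨fun j => -(T.sum Int.natAbs + 1 + j : ℕ), fun i j h => Fin.ext ?_⟩, fun j => ?_,
      fun α' h j => ?_⟩
    · simpa using h
    · change -((_ : ℕ) : ℤ) ≤ 0
      omega
    · by_contra hc
      have h1 : (-(T.sum Int.natAbs + 1 + j : ℕ) : ℤ) ∈ T :=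
        Finset.mem_biUnion.2 ⟨α', h, Finsupp.mem_support_iff.2 hc⟩
      have h2 := Finset.single_le_sum (f := Int.natAbs) (fun _ _ => Nat.zero_le _) h1
      rw [Int.natAbs_neg, Int.natAbs_natCast] at h2
      change _ ≤ T.sum Int.natAbs at h2
      omega
  obtain ⟨P, hP, hP'⟩ := exists_mvPolynomial_coeff (finite_wtE m)
    fun b => coeff ((b.embDomain (finPNat m)).sumElim γ) (f.coeff α)
  -- The coefficient of `f` is taken at `α` plus an exponent in the fresh variables. Another
  -- contributing `α'` would satisfy `α' ≤ α` by freshness, which the choice of `α` excludes.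
  have hQ : MvPolynomial.aeval (fun i : Fin m => MvPolynomial.esymm (Fin m) ℤ (i + 1)) P = 0 := by
    ext u
    rw [MvPolynomial.coeff_zero]
    by_contra hu
    have hdeg := degree_of_coeff_aeval_esymm hP' hu
    rw [← coeff_realizeLam_eq_coeff_aeval y hy (f.coeff α) γ u hdeg (hγ' α) P hP] at hu
    have h := congrArg (coeff ((α + u.embDomain y).sumElim γ)) hf
    rw [coeff_realizePoly, map_zero, Finset.sum_eq_single α, if_pos le_self_add,
      add_tsub_cancel_left] at h
    · exact hu h
    · intro α' hα1 hα2
      split_ifs with hle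
      · have hle' : α' ≤ α := by
          intro i
          by_cases hi : i ∈ Set.range y
          · obtain ⟨j, rfl⟩ := hi
            rw [hfresh α' hα1 j]
            exact Nat.zero_le _
          · have := hle i
            rwa [Finsupp.add_apply, Finsupp.embDomain_of_notMem_range _ _ _ hi, add_zero] at this
        refine coeff_realizeLam_eq_zero _ fun β δ hδ => ?_
        by_contra hc
        obtain rfl := hγ' _ _ _ hδ hc
        exact hc (hα' α' hle' hα2 β)
      · rfl
    · intro hn
      rw [MvPolynomial.notMem_support_iff.1 hn, map_zero, map_zero, ite_self]
  have hP0 : P = 0 := by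
    refine MvPolynomial.esymmAlgHom_fin_injective ℤ (le_refl m) (Subtype.ext ?_)
    rw [MvPolynomial.esymmAlgHom_apply, hQ, map_zero]
    rfl
  obtain ⟨b, rfl⟩ := exists_embDomain_finPNat hm
  refine hβ ?_
  rw [← hP b hm, hP0, MvPolynomial.coeff_zero]

theorem realize_ofPoly (f : MvPolynomial ℤ LamHat) : realize (BackRing.ofPoly f) = realizePoly f :=
  IsLocalization.lift_eq _ _

theorem realize_injective : Function.Injective realize := by
  rw [realize, IsLocalization.lift_injective_iff]
  intro x y
  refine ⟨fun h => ?_, fun h => congrArg _ (realizePoly_injective h)⟩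
  have := congrArg realize h
  exact (realize_ofPoly x).symm.trans (this.trans (realize_ofPoly y))

theorem realize_algebraMap (g : LamHat) :
    realize (algebraMap LamHat BackRing g) = realizeLam g := by
  rw [IsScalarTower.algebraMap_apply LamHat (MvPolynomial ℤ LamHat) BackRing]
  exact (realize_ofPoly _).trans (MvPolynomial.eval₂Hom_C _ _ _)

/-! ### The image of the realization -/

/-- The permutation of the variables of `Series` that exchanges `x_i` and `x_{i+1}`. -/
def swapX (i : ℤ) : (ℤ ⊕ ℤ) ↪ (ℤ ⊕ ℤ) :=
  ((Equiv.swap i (i + 1)).sumCongr (Equiv.refl ℤ)).toEmbedding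

theorem swapX_inl (i j : ℤ) : swapX i (Sum.inl j) = Sum.inl (Equiv.swap i (i + 1) j) := rfl

theorem swapX_inr (i j : ℤ) : swapX i (Sum.inr j) = Sum.inr j := rfl

theorem embDomain_swapX_inl (i j : ℤ) (d : ℤ ⊕ ℤ →₀ ℕ) :
    d.embDomain (swapX i) (Sum.inl j) = d (Sum.inl (Equiv.swap i (i + 1) j)) := by
  rw [← Finsupp.embDomain_apply_self (swapX i) d, swapX_inl, Equiv.swap_apply_self]

theorem embDomain_swapX_inr (i j : ℤ) (d : ℤ ⊕ ℤ →₀ ℕ) :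
    d.embDomain (swapX i) (Sum.inr j) = d (Sum.inr j) := by
  rw [← Finsupp.embDomain_apply_self (swapX i) d, swapX_inr]

theorem swap_nonpos_iff {i : ℤ} (hi : i < 0) (j : ℤ) : 0 < Equiv.swap i (i + 1) j ↔ 0 < j := by
  rw [Equiv.swap_apply_def]
  split_ifs <;> omega

/-- The series does not involve `x_i` for `i > 0` and is symmetric in the `x_i`, `i ≤ 0`. -/
structure IsBackSymm (f : Series) : Prop where
  nonpos : ∀ i > 0, IsHomog (Finsupp.applyAddHom (Sum.inl i)) f 0
  symm : ∀ i < 0, MvPowerSeries.killCompl (swapX i) f = f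

theorem IsBackSymm.coeff_embDomain {f : Series} (h : IsBackSymm f) {i : ℤ} (hi : i < 0)
    (d : ℤ ⊕ ℤ →₀ ℕ) : coeff (d.embDomain (swapX i)) f = coeff d f := by
  rw [← MvPowerSeries.coeff_killCompl, h.symm i hi]

theorem IsBackSymm.sub {f g : Series} (hf : IsBackSymm f) (hg : IsBackSymm g) :
    IsBackSymm (f - g) where
  nonpos i hi d h := by
    by_contra hc
    refine h ?_
    rw [map_sub, not_ne_iff.1 (mt (hf.nonpos i hi d) hc), not_ne_iff.1 (mt (hg.nonpos i hi d) hc),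
      sub_zero]
  symm i hi := by rw [map_sub, hf.symm i hi, hg.symm i hi]

theorem killCompl_swapX_eX {i : ℤ} (hi : i < 0) (k : ℕ) :
    MvPowerSeries.killCompl (swapX i) (eX k) = eX k := by
  classical
  ext d
  rw [MvPowerSeries.coeff_killCompl, MvPowerSeries.coeff_apply, MvPowerSeries.coeff_apply, eX, eX,
    degree_embDomain]
  simp only [embDomain_swapX_inl, embDomain_swapX_inr]
  refine if_congr (and_congr_right fun _ => and_congr_right fun _ => and_congr ?_ ?_) rfl rfl
  · refine (Equiv.swap i (i + 1)).forall_congr fun j => ?_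
    rw [gt_iff_lt, gt_iff_lt, swap_nonpos_iff hi]
  · exact (Equiv.swap i (i + 1)).forall_congr fun j => Iff.rfl

theorem killCompl_swapX_hA (i : ℤ) (k : ℕ) :
    MvPowerSeries.killCompl (swapX i) (hA k) = hA k := by
  classical
  ext d
  rw [MvPowerSeries.coeff_killCompl, MvPowerSeries.coeff_apply, MvPowerSeries.coeff_apply, hA, hA,
    degree_embDomain]
  simp only [embDomain_swapX_inl, embDomain_swapX_inr]
  refine if_congr (and_congr_right fun _ => and_congr_left fun _ => ?_) rfl rfl
  exact (Equiv.swap i (i + 1)).forall_congr fun j => Iff.rfl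

theorem killCompl_swapX_lamVal {i : ℤ} (hi : i < 0) (s : ℕ+ ⊕ ℤ) :
    MvPowerSeries.killCompl (swapX i) (lamVal s) = lamVal s := by
  rcases s with k | j
  · simp only [lamVal, eSuper, map_sum, map_mul, map_pow, map_neg, map_one, killCompl_swapX_hA,
      killCompl_swapX_eX hi]
  · have := MvPowerSeries.killCompl_X (R := ℤ) (e := swapX i) (Sum.inr j)
    rwa [swapX_inr] at this

theorem isHomog_eX {i : ℤ} (hi : 0 < i) (k : ℕ) :
    IsHomog (Finsupp.applyAddHom (Sum.inl i)) (eX k) 0 := by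
  intro d h
  rw [MvPowerSeries.coeff_apply, eX] at h
  split_ifs at h with hd
  · exact hd.2.2.1 i hi
  · exact absurd rfl h

theorem isHomog_hA (i : ℤ) (k : ℕ) : IsHomog (Finsupp.applyAddHom (Sum.inl i)) (hA k) 0 := by
  intro d h
  rw [MvPowerSeries.coeff_apply, hA] at h
  split_ifs at h with hd
  · exact hd.2.1 i
  · exact absurd rfl h

theorem isHomog_lamVal {i : ℤ} (hi : 0 < i) (s : ℕ+ ⊕ ℤ) :
    IsHomog (Finsupp.applyAddHom (Sum.inl i)) (lamVal s) 0 := by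
  classical
  rcases s with k | j
  · intro d h
    rw [lamVal, eSuper, map_sum] at h
    obtain ⟨l, hl, h⟩ := Finset.exists_ne_zero_of_sum_ne_zero h
    have hc : ((-1) ^ l * eX (k - l) * hA l : Series) =
        MvPowerSeries.C ((-1) ^ l) * (eX (k - l) * hA l) := by
      rw [mul_assoc]; simp
    rw [hc, MvPowerSeries.coeff_C_mul] at h
    exact ((isHomog_eX hi _).mul (isHomog_hA i _)) d (right_ne_zero_of_mul h)
  · intro d h
    rw [lamVal, MvPowerSeries.coeff_X] at h
    split_ifs at h with hd
    · rw [hd]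
      simp
    · exact absurd rfl h

theorem isBackSymm_realizeLam (g : LamHat) : IsBackSymm (realizeLam g) where
  nonpos i hi d h := by
    by_contra hc
    refine h ?_
    rw [coeff_realizeLam]
    refine finsum_eq_zero_of_forall_eq_zero fun e => ?_
    have := IsHomog.finsuppProd (isHomog_lamVal hi) e
    simp only [mul_zero, Finsupp.sum_fun_zero] at this
    rw [not_ne_iff.1 (mt (this d) hc), mul_zero]
  symm i hi := by
    ext d
    rw [MvPowerSeries.coeff_killCompl, coeff_realizeLam, coeff_realizeLam]
    refine finsum_congr fun e => ?_
    rw [← MvPowerSeries.coeff_killCompl, Finsupp.prod, map_prod]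
    simp only [map_pow, killCompl_swapX_lamVal hi]

theorem embDomain_swapX_sumElim (i : ℤ) (x γ : ℤ →₀ ℕ) :
    (x.sumElim γ).embDomain (swapX i) =
      (x.embDomain (Equiv.swap i (i + 1)).toEmbedding).sumElim γ := by
  ext (j | j)
  · rw [embDomain_swapX_inl, Finsupp.sumElim_inl, Finsupp.sumElim_inl]
    conv_rhs => rw [← Equiv.swap_apply_self i (i + 1) j]
    exact (Finsupp.embDomain_apply_self (Equiv.swap i (i + 1)).toEmbedding x _).symm
  · rw [embDomain_swapX_inr]
    rfl

/-- A series that is symmetric in the `x_i`, `i ≤ 0`, vanishes if its coefficients at the monomials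
in few of these variables vanish. -/
theorem IsBackSymm.coeff_eq_zero {f : Series} (hf : IsBackSymm f) {γ : ℤ →₀ ℕ} {m : ℕ}
    (h : ∀ u : Fin m →₀ ℕ, u.degree = m → coeff ((u.embDomain (negEmb m)).sumElim γ) f = 0)
    (x : ℤ →₀ ℕ) (hx : x.degree = m) : coeff (x.sumElim γ) f = 0 := by
  induction hN : (x.sum fun i n => n * i.natAbs) using Nat.strong_induction_on generalizing x with
  | _ N ih =>
    by_contra hc
    have hpos : ∀ i > 0, x i = 0 := fun i hi => hf.nonpos i hi _ hc
    -- Moving an exponent from `i` into the gap at `i + 1` is a symmetry and lowers the sum of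
    -- exponents times |i|.
    by_cases hstep : ∃ i < 0, x i ≠ 0 ∧ x (i + 1) = 0
    · obtain ⟨i, hi, h1, h2⟩ := hstep
      refine hc ?_
      rw [← hf.coeff_embDomain hi, embDomain_swapX_sumElim]
      refine ih _ ?_ _ (by rw [degree_embDomain, hx]) rfl
      rw [← hN, Finsupp.sum_embDomain]
      refine Finset.sum_lt_sum (fun j hj => ?_) ⟨i, Finsupp.mem_support_iff.2 h1, ?_⟩
      · refine Nat.mul_le_mul_left _ ?_
        rw [Equiv.coe_toEmbedding, Equiv.swap_apply_def]
        split_ifs with e1 e2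
        · omega
        · rw [e2] at hj
          exact absurd h2 (Finsupp.mem_support_iff.1 hj)
        · exact le_rfl
      · refine Nat.mul_lt_mul_of_pos_left ?_ (Nat.pos_of_ne_zero h1)
        rw [Equiv.coe_toEmbedding, Equiv.swap_apply_left]
        omega
    · push Not at hstep
      -- Without gaps the support reaches from its smallest index up to 0, so its size, at most the
      -- degree `m`, confines it to the first `m` nonpositive indices.
      have hdown : ∀ (k : ℕ) (i : ℤ), i + k ≤ 0 → x i ≠ 0 → x (i + k) ≠ 0 := by
        intro k
        induction k with
        | zero => intro i _ h; simpa using h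
        | succ k ihk =>
          intro i hi h
          have := hstep (i + k) (by push_cast at hi; omega) (ihk i (by push_cast at hi; omega) h)
          rwa [Nat.cast_succ, ← add_assoc]
      obtain ⟨u, rfl⟩ : ∃ u : Fin m →₀ ℕ, u.embDomain (negEmb m) = x := by
        rw [← Set.mem_range, Finsupp.mem_range_embDomain_iff]
        intro i hi
        rw [Finset.mem_coe, Finsupp.mem_support_iff] at hi
        have hi0 : i ≤ 0 := by
          by_contra hlt
          exact hi (hpos i (not_le.1 hlt))
        have hsub : Finset.Icc i 0 ⊆ x.support := by
          intro j hj
          rw [Finset.mem_Icc] at hj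
          rw [Finsupp.mem_support_iff]
          have := hdown (j - i).toNat i (by omega) hi
          rwa [show i + ((j - i).toNat : ℤ) = j by omega] at this
        have h1 := Finset.card_le_card hsub
        have h2 : x.support.card ≤ x.degree := by
          rw [Finset.card_eq_sum_ones, Finsupp.degree_apply]
          exact Finset.sum_le_sum fun j hj =>
            Nat.one_le_iff_ne_zero.2 (Finsupp.mem_support_iff.1 hj)
        rw [Int.card_Icc] at h1
        refine ⟨⟨(-i).toNat, by omega⟩, ?_⟩
        rw [negEmb_apply]
        simp only []
        omega
      rw [degree_embDomain] at hx
      exact hc (h u hx)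

theorem isSymmetric_of_adjacent {m : ℕ} {Q : MvPolynomial (Fin m) ℤ}
    (h : ∀ (i j : Fin m), (j : ℕ) = i + 1 → MvPolynomial.rename (Equiv.swap i j) Q = Q) :
    Q.IsSymmetric := by
  rcases m with _ | m
  · intro e
    rw [Subsingleton.elim e 1]
    exact MvPolynomial.rename_id_apply Q
  intro e
  have he : e ∈ Submonoid.closure (Set.range fun i : Fin m => Equiv.swap i.castSucc i.succ) := by
    rw [Equiv.Perm.mclosure_swap_castSucc_succ]
    trivial
  induction he using Submonoid.closure_induction with
  | mem _ h' =>
    obtain ⟨i, rfl⟩ := h'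
    exact h _ _ (by simp)
  | one => exact MvPolynomial.rename_id_apply Q
  | mul a b _ _ ha hb =>
    rw [Equiv.Perm.coe_mul, ← MvPolynomial.rename_rename, hb, ha]

/-- The part of degree `m` in the first `m` variables is a symmetric polynomial, hence a polynomial
in e_1, ..., e_m. -/
theorem IsBackSymm.exists_mvPolynomial {f : Series} (hf : IsBackSymm f) (γ : ℤ →₀ ℕ) (m : ℕ) :
    ∃ P : MvPolynomial (Fin m) ℤ, ∀ u : Fin m →₀ ℕ, u.degree = m →
      (MvPolynomial.aeval (fun i : Fin m => MvPolynomial.esymm (Fin m) ℤ (i + 1)) P).coeff u =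
        coeff ((u.embDomain (negEmb m)).sumElim γ) f := by
  have hfin : {u : Fin m →₀ ℕ | u.degree = m}.Finite := by
    refine (Set.finite_Iic (Finsupp.equivFunOnFinite.symm fun _ : Fin m => m)).subset ?_
    intro u hu i
    exact (Finsupp.le_degree i u).trans (Set.mem_ofPred_eq.mp hu).le
  obtain ⟨Q, hQ, hQ'⟩ := exists_mvPolynomial_coeff hfin
    fun u => coeff ((u.embDomain (negEmb m)).sumElim γ) f
  have hsymm : Q.IsSymmetric := by
    refine isSymmetric_of_adjacent fun i j hij => ?_
    ext u
    obtain ⟨v, rfl⟩ : ∃ v : Fin m →₀ ℕ, v.mapDomain (Equiv.swap i j) = u :=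
      ⟨u.mapDomain (Equiv.swap i j), by
        rw [← Finsupp.mapDomain_comp]
        have : (Equiv.swap i j : Fin m → Fin m) ∘ Equiv.swap i j = id := by
          funext k
          simp
        rw [this, Finsupp.mapDomain_id]⟩
    rw [MvPolynomial.coeff_rename_mapDomain _ (Equiv.swap i j).injective]
    by_cases hv : v.degree = m
    · rw [hQ v hv, hQ _ (by rw [Set.mem_ofPred_eq, Finsupp.degree_mapDomain, hv])]
      have hlt : (-(j : ℕ) : ℤ) < 0 := by omega
      rw [← hf.coeff_embDomain hlt, embDomain_swapX_sumElim]
      congr 2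
      simp only [Finsupp.embDomain_eq_mapDomain, ← Finsupp.mapDomain_comp]
      refine congrArg (fun h => (Finsupp.mapDomain h v).sumElim γ) (funext fun k => ?_)
      simp only [Function.comp_apply, Equiv.coe_toEmbedding, negEmb_apply, Equiv.swap_apply_def,
        Fin.ext_iff]
      split_ifs <;> omega
    · rw [hQ' v hv, hQ' _ (by rw [Set.mem_ofPred_eq, Finsupp.degree_mapDomain]; exact hv)]
  obtain ⟨P, hP⟩ := MvPolynomial.esymmAlgHom_fin_surjective ℤ (le_refl m) ⟨Q, hsymm⟩
  refine ⟨P, fun u hu => ?_⟩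
  rw [← MvPolynomial.esymmAlgHom_apply, hP]
  exact hQ u hu

/-- The coefficients at the monomials of degree less than `N` in the `a_i` vanish. -/
def VanishesBelow (N : ℕ) (f : Series) : Prop :=
  ∀ x γ : ℤ →₀ ℕ, γ.degree < N → coeff (x.sumElim γ) f = 0

/-- Modulo higher degree in the a_i, each e_k(x/a) is the ordinary e_k(x). So the part of lowest
a-degree `N` can be matched using classical symmetric polynomials. -/
theorem IsBackSymm.exists_approx {f : Series} {N : ℕ} (hf : IsBackSymm f)
    (hN : VanishesBelow N f) : ∃ g : LamHat, VanishesBelow (N + 1) (f - realizeLam g) ∧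
      ∀ β γ, coeff (Finsupp.sumElim β γ) g ≠ 0 → γ.degree = N := by
  classical
  choose P hP using hf.exists_mvPolynomial
  -- The coefficient at a product of degree d = `wtE β` is read off from the expression found in d
  -- variables.
  let c : (ℤ →₀ ℕ) → (ℕ+ →₀ ℕ) → ℤ := fun γ β =>
    (P γ (wtE β)).coeff (β.comapDomain (finPNat _) (finPNat _).injective.injOn)
  have hc : ∀ γ m β (b : Fin m →₀ ℕ), wtE β = m → β = b.embDomain (finPNat m) →
      (P γ m).coeff b = c γ β := by
    rintro γ _ β b rfl h
    refine congrArg (fun b => (P γ _).coeff b) (Finsupp.ext fun i => ?_)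
    rw [Finsupp.comapDomain_apply, DFunLike.congr_fun h (finPNat _ i),
      Finsupp.embDomain_apply_self]
  let g : LamHat := fun e =>
    if (e.comapDomain Sum.inr Sum.inr_injective.injOn).degree = N then
      c (e.comapDomain Sum.inr Sum.inr_injective.injOn)
        (e.comapDomain Sum.inl Sum.inl_injective.injOn)
    else 0
  have hcoeff : ∀ β γ, coeff (Finsupp.sumElim β γ) g = if γ.degree = N then c γ β else 0 := by
    intro β γ
    rw [MvPowerSeries.coeff_apply]
    simp only [g, Finsupp.comapDomain_inl_sumElim, Finsupp.comapDomain_inr_sumElim]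
  have hgN : ∀ β γ, coeff (Finsupp.sumElim β γ) g ≠ 0 → γ.degree = N := by
    intro β γ h
    rw [hcoeff] at h
    by_contra hc
    exact h (if_neg hc)
  refine ⟨g, fun x γ hγ => ?_, hgN⟩
  refine (hf.sub (isBackSymm_realizeLam g)).coeff_eq_zero (m := x.degree) (fun u hu => ?_) x rfl
  rw [map_sub]
  rcases (Nat.lt_succ_iff.1 hγ).lt_or_eq with hlt | heq
  · rw [hN _ _ hlt, coeff_realizeLam_eq_zero, sub_zero]
    intro β δ hδ
    by_contra hc
    have h1 := hgN _ _ hc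
    have h2 := Finsupp.degree_mono hδ
    omega
  · rw [coeff_realizeLam_eq_coeff_aeval (negEmb _) negEmb_nonpos g γ u hu _ (P γ x.degree),
      hP γ _ u hu, sub_self]
    · intro b hb
      rw [hcoeff, if_pos heq]
      exact hc γ _ _ b hb rfl
    · intro β δ hδ hc
      exact eq_of_le_of_degree_le hδ (by rw [hgN _ _ hc, heq])

/-- The approximation is iterated. The successive corrections are homogeneous of different degrees
in the a_i, so their infinite sum is a well-defined power series. -/
theorem IsBackSymm.exists_realizeLam {f : Series} (hf : IsBackSymm f) :
    ∃ g : LamHat, realizeLam g = f := by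
  classical
  have step : ∀ (N : ℕ) (F : {F : Series // IsBackSymm F ∧ VanishesBelow N F}),
      ∃ g : LamHat, VanishesBelow (N + 1) (F - realizeLam g) ∧
        ∀ β γ, coeff (Finsupp.sumElim β γ) g ≠ 0 → γ.degree = N :=
    fun N F => F.2.1.exists_approx F.2.2
  choose G hG hG' using step
  let S : (N : ℕ) → {F : Series // IsBackSymm F ∧ VanishesBelow N F} := fun N =>
    Nat.rec ⟨f, hf, fun _ _ h => absurd h (Nat.not_lt_zero _)⟩
      (fun N F => ⟨F - realizeLam (G N F), F.2.1.sub (isBackSymm_realizeLam _), hG N F⟩) N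
  have hS : ∀ N, (S (N + 1)).1 = (S N).1 - realizeLam (G N (S N)) := fun N => rfl
  let c : (ℕ+ ⊕ ℤ →₀ ℕ) → ℕ → ℤ := fun e N => coeff e (G N (S N))
  -- A coefficient of a-degree N is taken from the N-th correction, the only one that contributes to
  -- it.
  let g : LamHat := fun e => c e (e.comapDomain Sum.inr Sum.inr_injective.injOn).degree
  have hg : ∀ β γ, coeff (Finsupp.sumElim β γ) g =
      coeff (Finsupp.sumElim β γ) (G γ.degree (S γ.degree)) := by
    intro β γ
    exact congrArg (c _) (congrArg Finsupp.degree (Finsupp.comapDomain_inr_sumElim β γ))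
  refine ⟨g, MvPowerSeries.ext fun d => ?_⟩
  obtain ⟨⟨x, γ⟩, rfl⟩ := Finsupp.sumFinsuppEquivProdFinsupp.symm.surjective d
  change coeff (Finsupp.sumElim x γ) _ = coeff (Finsupp.sumElim x γ) _
  set M := γ.degree with hM
  set gM : LamHat := ∑ N ∈ Finset.range (M + 1), G N (S N) with hgM
  have h1 : coeff (x.sumElim γ) (realizeLam (g - gM)) = 0 := by
    refine coeff_realizeLam_eq_zero _ fun β δ hδ => ?_
    have hle : δ.degree ≤ M := Finsupp.degree_mono hδ
    rw [map_sub, hg, hgM, map_sum, Finset.sum_eq_single δ.degree, sub_self]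
    · intro N _ hne
      by_contra hc
      exact hne (hG' _ _ _ _ hc).symm
    · intro hn
      exact absurd (Finset.mem_range.2 (by omega)) hn
  have h2 : realizeLam gM = f - (S (M + 1)).1 := by
    have : ∀ K, ∑ N ∈ Finset.range K, realizeLam (G N (S N)) = f - (S K).1 := by
      intro K
      induction K with
      | zero => simp [S]
      | succ K ih =>
        rw [Finset.sum_range_succ, ih, hS]
        ring
    rw [hgM, map_sum, this]
  rw [map_sub, map_sub, h2, map_sub, (S (M + 1)).2.2 x γ (by omega), sub_zero, sub_eq_zero] at h1
  exact h1

/-! ### Back stable limits -/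

/-- The row parameters `1 - x_i` as power series. -/
def serX (i : ℤ) : Series := 1 - MvPowerSeries.X (Sum.inl i)

/-- The column parameters `1 / (1 - a_j)` as power series. -/
def serA (j : ℤ) : Series := Ring.inverse (1 - MvPowerSeries.X (Sum.inr j))

theorem isUnit_one_sub_X {σ : Type*} (s : σ) :
    IsUnit (1 - MvPowerSeries.X s : MvPowerSeries σ ℤ) := by
  rw [MvPowerSeries.isUnit_iff_constantCoeff]
  simp

theorem realizeLam_a (j : ℤ) : realizeLam (LamHat.a j) = MvPowerSeries.X (Sum.inr j) :=
  (MvPowerSeries.substAlgHom_apply hasSubst_lamVal _).trans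
    (MvPowerSeries.subst_X hasSubst_lamVal _)

theorem realizePoly_X (i : ℤ) : realizePoly (MvPolynomial.X i) = MvPowerSeries.X (Sum.inl i) :=
  MvPolynomial.eval₂_X _ _ _

theorem realizePoly_C (g : LamHat) : realizePoly (MvPolynomial.C g) = realizeLam g :=
  MvPolynomial.eval₂_C _ _ _

theorem realizePoly_polyX (i : ℤ) : realizePoly (polyX i) = serX i := by
  rw [polyX, map_sub, map_one, realizePoly_X, serX]

theorem realizePoly_polyA (j : ℤ) : realizePoly (polyA j) = serA j := by
  rw [polyA, map_ringInverse _ (isUnit_one_sub_C_a j), map_sub, map_one, realizePoly_C,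
    realizeLam_a, serA]

theorem map_serA {B : Type*} [CommRing B] (f : Series →+* B) (j : ℤ) :
    f (serA j) = Ring.inverse (1 - f (MvPowerSeries.X (Sum.inr j))) := by
  rw [serA, map_ringInverse f (isUnit_one_sub_X _), map_sub, map_one]

/-- The partition function of the rows and columns `1 - k, …, n` as a power series. -/
def gridSeries (k n : ℕ) (v : Equiv.Perm ℤ) : Series := gridSum serX serA (1 - k) (k + n) v

/-- A monomial without x_{-k} and a_{-k} is unaffected by setting both to zero. The new corner then
has parameter 1 and `gridSum_unit_corner` removes the added row and column. -/
theorem gridSeries_succ {k n : ℕ} (hk : n ≤ k) {v : Equiv.Perm ℤ} (hv : SuppIn (1 - n) n v)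
    {d : ℤ ⊕ ℤ →₀ ℕ} (h1 : d (Sum.inl (-k)) = 0) (h2 : d (Sum.inr (-k)) = 0) :
    coeff d (gridSeries (k + 1) n v) = coeff d (gridSeries k n v) := by
  let e : {s : ℤ ⊕ ℤ // s ≠ Sum.inl (-(k : ℤ)) ∧ s ≠ Sum.inr (-(k : ℤ))} ↪ ℤ ⊕ ℤ :=
    Function.Embedding.subtype _
  obtain ⟨u, rfl⟩ : ∃ u, Finsupp.embDomain e u = d := by
    rw [← Set.mem_range, Finsupp.mem_range_embDomain_iff]
    intro s hs
    rw [Finset.mem_coe, Finsupp.mem_support_iff] at hs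
    refine ⟨⟨s, ?_, ?_⟩, rfl⟩ <;> rintro rfl <;> contradiction
  rw [← MvPowerSeries.coeff_killCompl, ← MvPowerSeries.coeff_killCompl]
  congr 1
  have hX : MvPowerSeries.killCompl (R := ℤ) e (MvPowerSeries.X (Sum.inl (-(k : ℤ)))) = 0 :=
    MvPowerSeries.killCompl_X_eq_zero (by rintro ⟨⟨s, h, h'⟩, rfl⟩; exact h rfl)
  have hA : MvPowerSeries.killCompl (R := ℤ) e (MvPowerSeries.X (Sum.inr (-(k : ℤ)))) = 0 :=
    MvPowerSeries.killCompl_X_eq_zero (by rintro ⟨⟨s, h, h'⟩, rfl⟩; exact h' rfl)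
  have hp : (1 - ((k + 1 : ℕ) : ℤ)) = -k := by push_cast; ring
  have hp' : (1 - k : ℤ) = -k + 1 := by ring
  have h := map_gridSum (MvPowerSeries.killCompl (R := ℤ) e).toRingHom serX serA
  simp only [AlgHom.toRingHom_eq_coe, RingHom.coe_coe] at h
  rw [gridSeries, gridSeries, h, h, hp, hp', Nat.add_right_comm, gridSum_unit_corner]
  · refine hv _ ?_
    rw [Set.mem_Icc]
    omega
  · have := map_serA (MvPowerSeries.killCompl (R := ℤ) e).toRingHom (-k)
    simp only [AlgHom.toRingHom_eq_coe, RingHom.coe_coe] at this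
    rw [this, hA, serX, map_sub, hX, map_one]
    simp

theorem coeff_gridSeries {n : ℕ} {v : Equiv.Perm ℤ} (hv : SuppIn (1 - n) n v)
    (d : ℤ ⊕ ℤ →₀ ℕ) : ∃ K, n ≤ K ∧ ∀ k, K ≤ k →
      coeff d (gridSeries k n v) = coeff d (gridSeries K n v) := by
  classical
  set N := ∑ s ∈ d.support, (s.elim Int.natAbs Int.natAbs) with hN
  refine ⟨n + N + 1, by omega, fun k hk => ?_⟩
  induction k, hk using Nat.le_induction with
  | base => rfl
  | succ k hk ih =>
    have key : ∀ s : ℤ ⊕ ℤ, s.elim Int.natAbs Int.natAbs = k → d s = 0 := by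
      intro s hs
      by_contra hc
      have := Finset.single_le_sum (f := fun s : ℤ ⊕ ℤ => s.elim Int.natAbs Int.natAbs)
        (fun _ _ => Nat.zero_le _) (Finsupp.mem_support_iff.2 hc)
      simp only [hs] at this
      omega
    rw [gridSeries_succ (by omega) hv (key _ (by simp)) (key _ (by simp)), ih]

theorem exists_gridSeries_limit {n : ℕ} {v : Equiv.Perm ℤ} (hv : SuppIn (1 - n) n v) :
    ∃ F : Series, ∀ d, ∃ K, n ≤ K ∧ ∀ k, K ≤ k → coeff d (gridSeries k n v) = coeff d F := by
  choose K hK hK' using coeff_gridSeries hv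
  exact ⟨fun d => coeff d (gridSeries (K d) n v), fun d => ⟨K d, hK d, hK' d⟩⟩

/-- The exchange relations for `X` and for the interchanged parameters add up to a multiple of the
difference, in which the terms with `v * Equiv.swap i (i + 1)` cancel. -/
theorem gridSum_swap {A : Type*} [CommRing A] [NoZeroDivisors A] (X α : ℤ → A) {p : ℤ} {m : ℕ}
    {v : Equiv.Perm ℤ} {i : ℤ} (hp : p ≤ i) (hm : i + 1 < p + m) (hi : v i < v (i + 1))
    (hX : X i ≠ X (i + 1)) :
    gridSum (fun k => X (Equiv.swap i (i + 1) k)) α p m v = gridSum X α p m v := by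
  have h1 := gridSum_exchange X α p m v hp hm hi
  have h2 := gridSum_exchange (fun k => X (Equiv.swap i (i + 1) k)) α p m v hp hm hi
  simp only [Equiv.swap_apply_self, Equiv.swap_apply_left, Equiv.swap_apply_right] at h2
  have h : (X i - X (i + 1)) *
      (gridSum (fun k => X (Equiv.swap i (i + 1) k)) α p m v - gridSum X α p m v) = 0 := by
    linear_combination -h1 - h2
  exact sub_eq_zero.1 ((mul_eq_zero.1 h).resolve_left (sub_ne_zero.2 hX))

theorem killCompl_swapX_gridSeries {k n : ℕ} {v : Equiv.Perm ℤ}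
    (h0 : StrictMonoOn v (Set.Iic 0)) {i : ℤ} (hi : i < 0) (hk : -k < i) :
    MvPowerSeries.killCompl (swapX i) (gridSeries k n v) = gridSeries k n v := by
  have h := map_gridSum (MvPowerSeries.killCompl (R := ℤ) (swapX i)).toRingHom serX serA
  have hA := map_serA (MvPowerSeries.killCompl (R := ℤ) (swapX i)).toRingHom
  simp only [AlgHom.toRingHom_eq_coe, RingHom.coe_coe] at h hA
  have hA' : ∀ j, MvPowerSeries.killCompl (swapX i) (serA j) = serA j := by
    intro j
    have := MvPowerSeries.killCompl_X (R := ℤ) (e := swapX i) (Sum.inr j)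
    rw [swapX_inr] at this
    rw [hA, this, serA]
  have hX' : ∀ j, MvPowerSeries.killCompl (swapX i) (serX j) = serX (Equiv.swap i (i + 1) j) := by
    intro j
    have := MvPowerSeries.killCompl_X (R := ℤ) (e := swapX i) (Sum.inl (Equiv.swap i (i + 1) j))
    rw [swapX_inl, Equiv.swap_apply_self] at this
    rw [serX, map_sub, map_one, this, serX]
  rw [gridSeries, h]
  simp only [hA', hX']
  refine gridSum_swap serX serA (by omega) (by push_cast; omega)
    (h0 (Set.mem_Iic.2 (by omega)) (Set.mem_Iic.2 (by omega)) (by omega)) ?_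
  intro hc
  have := congrArg (coeff (Finsupp.single (Sum.inl i) 1)) hc
  classical
  simp [serX, MvPowerSeries.coeff_X, MvPowerSeries.coeff_one, Finsupp.single_left_inj] at this

/-- For a Grassmannian permutation the rows 1, ..., `n` have weight 1, and `upperSum` contains no
parameter of a positive row. -/
theorem gridSum_congr_nonpos {A : Type*} [CommRing A] {X Y : ℤ → A} (hXY : ∀ i ≤ 0, X i = Y i)
    (α : ℤ → A) {k n : ℕ} {v : Equiv.Perm ℤ} (hv : SuppIn (1 - k) n v)
    (h0 : StrictMonoOn v (Set.Iic 0)) (h1 : StrictMonoOn v (Set.Ioi 0)) :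
    gridSum X α (1 - k) (k + n) v = gridSum Y α (1 - k) (k + n) v := by
  set f : ℤ → Option ℤ := fun j => if v.symm j ≤ 0 then some (v.symm j) else none with hf
  have hfs : ∀ j b, f j = some b ↔ b ≤ 0 ∧ v b = j := by
    intro j b
    rw [← Equiv.eq_symm_apply, hf]
    simp only
    split_ifs with h
    · rw [Option.some_inj]
      constructor
      · rintro rfl
        exact ⟨h, rfl⟩
      · exact fun h => h.2.symm
    · simp only [false_iff]
      rintro ⟨h1, rfl⟩
      exact h h1
  have hs : ((upInts (1 - k) (k + n)).map f).reduceOption = upInts (1 - k) k := by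
    have hpw : ((upInts (1 - k) (k + n)).map f).reduceOption.Pairwise (· < ·) := by
      rw [List.reduceOption, List.filterMap_map, List.pairwise_filterMap]
      refine (pairwise_lt_upInts _ _).imp fun {a b} hab x hx y hy => ?_
      obtain ⟨hx', rfl⟩ := (hfs _ _).1 hx
      obtain ⟨hy', rfl⟩ := (hfs _ _).1 hy
      exact (h0.lt_iff_lt hx' hy').1 hab
    refine List.Perm.eq_of_pairwise (fun a b _ _ h h' => absurd h (lt_asymm h')) hpw
      (pairwise_lt_upInts _ _) ?_
    refine (List.perm_ext_iff_of_nodup (hpw.imp ne_of_lt) (upInts_nodup _ _)).2 fun x => ?_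
    rw [List.reduceOption_mem_iff, List.mem_map]
    constructor
    · rintro ⟨j, hj, hx⟩
      obtain ⟨hx, rfl⟩ := (hfs _ _).1 hx
      rw [mem_upInts] at hj ⊢
      refine ⟨?_, by omega⟩
      by_contra hlt
      have := hv x (by rw [Set.mem_Icc]; omega)
      omega
    · intro hx
      rw [mem_upInts] at hx
      refine ⟨v x, ?_, (hfs _ _).2 ⟨by omega, rfl⟩⟩
      have := hv.mem (i := x) (Set.mem_Icc.2 (by omega))
      rw [Set.mem_Icc] at this
      rw [mem_upInts]
      push_cast
      omega
  have hs' : ((upInts (1 - k) (k + n)).map f).map Option.isSome =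
      (upInts (1 - k) (k + n)).map fun j => decide (v.symm j ≤ 0) := by
    rw [List.map_map]
    refine List.map_congr_left fun j _ => ?_
    simp only [hf, Function.comp_apply]
    split_ifs with h <;> simp [h]
  rw [gridSum_eq_upperSum X α hv h0 h1 hs hs', gridSum_eq_upperSum Y α hv h0 h1 hs hs', upperSum,
    upperSum]
  congr 1
  refine List.map_congr_left fun i hi => ?_
  rw [mem_downInts] at hi
  rw [hXY i hi.2]

theorem isHomog_gridSeries {k n : ℕ} {v : Equiv.Perm ℤ} (hv : SuppIn (1 - k) n v)
    (h0 : StrictMonoOn v (Set.Iic 0)) (h1 : StrictMonoOn v (Set.Ioi 0)) {i : ℤ} (hi : 0 < i) :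
    IsHomog (Finsupp.applyAddHom (Sum.inl i)) (gridSeries k n v) 0 := by
  classical
  let e : {s : ℤ ⊕ ℤ // s ≠ Sum.inl i} ↪ ℤ ⊕ ℤ := Function.Embedding.subtype _
  -- `κ` sets x_i to zero; a series that it fixes does not involve x_i.
  set κ : Series →+* Series :=
    ((MvPowerSeries.rename (R := ℤ) e).comp (MvPowerSeries.killCompl e)).toRingHom with hκ
  have hκa : ∀ f, κ f = MvPowerSeries.rename e (MvPowerSeries.killCompl e f) := fun f => rfl
  have hκX : ∀ s, s ≠ Sum.inl i → κ (MvPowerSeries.X s) = MvPowerSeries.X s := by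
    intro s hs
    have := MvPowerSeries.killCompl_X (R := ℤ) (e := e) ⟨s, hs⟩
    rw [hκa, show (MvPowerSeries.X s : Series) = MvPowerSeries.X (e ⟨s, hs⟩) from rfl, this,
      MvPowerSeries.rename_X]
  have h : κ (gridSeries k n v) = gridSeries k n v := by
    rw [gridSeries, map_gridSum]
    have hA : ∀ j, κ (serA j) = serA j := by
      intro j
      rw [map_serA, hκX _ (by simp), serA]
    simp only [hA]
    refine gridSum_congr_nonpos (fun j hj => ?_) _ hv h0 h1
    rw [serX, map_sub, map_one, hκX _ (by simp only [ne_eq, Sum.inl.injEq]; omega)]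
  intro d hd
  by_contra hc
  refine hd ?_
  rw [← h, hκa]
  refine MvPowerSeries.coeff_rename_eq_zero _ _ ?_
  rintro ⟨u, rfl⟩
  refine hc ?_
  rw [Finsupp.applyAddHom_apply, Finsupp.mapDomain_of_notMem_range]
  rintro ⟨⟨s, hs⟩, rfl⟩
  exact hs rfl

/-- Symmetry in x_i, x_{i+1} and independence of positive indices hold at finite level, are
inherited coefficientwise by the limit, and put it into the image of `realizeLam`. -/
theorem exists_realizeLam_gridSeries (μ : YoungDiagram) {n : ℕ}
    (hv : SuppIn (1 - n) n (grassPerm μ)) : ∃ g : LamHat, ∀ d, ∃ K, n ≤ K ∧ ∀ k, K ≤ k →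
      coeff d (gridSeries k n (grassPerm μ)) = coeff d (realizeLam g) := by
  obtain ⟨F, hF⟩ := exists_gridSeries_limit hv
  have hFs : IsBackSymm F := by
    constructor
    · intro i hi d hd
      obtain ⟨K, hK, h⟩ := hF d
      rw [← h K le_rfl] at hd
      exact isHomog_gridSeries (hv.mono (by omega) le_rfl) (grassPerm_strictMonoOn_Iic μ)
        (grassPerm_strictMonoOn_Ioi μ) hi d hd
    · intro i hi
      ext d
      obtain ⟨K, -, h⟩ := hF d
      obtain ⟨K', -, h'⟩ := hF (d.embDomain (swapX i))
      -- `k` lies beyond both stabilization bounds and is large enough for rows `i` and `i + 1` to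
      -- belong to the square.
      obtain ⟨k, hk1, hk2, hk3⟩ : ∃ k : ℕ, K ≤ k ∧ K' ≤ k ∧ -(k : ℤ) < i :=
        ⟨K + K' + i.natAbs + 1, by omega, by omega, by omega⟩
      rw [MvPowerSeries.coeff_killCompl, ← h k hk1, ← h' k hk2, ← MvPowerSeries.coeff_killCompl,
        killCompl_swapX_gridSeries (grassPerm_strictMonoOn_Iic μ) hi hk3]
  obtain ⟨g, rfl⟩ := hFs.exists_realizeLam
  exact ⟨g, hF⟩

/-! ### Coefficientwise limits and back stable polynomials -/

/-- The coefficients of the series `φ (p, q)` are eventually those of `f` as `p → -∞` and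
`q → ∞`. -/
def HasCoeffLimit (φ : ℤ × ℤ → Series) (f : Series) : Prop :=
  ∀ d, ∀ᶠ pq : ℤ × ℤ in Filter.atBot ×ˢ Filter.atTop, coeff d (φ pq) = coeff d f

theorem HasCoeffLimit.const_mul {φ : ℤ × ℤ → Series} {f : Series} (h : HasCoeffLimit φ f)
    (c : Series) : HasCoeffLimit (fun pq => c * φ pq) (c * f) := by
  classical
  intro d
  have := (Filter.eventually_all_finset (Finset.HasAntidiagonal.antidiagonal d)).2 fun t _ => h t.2
  filter_upwards [this] with pq hpq
  rw [MvPowerSeries.coeff_mul, MvPowerSeries.coeff_mul]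
  exact Finset.sum_congr rfl fun t ht => by rw [hpq t ht]

theorem HasCoeffLimit.sum {ι : Type*} {s : Finset ι} {φ : ι → ℤ × ℤ → Series} {f : ι → Series}
    (h : ∀ i ∈ s, HasCoeffLimit (φ i) (f i)) :
    HasCoeffLimit (fun pq => ∑ i ∈ s, φ i pq) (∑ i ∈ s, f i) := by
  intro d
  have := (Filter.eventually_all_finset s).2 fun i hi => h i hi d
  filter_upwards [this] with pq hpq
  rw [map_sum, map_sum]
  exact Finset.sum_congr rfl hpq

theorem HasCoeffLimit.congr {φ ψ : ℤ × ℤ → Series} {f : Series} (h : HasCoeffLimit φ f) {p q : ℤ}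
    (hψ : ∀ p' ≤ p, ∀ q' ≥ q, ψ (p', q') = φ (p', q')) : HasCoeffLimit ψ f := by
  intro d
  filter_upwards [h d, (Filter.eventually_le_atBot p).prod_mk (Filter.eventually_ge_atTop q)]
    with pq h1 h2
  rw [← h1]
  exact congrArg _ (hψ _ h2.1 _ h2.2)

theorem HasCoeffLimit.unique {φ : ℤ × ℤ → Series} {f g : Series} (hf : HasCoeffLimit φ f)
    (hg : HasCoeffLimit φ g) : f = g := by
  ext d
  obtain ⟨pq, h1, h2⟩ := ((hf d).and (hg d)).exists
  rw [← h1, h2]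

theorem isBackStableLimit_iff {w : Equiv.Perm ℤ} {f : BackRing} : IsBackStableLimit w f ↔
    HasCoeffLimit (fun pq => realizePoly (doubleGroth pq.1 pq.2 w)) (realize f) := by
  simp only [IsBackStableLimit, HasCoeffLimit, realize_ofPoly]

theorem IsBackStableLimit.existsUnique {w : Equiv.Perm ℤ} {f : BackRing}
    (hf : IsBackStableLimit w f) : ∃! f, IsBackStableLimit w f :=
  ⟨f, hf, fun _ hg => realize_injective
    ((isBackStableLimit_iff.1 hg).unique (isBackStableLimit_iff.1 hf))⟩

theorem IsBackStableLimit.backGroth_eq {w : Equiv.Perm ℤ} {f : BackRing}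
    (hf : IsBackStableLimit w f) : backGroth w = f :=
  hf.existsUnique.unique (Classical.epsilon_spec ⟨f, hf⟩) hf

theorem exists_isBackStableLimit_grassPerm (μ : YoungDiagram) :
    ∃ g : LamHat, IsBackStableLimit (grassPerm μ) (algebraMap LamHat BackRing g) := by
  set n := max (μ.rowLen 0) (μ.colLen 0) with hn
  have hv : SuppIn (1 - n) n (grassPerm μ) :=
    suppIn_grassPerm (le_max_left _ _) (le_max_right _ _)
  obtain ⟨g, hg⟩ := exists_realizeLam_gridSeries μ hv
  refine ⟨(-1) ^ len (grassPerm μ) * g, isBackStableLimit_iff.2 ?_⟩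
  rw [realize_algebraMap, map_mul, map_pow, map_neg, map_one]
  have h : HasCoeffLimit (fun pq => gridSeries (1 - pq.1).toNat n (grassPerm μ)) (realizeLam g) := by
    intro d
    obtain ⟨K, -, hK⟩ := hg d
    filter_upwards [(Filter.eventually_le_atBot (1 - K : ℤ)).prod_mk
      (Filter.eventually_ge_atTop (0 : ℤ))] with pq h
    exact hK _ (by have := h.1; omega)
  refine (h.const_mul ((-1) ^ len (grassPerm μ))).congr (p := 1 - n) (q := n) fun p hp q hq => ?_
  obtain ⟨k, rfl⟩ : ∃ k : ℕ, p = 1 - k := ⟨(1 - p).toNat, by omega⟩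
  obtain ⟨t, rfl⟩ : ∃ t : ℕ, q = n + t := ⟨(q - n).toNat, by omega⟩
  have hk : (1 - (1 - (k : ℤ))).toNat = k := by omega
  simp only [hk]
  rw [map_doubleGroth realizePoly (by omega) t hv]
  simp only [realizePoly_polyX, realizePoly_polyA, gridSeries]

/-- The limit for w_μ already lies in Λ̂(x‖a), where η_a is the identity, so it coincides with its
own K-Stanley function. -/
theorem isBackStableLimit_kStanleyGrass (μ : YoungDiagram) :
    IsBackStableLimit (grassPerm μ) (algebraMap LamHat BackRing (kStanleyGrass μ)) := by
  obtain ⟨g, hg⟩ := exists_isBackStableLimit_grassPerm μ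
  have : kStanleyGrass μ = g := by
    rw [kStanleyGrass, kStanley, hg.backGroth_eq]
    exact etaA.commutes g
  rwa [this]

theorem isUnit_one_sub_backRing_a (j : ℤ) : IsUnit (1 - BackRing.a j) := by
  have h := (LamHat.isUnit_one_sub_a j).map (algebraMap LamHat BackRing)
  rwa [map_sub, map_one] at h

theorem realize_wt {n : ℕ} (D : Filling n) : realize (wt D) =
    weightAt (fun i => realizePoly (MvPolynomial.X i))
      (fun j => realizePoly (MvPolynomial.C (LamHat.a j))) D := by
  refine (map_weightAt realize BackRing.x isUnit_one_sub_backRing_a D).trans ?_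
  congr 1
  · funext i
    exact realize_ofPoly _
  · funext j
    exact (realize_algebraMap _).trans (realizePoly_C _).symm

/-- The expansion of the back stable double Grothendieck polynomial of `w` into double `K`-Stanley
functions of partitions. -/
def pipedreamSum (n : ℕ) (w : Equiv.Perm ℤ) : BackRing :=
  (-1) ^ len w * ∑ D ∈ rectBPDs n w,
    (-1) ^ (shape D).card * wt D * algebraMap LamHat BackRing (kStanleyGrass (shape D))

/-- The finite expansion converges term by term. This proves at once that the limit for `w` exists
and what it is. -/
theorem isBackStableLimit_pipedreamSum {n : ℕ} {w : Equiv.Perm ℤ} (hw : SuppIn 1 n w) :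
    IsBackStableLimit w (pipedreamSum n w) := by
  rw [isBackStableLimit_iff, pipedreamSum]
  simp only [map_mul, map_sum, map_pow, map_neg, map_one]
  refine (HasCoeffLimit.const_mul (HasCoeffLimit.sum fun D _ => HasCoeffLimit.const_mul
    (isBackStableLimit_iff.1 (isBackStableLimit_kStanleyGrass (shape D))) _) _).congr
      (p := 1 - n) (q := n) fun p hp q hq => ?_
  simp only [realize_wt]
  exact map_doubleGroth_eq_sum_rectBPDs realizePoly hw hp hq

theorem etaA_pipedreamSum (n : ℕ) (w : Equiv.Perm ℤ) :
    etaA (pipedreamSum n w) = (-1) ^ len w * ∑ D ∈ rectBPDs n w,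
      (-1) ^ (shape D).card * etaA (wt D) * kStanleyGrass (shape D) := by
  rw [pipedreamSum]
  simp only [map_mul, map_sum, map_pow, map_neg, map_one]
  refine congrArg _ (Finset.sum_congr rfl fun D _ => congrArg _ ?_)
  exact etaA.commutes _

end

end BackStable

/-! ### The theorem -/

theorem mainTheorem8 (n : ℕ) (w : Equiv.Perm ℤ) (hw : ∀ i : ℤ, i ∉ Set.Icc 1 (n : ℤ) → w i = i) :
    ((∃! f : BackRing, IsBackStableLimit w f) ∧
      ∀ μ : YoungDiagram, ∃! f : BackRing, IsBackStableLimit (grassPerm μ) f) ∧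
    backGroth w = (-1) ^ len w * ∑ D ∈ rectBPDs n w,
      (-1) ^ (shape D).card * wt D * algebraMap LamHat BackRing (kStanleyGrass (shape D)) ∧
    kStanley w = (-1) ^ len w * ∑ D ∈ rectBPDs n w,
      (-1) ^ (shape D).card * etaA (wt D) * kStanleyGrass (shape D) := by
  have h := isBackStableLimit_pipedreamSum (n := n) (w := w) hw
  refine ⟨⟨h.existsUnique, fun μ => (isBackStableLimit_kStanleyGrass μ).existsUnique⟩,
    h.backGroth_eq, ?_⟩
  rw [kStanley, h.backGroth_eq, etaA_pipedreamSum]
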